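/- **Setting.** There are $K$ arms. In each round $t\ge 1$ a context and reward vector $(x_t,r_t)$, $r_t\in[0,1]^K$, are drawn i.i.d. from an unknown law $D$; $D_{\mathcal X}$ is the marginal on contexts, $f^*(x,a)=\mathbb E[r_t(a)\mid x_t=x]\in[0,1]$, $\pi^*(x)\in\arg\max_a f^*(x,a)$. The learner picks $a_t$, observes $r_t(a_t)$, and its regret is $R_T=\sum_{t=1}^T\big(r_t(\pi^*(x_t))-r_t(a_t)\big)$. For a probability kernel $p(a|x)$ let $D(p)$ be the law of $(x,a,r(a))$ with $(x,r)\sim D$, $a\sim p(\cdot|x)$. Let $\mathcal F$ be a class of models $f:\mathcal X\to[0,1]^K$, and $\mathcal K(\mathcal F)$ the set of kernels of the form $p(a|x)=g(a|f(x))$ with $f\in\mathcal F$ and $g$ a probability kernel. **Assumption on the regression algorithm** (it is possibly randomized and outputs models in $\mathcal F$). For some constant $B\ge 0$, for all $p\in\mathcal K(\mathcal F)$, $n\ge1$, $\zeta\in(0,1)$: with probability at least $1-\zeta$ the model $\hat f$ fitted on $n$ i.i.d. samples from $D(p)$ satisfies $\mathbb E_{x\sim D_{\mathcal X}}\mathbb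 E_{a\sim p(\cdot|x)}[(\hat f(x,a)-f^*(x,a))^2]\le B+\xi(n,\zeta)$. Here $\xi$ is a known rate that is valid: for every $c\in(0,1)$, $\xi(n,c/\ln n)$ is non-increasing over the integers $n\ge2$ with $c/\ln n<1$; and $\xi(n,\zeta)\ge\ln(1/\zeta)/n$ for all $n\ge1$, $\zeta\in(0,1)$. **Algorithm (Safe-FALCON).** Inputs: an integer $\tau_1\ge2$, $\delta\in(0,1)$, $\xi$ and the regression algorithm (not $B$). Put $\delta'=\delta/13$, $\tau_0=0$, $\tau_{m+1}=2\tau_m$ for $m\ge1$; epoch $m$ consists of the rounds $\tau_{m-1}<t\le\tau_m$, and $m(t)$ is the epoch containing $t$. Let $\hat f_1\equiv0$, $\gamma_1=1$ and, for $m\ge2$, $\gamma_m=\sqrt{1/8}\,\sqrt{K/\xi(\tau_{m-1}-\tau_{m-2},\delta'/m^2)}$. With $\hat a\in\arg\max_a\hat f_m(x,a)$ let $p_m(a|x)=1/\big(K+\gamma_m(\hat f_m(x,\hat a)-\hat f_m(x,a))\big)$ for $a\ne\hat a$, and let $p_m(\hat a|x)$ be the remaining mass. The status starts as safe, $l_0=0$,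 $\hat m=0$. While the status is safe, $a_t\sim p_{m(t)}(\cdot|x_t)$. In an epoch $m\ge2$, after each round $t=\tau_{m-1}+2^j$ ($j=0,1,\dots$) of the epoch and after $t=\tau_m$, the status becomes not safe, for ever, if $\sum_{i\le t}r_i(a_i)<L_t$, where $$L_t=t\,l_{m-1}-\tau_1-\sqrt{2t\ln\tfrac{\lceil m+\log_2\tau_1\rceil^3}{\delta'}}-20.3\sqrt K\sum_{i=\tau_1+1}^{t}\sqrt{\xi\Big(\tau_{m(i)-1}-\tau_{m(i)-2},\tfrac{\delta'}{m(i)^2}\Big)}.$$ If the status is safe at the end of epoch $m$, then, with $S_m$ the data of the epoch and $l_m'$ the average reward in $S_m$ minus $\sqrt{\ln(m^2/\delta')/(2|S_m|)}$, put $l_m=\max(l_{m-1},l'_m)$, put $\hat m=m$ if $l_m\ne l_{m-1}$, and let $\hat f_{m+1}$ be the output of the regression algorithm on $S_m$. Once the status is not safe, $a_t\sim p_{\hat m}(\cdot|x_t)$. **Theorem.** Write $\mathcal R_T(c)=\sqrt{KB}\,T+\sqrt K\sum_{t=\tau_1+1}^T\sqrt{\xi\big(\tau_{m(t)-1}-\tau_{m(t)-2},\,c/m(t)^2\big)}$.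 There is a universal constant $C>0$ such that, under the assumption above and if $\delta\ln\tau_1\le100$: 1. for every $T$, with probability at least $1-\delta$, $R_T\le C\,\big(\tau_1+\mathcal R_T(\delta/13)\big)$ and, if $T\ge\tau_1^2$, $R_T\le C\,\mathcal R_T(\delta/13)$; 2. if moreover $\kappa\ge1$ and $\xi(n,\zeta/13)\le\kappa\,\xi(n,\zeta)$ for all $n\ge1$ and $\zeta\in(0,1/4]$ (for rates proportional to $\ln(1/\zeta)$ one can take $\kappa=3$), then for every $T$, with probability at least $1-\delta$, $R_T\le C\sqrt\kappa\,\big(\tau_1+\mathcal R_T(\delta)\big)$ and, if $T\ge\tau_1^2$, $R_T\le C\sqrt\kappa\,\mathcal R_T(\delta)$. -/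

import Mathlib

open MeasureTheory ProbabilityTheory

noncomputable section

namespace SafeFalcon

/-! ### The contextual bandit -/

/-- The law `D(p)` of `(x, a, r(a))`, where `(x, r) ∼ D` and then `a ∼ p(· | x)`. -/
def inducedLaw {X : Type*} [MeasurableSpace X] {K : ℕ} (D : Measure (X × (Fin K → ℝ)))
    (p : X → Fin K → ℝ) : Measure (X × Fin K × ℝ) :=
  ∑ a : Fin K, (D.withDensity (fun z => ENNReal.ofReal (p z.1 a))).map
    (fun z => (z.1, a, z.2 a))

/-- `E_{x ∼ D_X} E_{a ∼ p(·|x)} [(f(x,a) - g(x,a))²]`, with `D_X` the marginal on contexts. -/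
def meanSqError {X : Type*} [MeasurableSpace X] {K : ℕ} (D : Measure (X × (Fin K → ℝ)))
    (p f g : X → Fin K → ℝ) : ℝ :=
  ∫ x, ∑ a : Fin K, p x a * (f x a - g x a) ^ 2 ∂(D.map Prod.fst)

/-- The set `K(F)` of the probability kernels that depend on the context through a model of `F`. -/
def kernelClass {X : Type*} {K : ℕ} (F : Set (X → Fin K → ℝ)) : Set (X → Fin K → ℝ) :=
  {p | ∃ f ∈ F, ∃ g : (Fin K → ℝ) → Fin K → ℝ,
    Measurable g ∧ (∀ v, g v ∈ stdSimplex ℝ (Fin K)) ∧ ∀ x a, p x a = g (f x) a}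

/-- `fstar` is a `[0,1]`-valued version of the conditional mean reward `x, a ↦ E[r(a) | x]`. -/
structure IsMeanReward {X : Type*} [MeasurableSpace X] {K : ℕ} (D : Measure (X × (Fin K → ℝ)))
    (fstar : X → Fin K → ℝ) : Prop where
  measurable : Measurable fstar
  mem_Icc : ∀ x a, fstar x a ∈ Set.Icc (0 : ℝ) 1
  condExp_eq : ∀ a, D[fun z => z.2 a | MeasurableSpace.comap Prod.fst inferInstance]
    =ᵐ[D] fun z => fstar z.1 a

/-- `pol` is a policy maximizing `fstar x ·` at every context `x`. -/
structure IsOptimalPolicy {X : Type*} [MeasurableSpace X] {K : ℕ} (fstar : X → Fin K → ℝ)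
    (pol : X → Fin K) : Prop where
  measurable : Measurable pol
  le : ∀ x a, fstar x a ≤ fstar x (pol x)

/-! ### The regression oracle -/

/-- A valid estimation rate. In the first condition `n` runs over the integers for which the
confidence level `c / ln n` lies in `(0,1)`. -/
structure ValidRate (ξ : ℕ → ℝ → ℝ) : Prop where
  antitone : ∀ c ∈ Set.Ioo (0 : ℝ) 1, ∀ n n' : ℕ, 2 ≤ n → n ≤ n' → c < Real.log n →
    ξ n' (c / Real.log n') ≤ ξ n (c / Real.log n)
  lower : ∀ n : ℕ, 1 ≤ n → ∀ ζ ∈ Set.Ioo (0 : ℝ) 1, Real.log (1 / ζ) / n ≤ ξ n ζ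

/-- A (possibly randomized) regression algorithm over `F`: it maps a sample size `n`, a random
seed and `n` observations to a model of `F`. -/
structure IsRegression {X W : Type*} [MeasurableSpace X] [MeasurableSpace W] {K : ℕ}
    (F : Set (X → Fin K → ℝ))
    (reg : (n : ℕ) → W → (Fin n → X × Fin K × ℝ) → X → Fin K → ℝ) : Prop where
  mem : ∀ n w s, reg n w s ∈ F
  measurable : ∀ n, Measurable
    (fun q : (W × (Fin n → X × Fin K × ℝ)) × X => reg n q.1.1 q.1.2 q.2)

/-- For every `p ∈ K(F)`, `n ≥ 1` and `ζ ∈ (0,1)`: the model fitted on `n` i.i.d. samples from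
`D(p)` has mean squared error at most `B + ξ(n, ζ)`, with probability at least `1 - ζ`. -/
def RegressionGuarantee {X W : Type*} [MeasurableSpace X] [MeasurableSpace W] {K : ℕ}
    (D : Measure (X × (Fin K → ℝ))) (ρ : Measure W) (F : Set (X → Fin K → ℝ))
    (reg : (n : ℕ) → W → (Fin n → X × Fin K × ℝ) → X → Fin K → ℝ)
    (fstar : X → Fin K → ℝ) (B : ℝ) (ξ : ℕ → ℝ → ℝ) : Prop :=
  ∀ p ∈ kernelClass F, ∀ n : ℕ, 1 ≤ n → ∀ ζ ∈ Set.Ioo (0 : ℝ) 1,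
    ENNReal.ofReal (1 - ζ) ≤
      (ρ.prod (Measure.pi fun _ : Fin n => inducedLaw D p))
        {q | meanSqError D p (reg n q.1 q.2) fstar ≤ B + ξ n ζ}

/-! ### The epoch schedule -/

/-- Last round of epoch `m`: `τ_0 = 0` and `τ_{m+1} = 2 τ_m` for `m ≥ 1`. -/
def tau (τ₁ : ℕ) : ℕ → ℕ
  | 0 => 0
  | m + 1 => 2 ^ m * τ₁

/-- The epoch containing round `t`: `m(t) = min {m | t ≤ τ_m}`. -/
def epochOf (τ₁ t : ℕ) : ℕ := sInf {m | t ≤ tau τ₁ m}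

/-- `ξ(τ_{m-1} - τ_{m-2}, c / m²)`, for `m ≥ 2`. -/
def epochRate (ξ : ℕ → ℝ → ℝ) (τ₁ : ℕ) (c : ℝ) (m : ℕ) : ℝ :=
  ξ (tau τ₁ (m - 1) - tau τ₁ (m - 2)) (c / (m : ℝ) ^ 2)

/-! ### The algorithm -/

/-- The action selection kernel of parameter `γ`, as a function of the vector `v` of predicted
rewards; `pick v` is the predicted best action. -/
def actionKernel {K : ℕ} (pick : (Fin K → ℝ) → Fin K) (γ : ℝ) (v : Fin K → ℝ) (a : Fin K) : ℝ :=
  if a = pick v then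
    1 - ∑ b ∈ Finset.univ.erase (pick v), 1 / ((K : ℝ) + γ * (v (pick v) - v b))
  else 1 / ((K : ℝ) + γ * (v (pick v) - v a))

/-- Everything Safe-FALCON is given: initial epoch length, confidence parameter, rate,
regression algorithm, and a rule `pick` for selecting a maximal entry of a vector. -/
structure Algorithm (X W : Type*) (K : ℕ) where
  τ₁ : ℕ
  δ : ℝ
  ξ : ℕ → ℝ → ℝ
  reg : (n : ℕ) → W → (Fin n → X × Fin K × ℝ) → X → Fin K → ℝ
  pick : (Fin K → ℝ) → Fin K

namespace Algorithm

variable {X W : Type*} {K : ℕ} (A : Algorithm X W K)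

/-- The internal confidence parameter `δ' = δ / 13`. -/
def δ' : ℝ := A.δ / 13

/-- `γ_1 = 1` and `γ_m = √(1/8) √(K / ξ(τ_{m-1} - τ_{m-2}, δ'/m²))` for `m ≥ 2`. -/
def γ (m : ℕ) : ℝ :=
  if m ≤ 1 then 1 else √(1 / 8) * √((K : ℝ) / epochRate A.ξ A.τ₁ A.δ' m)

/- In what follows `h t = (x_t, a_t, r_t(a_t))` is the observation of round `t ≥ 1`, and `w t` is
a seed for a call of the regression algorithm at the end of round `t`. -/

/-- The data `S_m` collected in epoch `m`. -/
def epochData (h : ℕ → X × Fin K × ℝ) (m : ℕ) :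
    Fin (tau A.τ₁ m - tau A.τ₁ (m - 1)) → X × Fin K × ℝ :=
  fun i => h (tau A.τ₁ (m - 1) + 1 + i)

/-- The model `f̂_m`: zero for `m = 1`, and fitted on `S_{m-1}` for `m ≥ 2`. -/
def model (h : ℕ → X × Fin K × ℝ) (w : ℕ → W) : ℕ → X → Fin K → ℝ
  | 0 => 0
  | 1 => 0
  | m + 2 => A.reg _ (w (tau A.τ₁ (m + 1))) (A.epochData h (m + 1))

/-- The kernel `p_m`. -/
def kernel (h : ℕ → X × Fin K × ℝ) (w : ℕ → W) (m : ℕ) (x : X) (a : Fin K) : ℝ :=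
  actionKernel A.pick (A.γ m) (A.model h w m x) a

/-- `l'_m`: average reward of epoch `m`, minus the width of the confidence interval. -/
def lower' (h : ℕ → X × Fin K × ℝ) (m : ℕ) : ℝ :=
  (∑ t ∈ Finset.Ioc (tau A.τ₁ (m - 1)) (tau A.τ₁ m), (h t).2.2)
      / ((tau A.τ₁ m - tau A.τ₁ (m - 1) : ℕ) : ℝ)
    - √(1 / (2 * ((tau A.τ₁ m - tau A.τ₁ (m - 1) : ℕ) : ℝ)) * Real.log ((m : ℝ) ^ 2 / A.δ'))

/-- `l_0 = 0`, `l_m = max(l_{m-1}, l'_m)`. (The value of `l_m` has an effect only if the status is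
still safe at the end of epoch `m`.) -/
def lower (h : ℕ → X × Fin K × ℝ) : ℕ → ℝ
  | 0 => 0
  | m + 1 => max (lower h m) (A.lower' h (m + 1))

/-- `Crwd_t`, the cumulative reward up to round `t`. -/
def cumReward (h : ℕ → X × Fin K × ℝ) (t : ℕ) : ℝ := ∑ i ∈ Finset.Icc 1 t, (h i).2.2

/-- The threshold `L_t`, with `m = m(t)`. -/
def threshold (h : ℕ → X × Fin K × ℝ) (t : ℕ) : ℝ :=
  t * A.lower h (epochOf A.τ₁ t - 1) - A.τ₁
    - √(2 * t * Real.log ((⌈(epochOf A.τ₁ t : ℝ) + Real.logb 2 A.τ₁⌉₊ : ℝ) ^ 3 / A.δ'))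
    - 20.3 * √K * ∑ i ∈ Finset.Icc (A.τ₁ + 1) t, √(epochRate A.ξ A.τ₁ A.δ' (epochOf A.τ₁ i))

/-- The rounds after which the status is tested: in epochs `m ≥ 2`, the rounds `τ_{m-1} + 2^j`
and `τ_m`. -/
def IsTestRound (t : ℕ) : Prop :=
  2 ≤ epochOf A.τ₁ t ∧
    ((∃ j : ℕ, t = tau A.τ₁ (epochOf A.τ₁ t - 1) + 2 ^ j) ∨ t = tau A.τ₁ (epochOf A.τ₁ t))

/-- The status at the end of round `t` is safe. -/
def SafeAfter (h : ℕ → X × Fin K × ℝ) : ℕ → Prop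
  | 0 => True
  | t + 1 => SafeAfter h t ∧
      (A.IsTestRound (t + 1) → A.threshold h (t + 1) ≤ cumReward h (t + 1))

open Classical in
/-- `m̂` at the end of epoch `m`; it is updated only in epochs that end with the safe status. -/
def safeEpoch (h : ℕ → X × Fin K × ℝ) : ℕ → ℕ
  | 0 => 0
  | m + 1 =>
      if A.SafeAfter h (tau A.τ₁ (m + 1)) ∧ A.lower h (m + 1) ≠ A.lower h m then m + 1
      else safeEpoch h m

open Classical in
/-- The kernel from which the action of round `t ≥ 1` is drawn; it is a function of the
observations of the rounds before `t`. -/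
def roundKernel (h : ℕ → X × Fin K × ℝ) (w : ℕ → W) (t : ℕ) : X → Fin K → ℝ :=
  if A.SafeAfter h (t - 1) then A.kernel h w (epochOf A.τ₁ t)
  else A.kernel h w (A.safeEpoch h (epochOf A.τ₁ t - 1))

end Algorithm

/-! ### A run of the algorithm -/

/-- `draw q u` has law `q` for every probability vector `q`, if the seed `u` has law `ν`. -/
structure IsSampler {U : Type*} [MeasurableSpace U] {K : ℕ} (ν : Measure U)
    (draw : (Fin K → ℝ) → U → Fin K) : Prop where
  measurable : Measurable (fun q : (Fin K → ℝ) × U => draw q.1 q.2)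
  law : ∀ q ∈ stdSimplex ℝ (Fin K), ∀ a, ν {u | draw q u = a} = ENNReal.ofReal (q a)

/-- `(x_t, a_t, r_t(a_t))`, where `z t ω = (x_t, r_t)`. -/
def observation {X Ω : Type*} {K : ℕ} (z : ℕ → Ω → X × (Fin K → ℝ)) (act : ℕ → Ω → Fin K)
    (ω : Ω) (t : ℕ) : X × Fin K × ℝ :=
  ((z t ω).1, act t ω, (z t ω).2 (act t ω))

/-- The actions `act` are those of the algorithm `A` in the environment `D`: the triples formed by
`z t = (x_t, r_t) ∼ D`, the seed `u t ∼ ν` of the draw of the action, and the seed `w t ∼ ρ` of the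
regression algorithm are i.i.d. over rounds with independent components, and in each round
`t ≥ 1` the action is drawn from the kernel prescribed by `A`. -/
structure IsRun {X U W Ω : Type*} [MeasurableSpace X] [MeasurableSpace U] [MeasurableSpace W]
    [MeasurableSpace Ω] {K : ℕ} (A : Algorithm X W K) (D : Measure (X × (Fin K → ℝ)))
    (ν : Measure U) (ρ : Measure W) (draw : (Fin K → ℝ) → U → Fin K) (P : Measure Ω)
    (z : ℕ → Ω → X × (Fin K → ℝ)) (u : ℕ → Ω → U) (w : ℕ → Ω → W) (act : ℕ → Ω → Fin K) :
    Prop where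
  measurable : ∀ t, Measurable (fun ω => (z t ω, u t ω, w t ω))
  indep : iIndepFun (fun t ω => (z t ω, u t ω, w t ω)) P
  law : ∀ t, P.map (fun ω => (z t ω, u t ω, w t ω)) = D.prod (ν.prod ρ)
  action : ∀ t, 1 ≤ t → ∀ ω, act t ω =
    draw (A.roundKernel (observation z act ω) (fun s => w s ω) t (z t ω).1) (u t ω)

/-- The cumulative regret `R_T = ∑_{t=1}^T (r_t(π*(x_t)) - r_t(a_t))`. -/
def regret {X Ω : Type*} {K : ℕ} (z : ℕ → Ω → X × (Fin K → ℝ)) (act : ℕ → Ω → Fin K)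
    (pol : X → Fin K) (T : ℕ) (ω : Ω) : ℝ :=
  ∑ t ∈ Finset.Icc 1 T, ((z t ω).2 (pol (z t ω).1) - (z t ω).2 (act t ω))

/-- `√(KB) T + √K ∑_{t=τ₁+1}^T √ξ(τ_{m(t)-1} - τ_{m(t)-2}, c / m(t)²)`. -/
def regretRate (K : ℕ) (B : ℝ) (ξ : ℕ → ℝ → ℝ) (τ₁ : ℕ) (c : ℝ) (T : ℕ) : ℝ :=
  √((K : ℝ) * B) * T
    + √K * ∑ t ∈ Finset.Icc (τ₁ + 1) T, √(epochRate ξ τ₁ c (epochOf τ₁ t))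

end SafeFalcon

end

/-!
On a favourable event the regret can be bounded deterministically; that event has probability at
least `1 - 12 δ'`, and one more application of Azuma's inequality passes from the kernels that are
played to the realized regret. The total is `13 δ' = δ`.

*Before misspecification matters.* The kernel `p_m` explores an action with probability about the
inverse of `K` plus `γ_m` times its predicted gap. Hence an estimate `f̂_{m+1}` that is accurate in
mean square under `p_m` predicts the value of every other kernel `q` up to an error that involves the
predicted regret of `q` only (`abs_value_sub_value_le`). By induction over the epochs, true and
predicted regrets agree up to a factor `2` and an additive term (`kernelRegret_comparison`,
`Standing.exists_scale`), as long as `B` is below the rates of all previous epochs. The predicted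
regret of `p_m` is at most `K / γ_m`, so its regret is at most `20.3 √(K ξ_m) + 12 √(K B)`
(`Standing.regret_kernel_le`). The rates `ξ_m` need not decrease with `m`, whereas the induction
needs the error of a model to be at most the rate of the previous epoch. This is recovered by using
the guarantee of the regression algorithm at a second confidence level, along the curve `c / ln n`
on which `ξ` is monotone (`exists_level_previous_rate`); the condition `δ ln τ₁ ≤ 100` keeps that
curve in the admissible range.

*Afterwards.* The first epoch with a rate below `B` is still covered by the previous bound, so from
its end on the lower confidence bound `l_m` is within `35 √(K B)` of the optimal value
(`Standing.value_sub_lower_le`). A passed test then bounds the cumulative regret, and since tests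
take place at dyadic distances from the start of an epoch in which the kernel does not change, the
bound persists between tests up to a factor `2` (`Standing.sum_regret_le_of_test`). A test can fail
only if `l_{m-1}` is within `35 √(K B)` of the optimum (`Standing.value_sub_lower_le_of_fail`), and
from then on the remembered kernel, whose value is at least `l_{m-1}`, is played
(`Standing.sum_regret_le`).

*Probabilities.* While the status is safe, the data of an epoch coincide with those of a fictitious
epoch whose actions are all drawn from `p_m`, which are i.i.d. given the past; this makes the
guarantee of the regression algorithm applicable (`measure_error_le`). Rewards deviate from the
values of the kernels by Azuma's inequality (`measure_reward_deviation_le`), and the confidence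
widths are dominated by `τ₁` and the cumulative rate (`sqrt_log_ceil_le`) because
`ξ(n, ζ) ≥ ln(1/ζ) / n`.
-/

namespace SafeFalcon

/-! ### Independence of the past and concentration -/

/-- If `ξ` is independent of `past`, integrating a function of both amounts to integrating first
over the law of `ξ`, with the past frozen. -/
lemma lintegral_comp_of_indepFun {Ω V H : Type*} {mΩ : MeasurableSpace Ω} [MeasurableSpace V]
    [MeasurableSpace H] {P : Measure Ω} [IsProbabilityMeasure P] {past : Ω → H} {ξ : Ω → V}
    (hpast : Measurable past) (hξ : Measurable ξ) (hind : IndepFun past ξ P)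
    {f : H × V → ENNReal} (hf : Measurable f) :
    ∫⁻ ω, f (past ω, ξ ω) ∂P = ∫⁻ ω, ∫⁻ v, f (past ω, v) ∂(P.map ξ) ∂P := by
  have hξ1 : IsProbabilityMeasure (P.map ξ) := Measure.isProbabilityMeasure_map hξ.aemeasurable
  have h := (indepFun_iff_map_prod_eq_prod_map_map hpast.aemeasurable hξ.aemeasurable).1 hind
  calc ∫⁻ ω, f (past ω, ξ ω) ∂P
      = ∫⁻ q, f q ∂(P.map fun ω => (past ω, ξ ω)) :=
        (lintegral_map hf (hpast.prodMk hξ)).symm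
    _ = ∫⁻ h, ∫⁻ v, f (h, v) ∂(P.map ξ) ∂(P.map past) := by
        rw [h, lintegral_prod _ hf.aemeasurable]
    _ = _ := lintegral_map hf.lintegral_prod_right' hpast

/-- `lintegral_comp_of_indepFun` for the past encoded by a sub-σ-algebra. -/
lemma lintegral_comp_of_indep {Ω V : Type*} {m mΩ : MeasurableSpace Ω} [mV : MeasurableSpace V]
    {P : Measure Ω} [IsProbabilityMeasure P] (hm : m ≤ mΩ) {ξ : Ω → V}
    (hξ : Measurable ξ) (hind : Indep m (mV.comap ξ) P)
    {f : Ω × V → ENNReal} (hf : Measurable[m.prod mV] f) :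
    ∫⁻ ω, f (ω, ξ ω) ∂P = ∫⁻ ω, ∫⁻ v, f (ω, v) ∂(P.map ξ) ∂P := by
  have hid : @Measurable Ω Ω mΩ m id := fun s hs => hm s hs
  refine @lintegral_comp_of_indepFun Ω V Ω mΩ mV m P _ id ξ hid hξ ?_ f hf
  exact (@IndepFun_iff_Indep Ω Ω V mΩ m mV id ξ P).2
    (by rw [MeasurableSpace.comap_id]; exact hind)

/-- An event that has small probability for every fixed past has small probability. -/
lemma measure_le_of_indep {Ω V : Type*} {m mΩ : MeasurableSpace Ω} [mV : MeasurableSpace V]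
    {P : Measure Ω} [IsProbabilityMeasure P] (hm : m ≤ mΩ) {ξ : Ω → V}
    (hξ : Measurable ξ) (hind : Indep m (mV.comap ξ) P)
    {s : Set (Ω × V)} (hs : MeasurableSet[m.prod mV] s) {c : ENNReal}
    (hc : ∀ ω, P.map ξ {v | (ω, v) ∈ s} ≤ c) :
    P {ω | (ω, ξ ω) ∈ s} ≤ c := by
  have hid : @Measurable Ω Ω mΩ m id := fun s hs => hm s hs
  have hs' : MeasurableSet {ω | (ω, ξ ω) ∈ s} :=
    (@Measurable.prodMk Ω mΩ Ω V m mV id ξ hid hξ) hs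
  have h := lintegral_comp_of_indep hm hξ hind
    (f := s.indicator 1) ((@measurable_const _ _ _ (m.prod mV) (1 : ENNReal)).indicator hs)
  have h1 : ∫⁻ ω, s.indicator (1 : Ω × V → ENNReal) (ω, ξ ω) ∂P = P {ω | (ω, ξ ω) ∈ s} := by
    rw [← lintegral_indicator_one hs']; rfl
  have h2 : ∀ ω, ∫⁻ v, s.indicator (1 : Ω × V → ENNReal) (ω, v) ∂(P.map ξ)
      = P.map ξ {v | (ω, v) ∈ s} := by
    intro ω
    have hms : MeasurableSet {v | (ω, v) ∈ s} :=
      (@Measurable.prodMk V mV Ω V m mV (fun _ => ω) id (@measurable_const _ _ m _ _) measurable_id) hs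
    rw [← lintegral_indicator_one hms]; rfl
  rw [← h1, h]
  calc _ ≤ ∫⁻ _, c ∂P := lintegral_mono fun ω => (h2 ω).trans_le (hc ω)
    _ = c := by simp

/-- Azuma's inequality. The increment `g t ω (ξ t ω)` depends on the past through `ω` (the map
`g t` is measurable for `𝓕 t` in `ω`), and is sub-Gaussian for every fixed past. -/
theorem azuma {Ω V : Type*} {mΩ : MeasurableSpace Ω} [mV : MeasurableSpace V]
    {P : Measure Ω} [IsProbabilityMeasure P] {μ : Measure V} {ξ : ℕ → Ω → V}
    {𝓕 : ℕ → MeasurableSpace Ω} (hle : ∀ t, 𝓕 t ≤ mΩ) (hmono : Monotone 𝓕)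
    (hξ : ∀ t, Measurable (ξ t)) (hξF : ∀ t, Measurable[𝓕 (t + 1)] (ξ t))
    (hind : ∀ t, Indep (𝓕 t) (mV.comap (ξ t)) P) (hlaw : ∀ t, P.map (ξ t) = μ)
    {g : ℕ → Ω → V → ℝ} {c : NNReal} (s : Finset ℕ)
    (hg : ∀ t ∈ s, Measurable[(𝓕 t).prod mV] (fun q : Ω × V => g t q.1 q.2))
    (hsub : ∀ t ∈ s, ∀ ω, HasSubgaussianMGF (g t ω) c μ) {ε : ℝ} (hε : 0 ≤ ε) :
    P {ω | ε ≤ ∑ t ∈ s, g t ω (ξ t ω)} ≤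
      ENNReal.ofReal (Real.exp (-ε ^ 2 / (2 * (s.card * c)))) := by
  have hY : ∀ t ∈ s, Measurable[𝓕 (t + 1)] (fun ω => g t ω (ξ t ω)) := by
    intro t ht
    have hid : @Measurable Ω Ω (𝓕 (t + 1)) (𝓕 t) id := fun s hs => hmono (Nat.le_succ t) s hs
    exact (hg t ht).comp (@Measurable.prodMk Ω (𝓕 (t + 1)) Ω V (𝓕 t) mV id (ξ t) hid (hξF t))
  have key : ∀ l : ℝ, ∫⁻ ω, ENNReal.ofReal (Real.exp (l * ∑ t ∈ s, g t ω (ξ t ω))) ∂P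
      ≤ ENNReal.ofReal (Real.exp (s.card * (c * l ^ 2 / 2))) := by
    intro l
    induction s using Finset.induction_on_max with
    | empty => simp
    | insert a s has ih =>
      have hna : a ∉ s := fun h => lt_irrefl _ (has a h)
      have ih := ih (fun t ht => hg t (Finset.mem_insert_of_mem ht))
        (fun t ht => hsub t (Finset.mem_insert_of_mem ht))
        (fun t ht => hY t (Finset.mem_insert_of_mem ht))
      have hS : Measurable[𝓕 a] (fun ω => ∑ t ∈ s, g t ω (ξ t ω)) :=
        Finset.measurable_sum (m := 𝓕 a) s fun t ht =>
          (hY t (Finset.mem_insert_of_mem ht)).mono (hmono (has t ht)) le_rfl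
      have hfst : @Measurable (Ω × V) Ω ((𝓕 a).prod mV) (𝓕 a) Prod.fst :=
        @measurable_fst Ω V (𝓕 a) mV
      have hF : Measurable[(𝓕 a).prod mV] (fun q : Ω × V =>
          ENNReal.ofReal (Real.exp (l * (∑ t ∈ s, g t q.1 (ξ t q.1))))
            * ENNReal.ofReal (Real.exp (l * g a q.1 q.2))) := by
        refine @Measurable.fun_mul ENNReal _ _ _ ((𝓕 a).prod mV) _ _ _ ?_ ?_
        · exact (ENNReal.measurable_ofReal.comp
            (Real.measurable_exp.comp (measurable_id.const_mul l))).comp (hS.comp hfst)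
        · exact (ENNReal.measurable_ofReal.comp
            (Real.measurable_exp.comp (measurable_id.const_mul l))).comp
              (hg a (Finset.mem_insert_self _ _))
      have h1 := lintegral_comp_of_indep (hle a) (hξ a) (hind a) hF
      have h2 : ∀ ω, ∫⁻ v, ENNReal.ofReal (Real.exp (l * g a ω v)) ∂μ
          ≤ ENNReal.ofReal (Real.exp (c * l ^ 2 / 2)) := by
        intro ω
        have h := hsub a (Finset.mem_insert_self _ _) ω
        rw [← ofReal_integral_eq_lintegral_ofReal (h.integrable_exp_mul l)
          (Filter.Eventually.of_forall fun _ => (Real.exp_pos _).le)]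
        exact ENNReal.ofReal_le_ofReal (h.mgf_le l)
      calc ∫⁻ ω, ENNReal.ofReal (Real.exp (l * ∑ t ∈ insert a s, g t ω (ξ t ω))) ∂P
          = ∫⁻ ω, ENNReal.ofReal (Real.exp (l * (∑ t ∈ s, g t ω (ξ t ω))))
            * ENNReal.ofReal (Real.exp (l * g a ω (ξ a ω))) ∂P := by
            refine lintegral_congr fun ω => ?_
            rw [← ENNReal.ofReal_mul (Real.exp_pos _).le, ← Real.exp_add, Finset.sum_insert hna]
            ring_nf
        _ = ∫⁻ ω, ∫⁻ v, ENNReal.ofReal (Real.exp (l * (∑ t ∈ s, g t ω (ξ t ω))))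
            * ENNReal.ofReal (Real.exp (l * g a ω v)) ∂μ ∂P := by rw [h1, hlaw]
        _ = ∫⁻ ω, ENNReal.ofReal (Real.exp (l * (∑ t ∈ s, g t ω (ξ t ω))))
            * ∫⁻ v, ENNReal.ofReal (Real.exp (l * g a ω v)) ∂μ ∂P := by
            refine lintegral_congr fun ω => ?_
            rw [lintegral_const_mul' _ _ ENNReal.ofReal_ne_top]
        _ ≤ ∫⁻ ω, ENNReal.ofReal (Real.exp (l * (∑ t ∈ s, g t ω (ξ t ω))))
            * ENNReal.ofReal (Real.exp (c * l ^ 2 / 2)) ∂P :=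
            lintegral_mono fun ω => mul_le_mul_right (h2 ω) _
        _ ≤ ENNReal.ofReal (Real.exp (s.card * (c * l ^ 2 / 2)))
            * ENNReal.ofReal (Real.exp (c * l ^ 2 / 2)) := by
            rw [lintegral_mul_const' _ _ ENNReal.ofReal_ne_top]
            exact mul_le_mul_left ih _
        _ = _ := by
            rw [← ENNReal.ofReal_mul (Real.exp_pos _).le, ← Real.exp_add,
              Finset.card_insert_of_notMem hna]
            push_cast; ring_nf
  have hS : Measurable (fun ω => ∑ t ∈ s, g t ω (ξ t ω)) :=
    Finset.measurable_sum s fun t ht => (hY t ht).mono (hle _) le_rfl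
  by_cases hc : (s.card * c : ℝ) = 0
  · rw [hc]; simpa using prob_le_one
  have hcpos : (0 : ℝ) < s.card * c := lt_of_le_of_ne (by positivity) (Ne.symm hc)
  -- the exponent `l` that is optimal in Markov's inequality
  set l : ℝ := ε / (s.card * c) with hl
  have hl0 : 0 ≤ l := by positivity
  have hE : Measurable fun ω => ENNReal.ofReal (Real.exp (l * ∑ t ∈ s, g t ω (ξ t ω))) :=
    ENNReal.measurable_ofReal.comp (Real.measurable_exp.comp (hS.const_mul l))
  calc P {ω | ε ≤ ∑ t ∈ s, g t ω (ξ t ω)}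
      ≤ P {ω | ENNReal.ofReal (Real.exp (l * ε)) ≤
          ENNReal.ofReal (Real.exp (l * ∑ t ∈ s, g t ω (ξ t ω)))} := by
        refine measure_mono fun ω hω => ?_
        exact ENNReal.ofReal_le_ofReal (Real.exp_le_exp.2 (mul_le_mul_of_nonneg_left hω hl0))
    _ ≤ (∫⁻ ω, ENNReal.ofReal (Real.exp (l * ∑ t ∈ s, g t ω (ξ t ω))) ∂P)
          / ENNReal.ofReal (Real.exp (l * ε)) :=
        meas_ge_le_lintegral_div hE.aemeasurable
          (by simpa using Real.exp_pos _) ENNReal.ofReal_ne_top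
    _ ≤ ENNReal.ofReal (Real.exp (s.card * (c * l ^ 2 / 2)))
          / ENNReal.ofReal (Real.exp (l * ε)) := ENNReal.div_le_div_right (key l) _
    _ = _ := by
        rw [← ENNReal.ofReal_div_of_pos (Real.exp_pos _), ← Real.exp_sub]
        congr 2
        rw [hl]; field_simp; ring

/-- The σ-algebra generated by the variables with index less than `t`. -/
@[reducible] def pastSigma {Ω V : Type*} [MeasurableSpace V] (ξ : ℕ → Ω → V) (t : ℕ) :
    MeasurableSpace Ω :=
  MeasurableSpace.comap (fun ω (i : Finset.range t) => ξ i ω) inferInstance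

section pastSigma

variable {Ω V : Type*} {mΩ : MeasurableSpace Ω} [mV : MeasurableSpace V] {P : Measure Ω}
  {ξ : ℕ → Ω → V}

lemma pastSigma_le (hξ : ∀ t, Measurable (ξ t)) (t : ℕ) : pastSigma ξ t ≤ mΩ :=
  (measurable_pi_lambda _ fun i : Finset.range t => hξ i).comap_le

lemma measurable_pastSigma {s t : ℕ} (h : s < t) : Measurable[pastSigma ξ t] (ξ s) := by
  have h1 : Measurable[pastSigma ξ t] (fun ω (i : Finset.range t) => ξ i ω) :=
    comap_measurable _
  exact (measurable_pi_apply (⟨s, Finset.mem_range.2 h⟩ : Finset.range t)).comp h1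

lemma pastSigma_mono : Monotone (pastSigma ξ) := by
  intro s t hst
  have : Measurable[pastSigma ξ t] (fun ω (i : Finset.range s) => ξ i ω) :=
    @measurable_pi_lambda _ _ _ (pastSigma ξ t) _ _ fun i =>
      measurable_pastSigma ((Finset.mem_range.1 i.2).trans_le hst)
  exact this.comap_le

/-- The past of index `a + 1` is independent of the block of `n` variables that starts with it. -/
lemma indep_pastSigma_block (hξ : ∀ t, Measurable (ξ t)) (hind : iIndepFun ξ P) (a n : ℕ) :
    Indep (pastSigma ξ (a + 1))
      (MeasurableSpace.comap (fun ω (i : Fin n) => ξ (a + 1 + i) ω) inferInstance) P := by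
  have hd : Disjoint (Finset.range (a + 1)) (Finset.Ico (a + 1) (a + 1 + n)) := by
    rw [Finset.disjoint_left]; intro i hi hj; simp at hi hj; omega
  have h := hind.indepFun_finset _ _ hd hξ
  let φ : (Finset.Ico (a + 1) (a + 1 + n) → V) → (Fin n → V) :=
    fun v i => v ⟨a + 1 + i, by simp⟩
  have hφ : Measurable φ := measurable_pi_lambda _ fun i => measurable_pi_apply _
  have h2 := h.comp measurable_id hφ
  rw [IndepFun_iff_Indep] at h2
  exact h2

lemma indep_pastSigma (hξ : ∀ t, Measurable (ξ t)) (hind : iIndepFun ξ P) (t : ℕ) :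
    Indep (pastSigma ξ t) (mV.comap (ξ t)) P := by
  have hd : Disjoint (Finset.range t) ({t} : Finset ℕ) := by simp
  have h := hind.indepFun_finset _ _ hd hξ
  have h2 := h.comp measurable_id
    (measurable_pi_apply (⟨t, by simp⟩ : ({t} : Finset ℕ)))
  rw [IndepFun_iff_Indep] at h2
  exact h2

lemma map_block [IsProbabilityMeasure P] (hξ : ∀ t, Measurable (ξ t)) (hind : iIndepFun ξ P)
    {μ : Measure V} (hlaw : ∀ t, P.map (ξ t) = μ) (a n : ℕ) :
    P.map (fun ω (i : Fin n) => ξ (a + i) ω) = Measure.pi fun _ => μ := by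
  have h := hind.precomp (g := fun i : Fin n => a + i)
    (fun i j hij => Fin.ext (by simpa using hij))
  rw [(iIndepFun_iff_map_fun_eq_pi_map fun i => (hξ _).aemeasurable).1 h]
  simp [hlaw]

end pastSigma

/-! ### Action kernels and their values -/

/-- A measurable probability kernel from contexts to actions. -/
structure IsKernel {X : Type*} [MeasurableSpace X] {K : ℕ} (q : X → Fin K → ℝ) : Prop where
  measurable : Measurable q
  mem : ∀ x, q x ∈ stdSimplex ℝ (Fin K)

/-- The mean reward of the kernel `q` if the contexts have law `μ` and the mean rewards of the
actions are given by `f`. -/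
noncomputable def value {X : Type*} [MeasurableSpace X] {K : ℕ} (μ : Measure X)
    (q f : X → Fin K → ℝ) : ℝ :=
  ∫ x, ∑ a, q x a * f x a ∂μ

/-- The deterministic policy `pol` as a kernel. -/
noncomputable def policyKernel {X : Type*} {K : ℕ} (pol : X → Fin K) (x : X) (a : Fin K) : ℝ :=
  if a = pol x then 1 else 0

section Kernels

variable {X : Type*} [MeasurableSpace X] {K : ℕ}

lemma measurable_eval_uncurry : Measurable fun q : (Fin K → ℝ) × Fin K => q.1 q.2 :=
  measurable_from_prod_countable_left fun a => measurable_pi_apply a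

lemma isKernel_policyKernel {pol : X → Fin K} (h : Measurable pol) :
    IsKernel (policyKernel pol) := by
  refine ⟨measurable_pi_lambda _ fun a => ?_, fun x => ⟨fun a => ?_, ?_⟩⟩
  · exact Measurable.ite (measurableSet_eq_fun measurable_const h) measurable_const
      measurable_const
  · unfold policyKernel; split_ifs <;> norm_num
  · simp [policyKernel]

omit [MeasurableSpace X] in
lemma sum_policyKernel_mul (pol : X → Fin K) (x : X) (φ : Fin K → ℝ) :
    ∑ a, policyKernel pol x a * φ a = φ (pol x) := by
  simp [policyKernel]

lemma IsKernel.nonneg {q : X → Fin K → ℝ} (hq : IsKernel q) (x : X) (a : Fin K) : 0 ≤ q x a :=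
  (hq.mem x).1 a

lemma IsKernel.sum_eq {q : X → Fin K → ℝ} (hq : IsKernel q) (x : X) : ∑ a, q x a = 1 :=
  (hq.mem x).2

lemma simplex_le_one {q : Fin K → ℝ} (hq : q ∈ stdSimplex ℝ (Fin K)) (a : Fin K) : q a ≤ 1 :=
  hq.2 ▸ Finset.single_le_sum (f := q) (fun b _ => hq.1 b) (Finset.mem_univ a)

lemma IsKernel.le_one {q : X → Fin K → ℝ} (hq : IsKernel q) (x : X) (a : Fin K) : q x a ≤ 1 :=
  simplex_le_one (hq.mem x) a

/-- A convex combination of numbers of `[0,1]` lies in `[0,1]`. -/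
lemma simplex_sum_mem_Icc {q φ : Fin K → ℝ} (hq : q ∈ stdSimplex ℝ (Fin K))
    (hφ : ∀ a, φ a ∈ Set.Icc (0 : ℝ) 1) : ∑ a, q a * φ a ∈ Set.Icc (0 : ℝ) 1 := by
  constructor
  · exact Finset.sum_nonneg fun a _ => mul_nonneg (hq.1 a) (hφ a).1
  · calc ∑ a, q a * φ a ≤ ∑ a, q a :=
        Finset.sum_le_sum fun a _ => mul_le_of_le_one_right (hq.1 a) (hφ a).2
      _ = 1 := hq.2

lemma measurable_apply {f : X → Fin K → ℝ} (hf : Measurable f) (a : Fin K) :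
    Measurable fun x => f x a := (measurable_pi_apply a).comp hf

lemma measurable_sum_mul {f g : X → Fin K → ℝ} (hf : Measurable f) (hg : Measurable g) :
    Measurable fun x => ∑ a, f x a * g x a :=
  Finset.measurable_sum _ fun a _ => (measurable_apply hf a).mul (measurable_apply hg a)

variable {μ : Measure X} [IsProbabilityMeasure μ]

lemma integrable_of_mem_Icc {φ : X → ℝ} (hφ : Measurable φ) {c : ℝ} (h : ∀ x, φ x ∈ Set.Icc 0 c) :
    Integrable φ μ :=
  Integrable.of_bound hφ.aestronglyMeasurable c <| .of_forall fun x => by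
    rw [Real.norm_eq_abs, abs_of_nonneg (h x).1]; exact (h x).2

lemma integrable_value {q f : X → Fin K → ℝ} (hq : IsKernel q) (hf : Measurable f)
    (h01 : ∀ x a, f x a ∈ Set.Icc (0 : ℝ) 1) : Integrable (fun x => ∑ a, q x a * f x a) μ :=
  integrable_of_mem_Icc (measurable_sum_mul hq.measurable hf)
    fun x => simplex_sum_mem_Icc (hq.mem x) (h01 x)

lemma value_mem_Icc {q f : X → Fin K → ℝ} (hq : IsKernel q) (hf : Measurable f)
    (h01 : ∀ x a, f x a ∈ Set.Icc (0 : ℝ) 1) : value μ q f ∈ Set.Icc (0 : ℝ) 1 := by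
  constructor
  · exact integral_nonneg fun x => (simplex_sum_mem_Icc (hq.mem x) (h01 x)).1
  · calc value μ q f ≤ ∫ _, (1 : ℝ) ∂μ := integral_mono (integrable_value hq hf h01)
          (integrable_const _) fun x => (simplex_sum_mem_Icc (hq.mem x) (h01 x)).2
      _ = 1 := by simp

/-- No kernel beats the policy that maximizes the mean reward at every context. -/
lemma value_le_value_policyKernel {q f : X → Fin K → ℝ} (hq : IsKernel q) (hf : Measurable f)
    (h01 : ∀ x a, f x a ∈ Set.Icc (0 : ℝ) 1) {pol : X → Fin K} (hpol : Measurable pol)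
    (hle : ∀ x a, f x a ≤ f x (pol x)) : value μ q f ≤ value μ (policyKernel pol) f := by
  refine integral_mono (integrable_value hq hf h01)
    (integrable_value (isKernel_policyKernel hpol) hf h01) fun x => ?_
  simp only [sum_policyKernel_mul]
  calc ∑ a, q x a * f x a ≤ ∑ a, q x a * f x (pol x) :=
        Finset.sum_le_sum fun a _ => mul_le_mul_of_nonneg_left (hle x a) (hq.nonneg x a)
    _ = f x (pol x) := by rw [← Finset.sum_mul, hq.sum_eq, one_mul]

end Kernels

/-! ### The action selection kernel -/

section ActionKernel

variable {K : ℕ} {pick : (Fin K → ℝ) → Fin K}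
  (hpick : ∀ (v : Fin K → ℝ) (a : Fin K), v a ≤ v (pick v)) {γ : ℝ}
  (hγ : 0 ≤ γ) (v : Fin K → ℝ)

include hpick hγ in
lemma actionKernel_denom_pos (a : Fin K) : (1 : ℝ) ≤ K ∧ (K : ℝ) ≤ K + γ * (v (pick v) - v a) := by
  have h1 : 0 < K := (pick v).pos
  exact ⟨by exact_mod_cast h1,
    le_add_of_nonneg_right (mul_nonneg hγ (sub_nonneg.2 (hpick v a)))⟩

include hpick hγ in
lemma inv_le_actionKernel_pick : 1 / (K : ℝ) ≤ actionKernel pick γ v (pick v) := by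
  have hK := (actionKernel_denom_pos hpick hγ v (pick v)).1
  have h : ∑ b ∈ Finset.univ.erase (pick v), 1 / ((K : ℝ) + γ * (v (pick v) - v b))
      ≤ ∑ b ∈ Finset.univ.erase (pick v), 1 / (K : ℝ) :=
    Finset.sum_le_sum fun b _ => one_div_le_one_div_of_le (by linarith)
      (actionKernel_denom_pos hpick hγ v b).2
  rw [Finset.sum_const, Finset.card_erase_of_mem (Finset.mem_univ _), Finset.card_univ,
    Fintype.card_fin, nsmul_eq_mul, Nat.cast_sub (pick v).pos] at h
  have h2 : ((K : ℝ) - (1 : ℕ)) * (1 / K) = 1 - 1 / K := by push_cast; field_simp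
  rw [h2] at h
  unfold actionKernel
  rw [if_pos rfl]; linarith

include hpick hγ in
/-- The kernel gives every action at least the probability `1 / (K + γ · predicted gap)`. -/
lemma one_le_actionKernel_mul (a : Fin K) :
    1 ≤ actionKernel pick γ v a * (K + γ * (v (pick v) - v a)) := by
  obtain ⟨h1, h2⟩ := actionKernel_denom_pos hpick hγ v a
  by_cases h : a = pick v
  · have := inv_le_actionKernel_pick hpick hγ v
    rw [h, sub_self, mul_zero, add_zero]
    calc (1 : ℝ) = 1 / K * K := by field_simp
      _ ≤ _ := mul_le_mul_of_nonneg_right this (by linarith)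
  · unfold actionKernel
    rw [if_neg h, one_div, inv_mul_cancel₀ (by linarith)]

include hpick hγ in
lemma actionKernel_mem_stdSimplex : actionKernel pick γ v ∈ stdSimplex ℝ (Fin K) := by
  refine ⟨fun a => ?_, ?_⟩
  · obtain ⟨h1, h2⟩ := actionKernel_denom_pos hpick hγ v a
    have := one_le_actionKernel_mul hpick hγ v a
    by_contra! hneg
    nlinarith
  · rw [← Finset.add_sum_erase _ _ (Finset.mem_univ (pick v))]
    have h : ∑ a ∈ Finset.univ.erase (pick v), actionKernel pick γ v a
        = ∑ b ∈ Finset.univ.erase (pick v), 1 / ((K : ℝ) + γ * (v (pick v) - v b)) :=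
      Finset.sum_congr rfl fun b hb => if_neg (Finset.ne_of_mem_erase hb)
    rw [h]; unfold actionKernel; rw [if_pos rfl]; ring

include hpick hγ in
/-- The predicted regret of the kernel with parameter `γ` is at most `K / γ`. -/
lemma mul_sum_actionKernel_gap_le :
    γ * ∑ a, actionKernel pick γ v a * (v (pick v) - v a) ≤ K := by
  rw [Finset.mul_sum]
  calc ∑ a, γ * (actionKernel pick γ v a * (v (pick v) - v a)) ≤ ∑ _a : Fin K, (1 : ℝ) := by
        refine Finset.sum_le_sum fun a _ => ?_
        by_cases h : a = pick v
        · rw [h]; simp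
        · obtain ⟨h1, h2⟩ := actionKernel_denom_pos hpick hγ v a
          unfold actionKernel
          rw [if_neg h, one_div, ← mul_assoc, mul_comm γ, mul_assoc, inv_mul_le_iff₀ (by linarith)]
          linarith
    _ = K := by simp

lemma measurable_actionKernel (hm : Measurable pick) : Measurable (actionKernel pick γ) := by
  have hbest : Measurable fun v : Fin K → ℝ => v (pick v) :=
    measurable_eval_uncurry.comp (measurable_id.prodMk hm)
  have hterm : ∀ b : Fin K, Measurable fun v : Fin K → ℝ =>
      1 / ((K : ℝ) + γ * (v (pick v) - v b)) := fun b =>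
    measurable_const.div (((hbest.sub (measurable_pi_apply b)).const_mul γ).const_add _)
  refine measurable_pi_lambda _ fun a => ?_
  unfold actionKernel
  refine Measurable.ite (measurableSet_eq_fun measurable_const hm) ?_ (hterm a)
  have : (fun v : Fin K → ℝ => ∑ b ∈ Finset.univ.erase (pick v),
      1 / ((K : ℝ) + γ * (v (pick v) - v b))) = fun v => ∑ b : Fin K,
        if b = pick v then 0 else 1 / ((K : ℝ) + γ * (v (pick v) - v b)) := by
    funext v
    rw [← Finset.add_sum_erase _ _ (Finset.mem_univ (pick v)), if_pos rfl, zero_add]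
    exact Finset.sum_congr rfl fun b hb => (if_neg (Finset.ne_of_mem_erase hb)).symm
  rw [show (fun v : Fin K → ℝ => 1 - ∑ b ∈ Finset.univ.erase (pick v),
      1 / ((K : ℝ) + γ * (v (pick v) - v b))) = fun v => 1 - (fun v : Fin K → ℝ =>
        ∑ b ∈ Finset.univ.erase (pick v), 1 / ((K : ℝ) + γ * (v (pick v) - v b))) v from rfl, this]
  exact measurable_const.sub (Finset.measurable_sum _ fun b _ =>
    Measurable.ite (measurableSet_eq_fun measurable_const hm) measurable_const (hterm b))

end ActionKernel

/-! ### Sampling an action -/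

lemma ae_norm_le_one {Y : Type*} {φ : Y → ℝ} [MeasurableSpace Y] {μ : Measure Y}
    (h : ∀ᵐ y ∂μ, φ y ∈ Set.Icc (0 : ℝ) 1) : ∀ᵐ y ∂μ, ‖φ y‖ ≤ 1 := by
  filter_upwards [h] with y hy
  rw [Real.norm_eq_abs, abs_of_nonneg hy.1]; exact hy.2

section Sampling

variable {X U W : Type*} [MeasurableSpace X] [MeasurableSpace U] [MeasurableSpace W] {K : ℕ}
  {D : Measure (X × (Fin K → ℝ))} [IsProbabilityMeasure D] {ν : Measure U} [IsProbabilityMeasure ν]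
  {ρ : Measure W} [IsProbabilityMeasure ρ] {draw : (Fin K → ℝ) → U → Fin K}

omit [IsProbabilityMeasure ν] in
/-- A sampler remains one if its seed is enlarged by an irrelevant component. -/
lemma IsSampler.prod (h : IsSampler ν draw) :
    IsSampler (ν.prod ρ) (fun q (y : U × W) => draw q y.1) := by
  refine ⟨h.measurable.comp (measurable_fst.prodMk (measurable_fst.comp measurable_snd)),
    fun q hq a => ?_⟩
  rw [← h.law q hq a]
  have : {y : U × W | draw q y.1 = a} = {u | draw q u = a} ×ˢ Set.univ := by ext; simp
  rw [this, Measure.prod_prod]; simp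

omit [IsProbabilityMeasure ν] in
lemma IsSampler.measurable_draw (h : IsSampler ν draw) (q : Fin K → ℝ) : Measurable (draw q) :=
  h.measurable.comp (measurable_const.prodMk measurable_id)

lemma IsSampler.integral_eq (h : IsSampler ν draw) {q : Fin K → ℝ} (hq : q ∈ stdSimplex ℝ (Fin K))
    (φ : Fin K → ℝ) : ∫ u, φ (draw q u) ∂ν = ∑ a, q a * φ a := by
  have hm := h.measurable_draw q
  have hp : IsProbabilityMeasure (ν.map (draw q)) := Measure.isProbabilityMeasure_map hm.aemeasurable
  rw [← integral_map (φ := draw q) (f := φ) hm.aemeasurable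
    (measurable_of_countable φ).aestronglyMeasurable, integral_fintype .of_finite]
  refine Finset.sum_congr rfl fun a _ => ?_
  rw [smul_eq_mul, measureReal_def, Measure.map_apply hm (measurableSet_singleton a)]
  have : draw q ⁻¹' {a} = {u | draw q u = a} := rfl
  rw [this, h.law q hq a, ENNReal.toReal_ofReal (hq.1 a)]

omit [IsProbabilityMeasure ν] in
lemma IsSampler.lintegral_eq (h : IsSampler ν draw) {q : Fin K → ℝ}
    (hq : q ∈ stdSimplex ℝ (Fin K)) (φ : Fin K → ENNReal) :
    ∫⁻ u, φ (draw q u) ∂ν = ∑ a, ENNReal.ofReal (q a) * φ a := by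
  have hm := h.measurable_draw q
  rw [← lintegral_map (measurable_of_countable φ) hm, lintegral_fintype]
  refine Finset.sum_congr rfl fun a _ => ?_
  rw [Measure.map_apply hm (measurableSet_singleton a), mul_comm]
  exact congrArg (· * φ a) (h.law q hq a)

omit [IsProbabilityMeasure ν] in
lemma measurable_drawn (h : IsSampler ν draw) {p : X → Fin K → ℝ} (hp : Measurable p) :
    Measurable fun y : (X × (Fin K → ℝ)) × U => draw (p y.1.1) y.2 :=
  h.measurable.comp ((hp.comp (measurable_fst.comp measurable_fst)).prodMk measurable_snd)

omit [IsProbabilityMeasure D] in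
/-- Drawing an action with a sampler produces the law `D(p)`. -/
lemma measurePreserving_inducedLaw (h : IsSampler ν draw) {p : X → Fin K → ℝ} (hp : IsKernel p) :
    MeasurePreserving (fun y : (X × (Fin K → ℝ)) × U =>
      (y.1.1, draw (p y.1.1) y.2, y.1.2 (draw (p y.1.1) y.2))) (D.prod ν) (inducedLaw D p) := by
  have hd := measurable_drawn h hp.measurable
  have hm : Measurable (fun y : (X × (Fin K → ℝ)) × U =>
      (y.1.1, draw (p y.1.1) y.2, y.1.2 (draw (p y.1.1) y.2))) :=
    (measurable_fst.comp measurable_fst).prodMk (hd.prodMk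
      (measurable_eval_uncurry.comp ((measurable_snd.comp measurable_fst).prodMk hd)))
  refine ⟨hm, ?_⟩
  ext s hs
  have hma : ∀ a : Fin K, Measurable fun z : X × (Fin K → ℝ) => (z.1, a, z.2 a) := fun a =>
    measurable_fst.prodMk (measurable_const.prodMk ((measurable_pi_apply a).comp measurable_snd))
  have hpa : ∀ a : Fin K, Measurable fun z : X × (Fin K → ℝ) => ENNReal.ofReal (p z.1 a) :=
    fun a => ENNReal.measurable_ofReal.comp ((measurable_apply hp.measurable a).comp measurable_fst)
  have h1 : Measurable (s.indicator (1 : X × Fin K × ℝ → ENNReal)) :=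
    measurable_one.indicator hs
  rw [← lintegral_indicator_one hs, lintegral_map h1 hm]
  erw [lintegral_prod _ (h1.comp hm).aemeasurable]
  simp only [Function.comp_apply]
  have h2 : ∀ z : X × (Fin K → ℝ), ∫⁻ u, s.indicator (1 : X × Fin K × ℝ → ENNReal)
      (z.1, draw (p z.1) u, z.2 (draw (p z.1) u)) ∂ν
      = ∑ a, ENNReal.ofReal (p z.1 a) * s.indicator (1 : X × Fin K × ℝ → ENNReal) (z.1, a, z.2 a) :=
    fun z => h.lintegral_eq (hp.mem z.1) fun a => s.indicator 1 (z.1, a, z.2 a)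
  simp only [h2]
  have hterm : ∀ a : Fin K, Measurable fun z : X × (Fin K → ℝ) => ENNReal.ofReal (p z.1 a)
      * s.indicator (1 : X × Fin K × ℝ → ENNReal) (z.1, a, z.2 a) :=
    fun a => (hpa a).mul (h1.comp (hma a))
  rw [lintegral_finsetSum _ fun a _ => hterm a, inducedLaw,
    Measure.coe_finsetSum, Finset.sum_apply]
  refine Finset.sum_congr rfl fun a _ => ?_
  rw [← lintegral_indicator_one hs, lintegral_map h1 (hma a)]
  exact (lintegral_withDensity_eq_lintegral_mul _ (hpa a) (h1.comp (hma a))).symm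

variable {fstar : X → Fin K → ℝ}

/-- Conditioning on the context replaces the rewards by their conditional means. -/
lemma integral_sum_mul_reward (hD : ∀ᵐ z ∂D, ∀ a, z.2 a ∈ Set.Icc (0 : ℝ) 1)
    (hf : IsMeanReward D fstar) {p : X → Fin K → ℝ} (hp : IsKernel p) :
    ∫ z, ∑ a, p z.1 a * z.2 a ∂D = value (D.map Prod.fst) p fstar := by
  have hr : ∀ a, Integrable (fun z : X × (Fin K → ℝ) => z.2 a) D := fun a =>
    Integrable.of_bound ((measurable_pi_apply a).comp measurable_snd).aestronglyMeasurable 1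
      (ae_norm_le_one (hD.mono fun z hz => hz a))
  have hple : ∀ a, ∀ᵐ z ∂D, ‖(fun z : X × (Fin K → ℝ) => p z.1 a) z‖ ≤ 1 := fun a =>
    ae_norm_le_one (.of_forall fun z => ⟨hp.nonneg _ _, hp.le_one _ _⟩)
  have hpm : ∀ a, Measurable fun z : X × (Fin K → ℝ) => p z.1 a := fun a =>
    (measurable_apply hp.measurable a).comp measurable_fst
  have hpr : ∀ a, Integrable (fun z : X × (Fin K → ℝ) => p z.1 a * z.2 a) D := fun a =>
    (hr a).bdd_mul (hpm a).aestronglyMeasurable (hple a)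
  have hfm : ∀ a, Integrable (fun z : X × (Fin K → ℝ) => fstar z.1 a) D := fun a =>
    integrable_of_mem_Icc ((measurable_apply hf.measurable a).comp measurable_fst)
      fun z => hf.mem_Icc z.1 a
  have hpf : ∀ a, Integrable (fun z : X × (Fin K → ℝ) => p z.1 a * fstar z.1 a) D := fun a =>
    (hfm a).bdd_mul (hpm a).aestronglyMeasurable (hple a)
  have hle : MeasurableSpace.comap (Prod.fst : X × (Fin K → ℝ) → X) inferInstance ≤
      (inferInstance : MeasurableSpace (X × (Fin K → ℝ))) := measurable_fst.comap_le
  have hcond : ∀ a, ∫ z, p z.1 a * z.2 a ∂D = ∫ z, p z.1 a * fstar z.1 a ∂D := by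
    intro a
    have hsm : StronglyMeasurable[MeasurableSpace.comap Prod.fst inferInstance]
        (fun z : X × (Fin K → ℝ) => p z.1 a) :=
      ((measurable_apply hp.measurable a).comp (comap_measurable _)).stronglyMeasurable
    have h1 := condExp_stronglyMeasurable_mul_of_bound hle hsm (hr a) 1 (hple a)
    calc ∫ z, p z.1 a * z.2 a ∂D
        = ∫ z, (D[(fun z : X × (Fin K → ℝ) => p z.1 a) * (fun z => z.2 a) |
            MeasurableSpace.comap Prod.fst inferInstance]) z ∂D := (integral_condExp hle).symm
      _ = _ := by
          refine integral_congr_ae ?_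
          filter_upwards [h1, hf.condExp_eq a] with z h1 h2
          rw [h1, Pi.mul_apply, h2]
  rw [integral_finsetSum _ fun a _ => hpr a, Finset.sum_congr rfl fun a _ => hcond a,
    ← integral_finsetSum _ fun a _ => hpf a, value,
    integral_map measurable_fst.aemeasurable
      (measurable_sum_mul hp.measurable hf.measurable).aestronglyMeasurable]

omit [IsProbabilityMeasure ν] in
lemma measurable_drawn_reward (h : IsSampler ν draw) {p : X → Fin K → ℝ} (hp : Measurable p) :
    Measurable fun y : (X × (Fin K → ℝ)) × U => y.1.2 (draw (p y.1.1) y.2) :=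
  measurable_eval_uncurry.comp ((measurable_snd.comp measurable_fst).prodMk (measurable_drawn h hp))

/-- The mean reward of an action that is drawn from the kernel `p`. -/
lemma integral_drawn_reward (hD : ∀ᵐ z ∂D, ∀ a, z.2 a ∈ Set.Icc (0 : ℝ) 1)
    (hf : IsMeanReward D fstar) (h : IsSampler ν draw) {p : X → Fin K → ℝ} (hp : IsKernel p) :
    ∫ y : (X × (Fin K → ℝ)) × U, y.1.2 (draw (p y.1.1) y.2) ∂(D.prod ν)
      = value (D.map Prod.fst) p fstar := by
  have hDν : ∀ᵐ y ∂(D.prod ν), ∀ a, y.1.2 a ∈ Set.Icc (0 : ℝ) 1 :=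
    Measure.quasiMeasurePreserving_fst.ae hD
  have hint : Integrable (fun y : (X × (Fin K → ℝ)) × U => y.1.2 (draw (p y.1.1) y.2))
      (D.prod ν) :=
    Integrable.of_bound (measurable_drawn_reward h hp.measurable).aestronglyMeasurable 1
      (ae_norm_le_one (hDν.mono fun y hy => hy _))
  have h2 : ∀ z : X × (Fin K → ℝ), ∫ u, z.2 (draw (p z.1) u) ∂ν = ∑ a, p z.1 a * z.2 a :=
    fun z => h.integral_eq (hp.mem z.1) z.2
  rw [integral_prod _ hint, ← integral_sum_mul_reward hD hf hp]
  simp only [h2]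

/-- The mean reward of a policy. -/
lemma integral_policy_reward (hD : ∀ᵐ z ∂D, ∀ a, z.2 a ∈ Set.Icc (0 : ℝ) 1)
    (hf : IsMeanReward D fstar) {pol : X → Fin K} (hpol : Measurable pol) :
    ∫ z, z.2 (pol z.1) ∂D = value (D.map Prod.fst) (policyKernel pol) fstar := by
  rw [← integral_sum_mul_reward hD hf (isKernel_policyKernel hpol)]
  simp only [sum_policyKernel_mul]

end Sampling

/-! ### Regret under successive models -/

/-- The regret of the kernel `q` with respect to the policy `pol`, under the mean rewards `f`. -/
noncomputable def kernelRegret {X : Type*} [MeasurableSpace X] {K : ℕ} (μ : Measure X)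
    (pol : X → Fin K) (f q : X → Fin K → ℝ) : ℝ :=
  value μ (policyKernel pol) f - value μ q f

section FalconStep

variable {X : Type*} [MeasurableSpace X] {K : ℕ} {μ : Measure X} [IsProbabilityMeasure μ]

lemma kernelRegret_nonneg {f q : X → Fin K → ℝ} (hf : Measurable f)
    (h01 : ∀ x a, f x a ∈ Set.Icc (0 : ℝ) 1) {pol : X → Fin K} (hpol : Measurable pol)
    (hle : ∀ x a, f x a ≤ f x (pol x)) (hq : IsKernel q) : 0 ≤ kernelRegret μ pol f q :=
  sub_nonneg.2 (value_le_value_policyKernel hq hf h01 hpol hle)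

lemma kernelRegret_le_one {f q : X → Fin K → ℝ} (hf : Measurable f)
    (h01 : ∀ x a, f x a ∈ Set.Icc (0 : ℝ) 1) {pol : X → Fin K} (hpol : Measurable pol)
    (hq : IsKernel q) : kernelRegret μ pol f q ≤ 1 := by
  have h1 := (value_mem_Icc (μ := μ) (isKernel_policyKernel hpol) hf h01).2
  have h2 := (value_mem_Icc (μ := μ) hq hf h01).1
  unfold kernelRegret; linarith

lemma kernelRegret_eq_integral {f q : X → Fin K → ℝ} (hf : Measurable f)
    (h01 : ∀ x a, f x a ∈ Set.Icc (0 : ℝ) 1) {pol : X → Fin K} (hpol : Measurable pol)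
    (hq : IsKernel q) :
    kernelRegret μ pol f q = ∫ x, ∑ a, q x a * (f x (pol x) - f x a) ∂μ := by
  unfold kernelRegret value
  rw [← integral_sub (integrable_value (isKernel_policyKernel hpol) hf h01)
    (integrable_value hq hf h01)]
  refine integral_congr_ae (.of_forall fun x => ?_)
  simp only [sum_policyKernel_mul, mul_sub, Finset.sum_sub_distrib, ← Finset.sum_mul, hq.sum_eq,
    one_mul]

lemma two_mul_le_of_sq_le_mul {a b c : ℝ} (ha : 0 ≤ a) (hb : 0 ≤ b) (h : c ^ 2 ≤ a * b) :
    2 * c ≤ a + b :=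
  (abs_le_of_sq_le_sq' (by nlinarith [sq_nonneg (a - b)]) (by positivity)).2

variable {pick : (Fin K → ℝ) → Fin K} {γ : ℝ} {f : X → Fin K → ℝ}

lemma isKernel_actionKernel (hpm : Measurable pick)
    (hpick : ∀ (v : Fin K → ℝ) (a : Fin K), v a ≤ v (pick v)) (hγ : 0 ≤ γ) (hf : Measurable f) :
    IsKernel fun x => actionKernel pick γ (f x) :=
  ⟨(measurable_actionKernel hpm).comp hf, fun x => actionKernel_mem_stdSimplex hpick hγ (f x)⟩

lemma mul_kernelRegret_actionKernel_le (hpm : Measurable pick)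
    (hpick : ∀ (v : Fin K → ℝ) (a : Fin K), v a ≤ v (pick v)) (hγ : 0 ≤ γ) (hf : Measurable f)
    (h01 : ∀ x a, f x a ∈ Set.Icc (0 : ℝ) 1) :
    γ * kernelRegret μ (fun x => pick (f x)) f (fun x => actionKernel pick γ (f x)) ≤ K := by
  have hq := isKernel_actionKernel hpm hpick hγ hf
  have hpol : Measurable fun x => pick (f x) := hpm.comp hf
  have hint : Integrable (fun x => ∑ a, actionKernel pick γ (f x) a *
      (f x (pick (f x)) - f x a)) μ := by
    have := (integrable_value (μ := μ) (isKernel_policyKernel hpol) hf h01).sub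
      (integrable_value hq hf h01)
    refine this.congr (.of_forall fun x => ?_)
    simp only [Pi.sub_apply, sum_policyKernel_mul, mul_sub, Finset.sum_sub_distrib,
      ← Finset.sum_mul, hq.sum_eq, one_mul]
  rw [kernelRegret_eq_integral hf h01 hpol hq, ← integral_const_mul]
  calc _ ≤ ∫ _, (K : ℝ) ∂μ := integral_mono (hint.const_mul γ) (integrable_const _)
        fun x => mul_sum_actionKernel_gap_le hpick hγ (f x)
    _ = K := by simp

/-- Transfer of the accuracy of a model `f'` under the kernel built from `f` to another kernel `q`.
The price is the inverse propensity of the actions of `q`, which is `K` plus `γ` times their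
regret predicted by `f`. -/
lemma abs_value_sub_value_le (hpm : Measurable pick)
    (hpick : ∀ (v : Fin K → ℝ) (a : Fin K), v a ≤ v (pick v)) (hγ : 0 ≤ γ) (hf : Measurable f)
    (h01 : ∀ x a, f x a ∈ Set.Icc (0 : ℝ) 1) {f' fstar q : X → Fin K → ℝ} (hf' : Measurable f')
    (h01' : ∀ x a, f' x a ∈ Set.Icc (0 : ℝ) 1) (hs : Measurable fstar)
    (h01s : ∀ x a, fstar x a ∈ Set.Icc (0 : ℝ) 1) (hq : IsKernel q) {η : ℝ} (hη : 0 < η) :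
    |value μ q f' - value μ q fstar| ≤
      (η * (K + γ * kernelRegret μ (fun x => pick (f x)) f q)
        + (∫ x, ∑ a, actionKernel pick γ (f x) a * (f' x a - fstar x a) ^ 2 ∂μ) / η) / 2 := by
  have hp := isKernel_actionKernel hpm hpick hγ hf
  have hpol : Measurable fun x => pick (f x) := hpm.comp hf
  have hd01 : ∀ x a, |f' x a - fstar x a| ≤ 1 := fun x a => by
    have h1 := h01' x a; have h2 := h01s x a
    rw [abs_le]; constructor <;> linarith [h1.1, h1.2, h2.1, h2.2]
  have hsq01 : ∀ x a, (f' x a - fstar x a) ^ 2 ∈ Set.Icc (0 : ℝ) 1 := fun x a =>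
    ⟨sq_nonneg _, by rw [← sq_abs]; exact pow_le_one₀ (abs_nonneg _) (hd01 x a)⟩
  have hsqm : Measurable fun x (a : Fin K) => (f' x a - fstar x a) ^ 2 :=
    measurable_pi_lambda _ fun a =>
      ((measurable_apply hf' a).sub (measurable_apply hs a)).pow_const 2
  have hmse : Integrable (fun x => ∑ a, actionKernel pick γ (f x) a *
      (f' x a - fstar x a) ^ 2) μ := integrable_value hp hsqm hsq01
  have hreg : Integrable (fun x => ∑ a, q x a * (f x (pick (f x)) - f x a)) μ := by
    have := (integrable_value (μ := μ) (isKernel_policyKernel hpol) hf h01).sub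
      (integrable_value hq hf h01)
    refine this.congr (.of_forall fun x => ?_)
    simp only [Pi.sub_apply, sum_policyKernel_mul, mul_sub, Finset.sum_sub_distrib,
      ← Finset.sum_mul, hq.sum_eq, one_mul]
  have hpoint : ∀ x, |∑ a, q x a * f' x a - ∑ a, q x a * fstar x a| ≤
      (η * (K + γ * ∑ a, q x a * (f x (pick (f x)) - f x a))
        + (∑ a, actionKernel pick γ (f x) a * (f' x a - fstar x a) ^ 2) / η) / 2 := by
    intro x
    have hterm : ∀ a, 2 * (q x a * |f' x a - fstar x a|) ≤
        η * (q x a * (K + γ * (f x (pick (f x)) - f x a)))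
          + actionKernel pick γ (f x) a * (f' x a - fstar x a) ^ 2 / η := by
      intro a
      obtain ⟨h1, h2⟩ := actionKernel_denom_pos hpick hγ (f x) a
      have h3 := one_le_actionKernel_mul hpick hγ (f x) a
      have h4 := hq.nonneg x a
      have h5 := hq.le_one x a
      have h6 := hp.nonneg x a
      set c : ℝ := K + γ * (f x (pick (f x)) - f x a)
      refine two_mul_le_of_sq_le_mul (mul_nonneg hη.le (mul_nonneg h4 (by linarith)))
        (by positivity) ?_
      have e : η * (q x a * c) * (actionKernel pick γ (f x) a * (f' x a - fstar x a) ^ 2 / η)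
          = q x a * (actionKernel pick γ (f x) a * c) * (f' x a - fstar x a) ^ 2 := by
        field_simp
      rw [e, mul_pow, sq_abs]
      refine mul_le_mul_of_nonneg_right ?_ (sq_nonneg _)
      calc q x a ^ 2 ≤ q x a * 1 := by nlinarith
        _ ≤ _ := mul_le_mul_of_nonneg_left h3 h4
    rw [← Finset.sum_sub_distrib]
    calc |∑ a, (q x a * f' x a - q x a * fstar x a)|
        ≤ ∑ a, |q x a * f' x a - q x a * fstar x a| := Finset.abs_sum_le_sum_abs _ _
      _ = (∑ a, 2 * (q x a * |f' x a - fstar x a|)) / 2 := by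
          rw [← Finset.mul_sum, mul_div_cancel_left₀ _ two_ne_zero]
          refine Finset.sum_congr rfl fun a _ => ?_
          rw [← mul_sub, abs_mul, abs_of_nonneg (hq.nonneg x a)]
      _ ≤ (∑ a, (η * (q x a * (K + γ * (f x (pick (f x)) - f x a)))
          + actionKernel pick γ (f x) a * (f' x a - fstar x a) ^ 2 / η)) / 2 :=
          div_le_div_of_nonneg_right (Finset.sum_le_sum fun a _ => hterm a) zero_le_two
      _ = _ := by
          rw [Finset.sum_add_distrib, ← Finset.mul_sum, ← Finset.sum_div]
          congr 3
          simp only [mul_add, Finset.sum_add_distrib, ← Finset.sum_mul, hq.sum_eq, one_mul]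
          rw [Finset.mul_sum]
          congr 2
          funext a; ring
  have hV : Integrable (fun x => η * (K + γ * ∑ a, q x a * (f x (pick (f x)) - f x a))) μ :=
    ((integrable_const (K : ℝ)).add (hreg.const_mul γ)).const_mul η
  have hR : Integrable (fun x => (η * (K + γ * ∑ a, q x a * (f x (pick (f x)) - f x a))
        + (∑ a, actionKernel pick γ (f x) a * (f' x a - fstar x a) ^ 2) / η) / 2) μ :=
    (hV.add (hmse.div_const η)).div_const 2
  unfold value
  rw [← integral_sub (integrable_value hq hf' h01') (integrable_value hq hs h01s)]
  calc _ ≤ ∫ x, |∑ a, q x a * f' x a - ∑ a, q x a * fstar x a| ∂μ := abs_integral_le_integral_abs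
    _ ≤ _ := integral_mono
        ((integrable_value hq hf' h01').sub (integrable_value hq hs h01s)).abs hR hpoint
    _ = _ := by
      rw [integral_div, integral_add hV (hmse.div_const η), integral_const_mul,
        integral_add (integrable_const _) (hreg.const_mul γ), integral_const_mul, integral_div,
        kernelRegret_eq_integral hf h01 hpol hq]
      simp

/-- One step of the FALCON analysis. If `f'` is accurate at scale `s` under the kernel built from
`f`, and the regrets predicted by `f` are controlled by the true ones at a scale that is at least
`s`, then the regrets predicted by `f'` and the true ones agree up to a factor `2` and an additive
term of order `s`. The constant `0.354` is an upper bound for `√(1/8)`. -/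
lemma kernelRegret_comparison (hpm : Measurable pick)
    (hpick : ∀ (v : Fin K → ℝ) (a : Fin K), v a ≤ v (pick v)) (hγ : 0 ≤ γ) (hf : Measurable f)
    (h01 : ∀ x a, f x a ∈ Set.Icc (0 : ℝ) 1) {f' fstar : X → Fin K → ℝ} (hf' : Measurable f')
    (h01' : ∀ x a, f' x a ∈ Set.Icc (0 : ℝ) 1) (hs : Measurable fstar)
    (h01s : ∀ x a, fstar x a ∈ Set.Icc (0 : ℝ) 1) {pol : X → Fin K} (hpol : Measurable pol)
    (hopt : ∀ x a, fstar x a ≤ fstar x (pol x)) (hK : 0 < K) {s : ℝ} (hs0 : 0 < s)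
    (hmse : K * (∫ x, ∑ a, actionKernel pick γ (f x) a * (f' x a - fstar x a) ^ 2 ∂μ)
      ≤ 2 * s ^ 2)
    (hprev : ∀ q, IsKernel q → γ * kernelRegret μ (fun x => pick (f x)) f q * s ≤
      0.354 * K * (2 * kernelRegret μ pol fstar q + 12 * s))
    {q : X → Fin K → ℝ} (hq : IsKernel q) :
    kernelRegret μ pol fstar q ≤ 2 * kernelRegret μ (fun x => pick (f' x)) f' q + 12 * s ∧
    kernelRegret μ (fun x => pick (f' x)) f' q ≤ 2 * kernelRegret μ pol fstar q + 12 * s := by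
  have hK' : (0 : ℝ) < K := by exact_mod_cast hK
  -- with `η = 0.6 s / K` at most a quarter of the true regret enters the error, which is absorbed by
  -- the factor `2`
  have err : ∀ q, IsKernel q →
      |value μ q f' - value μ q fstar| ≤ 4 * s + kernelRegret μ pol fstar q / 4 := by
    intro q hq
    have hR := kernelRegret_nonneg (μ := μ) hs h01s hpol hopt hq
    have h1 := abs_value_sub_value_le (μ := μ) hpm hpick hγ hf h01 hf' h01' hs h01s hq
      (η := 0.6 * s / K) (by positivity)
    have h2 := hprev q hq
    set R := kernelRegret μ pol fstar q
    set Rh := kernelRegret μ (fun x => pick (f x)) f q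
    set M := ∫ x, ∑ a, actionKernel pick γ (f x) a * (f' x a - fstar x a) ^ 2 ∂μ
    have e1 : 0.6 * s / K * (K + γ * Rh) ≤ 0.6 * s + 0.6 * (0.354 * (2 * R + 12 * s)) := by
      have : 0.6 * s / K * (K + γ * Rh) = 0.6 * s + 0.6 * ((γ * Rh * s) / K) := by field_simp
      rw [this]
      have h3 : γ * Rh * s / K ≤ 0.354 * (2 * R + 12 * s) := by
        rw [div_le_iff₀ hK']; linarith
      linarith
    have e2 : M / (0.6 * s / K) ≤ 2 * s / 0.6 := by
      have : M / (0.6 * s / K) = (K * M) / (0.6 * s) := by field_simp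
      rw [this, div_le_div_iff₀ (by positivity) (by norm_num)]
      nlinarith
    have e3 : 2 * s / 0.6 ≤ 3.34 * s := by
      rw [div_le_iff₀ (by norm_num)]; linarith
    refine h1.trans ?_
    linarith
  have hpm' : Measurable fun x => pick (f' x) := hpm.comp hf'
  have hqs := isKernel_policyKernel hpol
  have hqh := isKernel_policyKernel hpm'
  have e1 := abs_le.1 (err _ hqs)
  have e2 := abs_le.1 (err _ hqh)
  have e3 := abs_le.1 (err q hq)
  have hbest : value μ (policyKernel pol) f' ≤ value μ (policyKernel fun x => pick (f' x)) f' :=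
    value_le_value_policyKernel hqs hf' h01' hpm' fun x a => hpick (f' x) a
  have hR0 := kernelRegret_nonneg (μ := μ) hs h01s hpol hopt hq
  have hRh0 : 0 ≤ kernelRegret μ (fun x => pick (f' x)) f' q :=
    kernelRegret_nonneg (μ := μ) hf' h01' hpm' (fun x a => hpick (f' x) a) hq
  have hRqh0 := kernelRegret_nonneg (μ := μ) hs h01s hpol hopt hqh
  have hself : kernelRegret μ pol fstar (policyKernel pol) = 0 := sub_self _
  rw [hself] at e1
  unfold kernelRegret at *
  constructor <;> linarith

end FalconStep

/-! ### The epoch schedule and the estimation rate -/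

section Schedule

variable {τ₁ : ℕ}

lemma tau_zero : tau τ₁ 0 = 0 := rfl

lemma tau_one : tau τ₁ 1 = τ₁ := by simp [tau]

lemma tau_succ_succ (m : ℕ) : tau τ₁ (m + 2) = 2 * tau τ₁ (m + 1) := by
  simp only [tau, pow_succ]; ring

lemma tau_strictMono (hτ : 2 ≤ τ₁) : StrictMono (tau τ₁) := by
  refine strictMono_nat_of_lt_succ fun m => ?_
  cases m with
  | zero => rw [tau_zero, tau_one]; omega
  | succ m =>
    rw [tau_succ_succ]
    have : 0 < tau τ₁ (m + 1) := by simp only [tau]; positivity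
    omega

lemma epochOf_eq (hτ : 2 ≤ τ₁) {m t : ℕ} (h1 : tau τ₁ m < t) (h2 : t ≤ tau τ₁ (m + 1)) :
    epochOf τ₁ t = m + 1 := by
  refine le_antisymm (Nat.sInf_le h2) (le_csInf ⟨m + 1, h2⟩ fun k hk => ?_)
  by_contra! h
  have h3 : tau τ₁ k ≤ tau τ₁ m := (tau_strictMono hτ).monotone (by omega)
  have h4 : t ≤ tau τ₁ k := hk
  omega

/-- Every round `t ≥ 1` lies in an epoch. -/
lemma exists_epochOf_eq (hτ : 2 ≤ τ₁) {t : ℕ} (ht : 1 ≤ t) :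
    ∃ m, epochOf τ₁ t = m + 1 ∧ tau τ₁ m < t ∧ t ≤ tau τ₁ (m + 1) := by
  have hex : ∃ m, t ≤ tau τ₁ m := ⟨t, (tau_strictMono hτ).le_apply⟩
  have hpos : Nat.find hex ≠ 0 := by
    intro h
    have := Nat.find_spec hex
    rw [h, tau_zero] at this; omega
  obtain ⟨m, hm⟩ := Nat.exists_eq_succ_of_ne_zero hpos
  have h1 : tau τ₁ m < t := not_le.1 (Nat.find_min hex (by omega))
  have h2 : t ≤ tau τ₁ (m + 1) := by have := Nat.find_spec hex; rwa [hm] at this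
  exact ⟨m, epochOf_eq hτ h1 h2, h1, h2⟩

lemma epochOf_mono (hτ : 2 ≤ τ₁) {s t : ℕ} (hs : 1 ≤ s) (h : s ≤ t) :
    epochOf τ₁ s ≤ epochOf τ₁ t := by
  obtain ⟨m, hm, h1, h2⟩ := exists_epochOf_eq hτ hs
  obtain ⟨k, hk, h3, h4⟩ := exists_epochOf_eq hτ (hs.trans h)
  rw [hm, hk]
  by_contra! hlt
  have : tau τ₁ (k + 1) ≤ tau τ₁ m := (tau_strictMono hτ).monotone (by omega)
  omega

end Schedule

/-- The cumulative rate `∑ √ξ_{m(i)}` over the rounds `τ₁ < i ≤ t`. -/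
noncomputable def rateSum (ξ : ℕ → ℝ → ℝ) (τ₁ : ℕ) (c : ℝ) (t : ℕ) : ℝ :=
  ∑ i ∈ Finset.Icc (τ₁ + 1) t, √(epochRate ξ τ₁ c (epochOf τ₁ i))

section Rate

variable {ξ : ℕ → ℝ → ℝ} (hξ : ValidRate ξ) {τ₁ : ℕ} (hτ : 2 ≤ τ₁) {c : ℝ}

lemma rateSum_nonneg (t : ℕ) : 0 ≤ rateSum ξ τ₁ c t :=
  Finset.sum_nonneg fun _ _ => Real.sqrt_nonneg _

lemma rateSum_mono {s t : ℕ} (h : s ≤ t) : rateSum ξ τ₁ c s ≤ rateSum ξ τ₁ c t :=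
  Finset.sum_le_sum_of_subset_of_nonneg (Finset.Icc_subset_Icc_right h)
    fun _ _ _ => Real.sqrt_nonneg _

include hξ hτ in
lemma log_div_le_epochRate (hc : c ∈ Set.Ioo (0 : ℝ) 1) (m : ℕ) :
    Real.log (((m + 2 : ℕ) : ℝ) ^ 2 / c) / ((tau τ₁ (m + 1) - tau τ₁ m : ℕ) : ℝ)
      ≤ epochRate ξ τ₁ c (m + 2) := by
  have h1 : 1 ≤ tau τ₁ (m + 1) - tau τ₁ m := by
    have := tau_strictMono hτ (Nat.lt_add_one m)
    omega
  have hm : (1 : ℝ) ≤ ((m + 2 : ℕ) : ℝ) ^ 2 := one_le_pow₀ (by exact_mod_cast Nat.le_add_left 1 _)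
  have h2 := hξ.lower _ h1 (c / ((m + 2 : ℕ) : ℝ) ^ 2)
    ⟨div_pos hc.1 (by linarith), (div_lt_one (by linarith)).2 (hc.2.trans_le hm)⟩
  rw [one_div_div] at h2
  exact h2

lemma log_sq_div_pos (hc : c ∈ Set.Ioo (0 : ℝ) 1) (m : ℕ) :
    0 < Real.log (((m + 1 : ℕ) : ℝ) ^ 2 / c) := by
  refine Real.log_pos ((one_lt_div hc.1).2 (hc.2.trans_le ?_))
  exact one_le_pow₀ (by exact_mod_cast Nat.le_add_left 1 _)

include hξ hτ in
lemma epochRate_pos (hc : c ∈ Set.Ioo (0 : ℝ) 1) (m : ℕ) : 0 < epochRate ξ τ₁ c (m + 2) := by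
  refine lt_of_lt_of_le (div_pos (log_sq_div_pos hc (m + 1)) ?_) (log_div_le_epochRate hξ hτ hc m)
  have := tau_strictMono hτ (Nat.lt_add_one m)
  exact_mod_cast Nat.sub_pos_of_lt this

/-- An epoch is at least as long as the previous one. -/
lemma epoch_length_le (m : ℕ) :
    tau τ₁ (m + 1) - tau τ₁ m ≤ tau τ₁ (m + 2) - tau τ₁ (m + 1) := by
  rw [tau_succ_succ]; omega

include hξ hτ in
/-- A complete epoch contributes to the cumulative rate at least what the lower bound on `ξ`
gives. -/
lemma mul_log_le_rateSum_sq (hc : c ∈ Set.Ioo (0 : ℝ) 1) {m t : ℕ} (ht : tau τ₁ (m + 2) ≤ t) :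
    ((tau τ₁ (m + 2) - tau τ₁ (m + 1) : ℕ) : ℝ) * Real.log (((m + 2 : ℕ) : ℝ) ^ 2 / c)
      ≤ rateSum ξ τ₁ c t ^ 2 := by
  set n : ℕ := tau τ₁ (m + 2) - tau τ₁ (m + 1) with hn
  have hl := log_div_le_epochRate hξ hτ hc m
  have hn0 : 0 < tau τ₁ (m + 1) - tau τ₁ m :=
    Nat.sub_pos_of_lt (tau_strictMono hτ (Nat.lt_add_one m))
  have hlog := log_sq_div_pos hc (m + 1)
  have hle : ((tau τ₁ (m + 1) - tau τ₁ m : ℕ) : ℝ) ≤ n := by exact_mod_cast epoch_length_le m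
  have h1 : Real.log (((m + 2 : ℕ) : ℝ) ^ 2 / c) ≤ n * epochRate ξ τ₁ c (m + 2) := by
    rw [div_le_iff₀ (by exact_mod_cast hn0)] at hl
    refine hl.trans ?_
    rw [mul_comm]
    exact mul_le_mul_of_nonneg_right hle (epochRate_pos hξ hτ hc m).le
  have hsub : Finset.Ioc (tau τ₁ (m + 1)) (tau τ₁ (m + 2)) ⊆ Finset.Icc (τ₁ + 1) t := by
    intro i hi
    rw [Finset.mem_Ioc] at hi
    rw [Finset.mem_Icc]
    have : tau τ₁ 1 ≤ tau τ₁ (m + 1) := (tau_strictMono hτ).monotone (by omega)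
    rw [tau_one] at this
    omega
  have h2 : n * √(epochRate ξ τ₁ c (m + 2)) ≤ rateSum ξ τ₁ c t := by
    calc n * √(epochRate ξ τ₁ c (m + 2))
        = ∑ i ∈ Finset.Ioc (tau τ₁ (m + 1)) (tau τ₁ (m + 2)),
            √(epochRate ξ τ₁ c (epochOf τ₁ i)) := by
          rw [Finset.sum_congr rfl fun i hi => by
            rw [epochOf_eq hτ (Finset.mem_Ioc.1 hi).1 (Finset.mem_Ioc.1 hi).2]]
          simp [hn]
      _ ≤ _ := Finset.sum_le_sum_of_subset_of_nonneg hsub fun _ _ _ => Real.sqrt_nonneg _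
  calc (n : ℝ) * Real.log (((m + 2 : ℕ) : ℝ) ^ 2 / c)
      ≤ n * (n * epochRate ξ τ₁ c (m + 2)) := mul_le_mul_of_nonneg_left h1 (Nat.cast_nonneg _)
    _ = (n * √(epochRate ξ τ₁ c (m + 2))) ^ 2 := by
        rw [mul_pow, Real.sq_sqrt (epochRate_pos hξ hτ hc m).le]; ring
    _ ≤ _ := pow_le_pow_left₀ (by positivity) h2 2

include hξ hτ in
lemma mul_log_le_four_rateSum_sq (hc : c ∈ Set.Ioo (0 : ℝ) 1) {m t : ℕ}
    (h1 : tau τ₁ (m + 2) < t) (h2 : t ≤ tau τ₁ (m + 3)) :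
    t * Real.log (((m + 2 : ℕ) : ℝ) ^ 2 / c) ≤ 4 * rateSum ξ τ₁ c t ^ 2 := by
  have h := mul_log_le_rateSum_sq hξ hτ hc h1.le
  have h3 : t ≤ 4 * (tau τ₁ (m + 2) - tau τ₁ (m + 1)) := by
    have e1 := tau_succ_succ (τ₁ := τ₁) m
    have e2 : tau τ₁ (m + 3) = 2 * tau τ₁ (m + 2) := tau_succ_succ (m + 1)
    omega
  have h4 : (t : ℝ) ≤ 4 * ((tau τ₁ (m + 2) - tau τ₁ (m + 1) : ℕ) : ℝ) := by exact_mod_cast h3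
  have := mul_le_mul_of_nonneg_right h4 (log_sq_div_pos hc (m + 1)).le
  linarith

lemma one_le_log_thirteen : (1 : ℝ) ≤ Real.log 13 := by
  rw [Real.le_log_iff_exp_le (by norm_num)]
  have := Real.exp_one_lt_d9
  linarith

lemma log_inv_le_log_sq_div (hc : c ∈ Set.Ioo (0 : ℝ) 1) (m : ℕ) :
    Real.log (1 / c) ≤ Real.log (((m + 1 : ℕ) : ℝ) ^ 2 / c) := by
  have hc0 := hc.1
  refine Real.log_le_log (by positivity) (div_le_div_of_nonneg_right ?_ hc.1.le)
  exact one_le_pow₀ (by exact_mod_cast Nat.le_add_left 1 _)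

lemma one_le_log_inv (hc : 0 < c) (hc13 : c ≤ 1 / 13) : 1 ≤ Real.log (1 / c) := by
  refine one_le_log_thirteen.trans (Real.log_le_log (by norm_num) ?_)
  rw [le_div_iff₀ hc]; linarith

include hξ hτ in
/-- From round `τ₁²` on, the cumulative rate dominates the length of the first epoch. -/
lemma tau_one_le_rateSum (hc : 0 < c) (hc13 : c ≤ 1 / 13) {t : ℕ} (ht : τ₁ ^ 2 ≤ t) :
    (τ₁ : ℝ) ≤ 2 * rateSum ξ τ₁ c t := by
  have hcI : c ∈ Set.Ioo (0 : ℝ) 1 := ⟨hc, by linarith⟩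
  have hS := rateSum_nonneg (ξ := ξ) (τ₁ := τ₁) (c := c) t
  have hτ1 : (2 : ℝ) ≤ τ₁ := by exact_mod_cast hτ
  have htr : (τ₁ : ℝ) ^ 2 ≤ t := by exact_mod_cast ht
  have h2t : 2 * τ₁ ≤ t := by nlinarith
  have hlog := one_le_log_inv hc hc13
  suffices h : (τ₁ : ℝ) ^ 2 ≤ (2 * rateSum ξ τ₁ c t) ^ 2 from
    (abs_le_of_sq_le_sq' h (by positivity)).2
  by_cases hcase : t ≤ 2 * τ₁
  · -- only possible if `τ₁ = 2` and `t = 4`: epoch `2` has just been completed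
    have h : τ₁ ≤ 2 := by nlinarith
    have h1 := mul_log_le_rateSum_sq hξ hτ hcI (m := 0) (t := t)
      (by rw [tau_succ_succ, tau_one]; exact h2t)
    rw [tau_succ_succ, tau_one] at h1
    have h2 := log_inv_le_log_sq_div hcI 1
    have e : ((2 * τ₁ - τ₁ : ℕ) : ℝ) = τ₁ := by congr 1; omega
    rw [e] at h1
    have h3 : (τ₁ : ℝ) ≤ 2 := by exact_mod_cast h
    have h4 : (τ₁ : ℝ) * 1 ≤ τ₁ * Real.log (((0 + 2 : ℕ) : ℝ) ^ 2 / c) :=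
      mul_le_mul_of_nonneg_left (hlog.trans h2) (by linarith)
    nlinarith
  · obtain ⟨m, hm, h3, h4⟩ := exists_epochOf_eq hτ (t := t) (by omega)
    obtain ⟨k, rfl⟩ : ∃ k, m = k + 2 := by
      refine ⟨m - 2, ?_⟩
      by_contra hne
      have : tau τ₁ (m + 1) ≤ tau τ₁ 2 := (tau_strictMono hτ).monotone (by omega)
      rw [tau_succ_succ, tau_one] at this
      omega
    have h5 := mul_log_le_four_rateSum_sq hξ hτ hcI h3 h4
    have h6 := log_inv_le_log_sq_div hcI (k + 1)
    have : (t : ℝ) * 1 ≤ t * Real.log (((k + 2 : ℕ) : ℝ) ^ 2 / c) :=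
      mul_le_mul_of_nonneg_left (hlog.trans h6) (Nat.cast_nonneg _)
    nlinarith

include hξ hτ in
/-- The confidence width of the cumulative reward is dominated by the length of the first epoch and
the cumulative rate. In early epochs, where the index `m` may be much smaller than `log₂ τ₁`, the
number of rounds is so small that `τ₁` takes care of the logarithm. -/
lemma sqrt_log_ceil_le (hc : 0 < c) (hc13 : c ≤ 1 / 13) {m t : ℕ}
    (h1 : tau τ₁ (m + 2) < t) (h2 : t ≤ tau τ₁ (m + 3)) :
    √(2 * t * Real.log ((⌈((m + 3 : ℕ) : ℝ) + Real.logb 2 τ₁⌉₊ : ℝ) ^ 3 / c))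
      ≤ 6 * (τ₁ + rateSum ξ τ₁ c t) := by
  have hcI : c ∈ Set.Ioo (0 : ℝ) 1 := ⟨hc, by linarith⟩
  have hS := rateSum_nonneg (ξ := ξ) (τ₁ := τ₁) (c := c) t
  have hτ1 : (2 : ℝ) ≤ τ₁ := by exact_mod_cast hτ
  have h4S := mul_log_le_four_rateSum_sq hξ hτ hcI h1 h2
  set L := Real.logb 2 τ₁ with hL
  have hL0 : 0 ≤ L := Real.logb_nonneg (by norm_num) (by linarith)
  set N : ℝ := (⌈((m + 3 : ℕ) : ℝ) + L⌉₊ : ℝ) with hN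
  have hN1 : N ≤ m + 4 + L := by
    have := (Nat.ceil_lt_add_one (by positivity : 0 ≤ ((m + 3 : ℕ) : ℝ) + L)).le
    push_cast at this hN ⊢; linarith
  have hN3 : 3 ≤ N := by
    have : ((m + 3 : ℕ) : ℝ) + L ≤ N := Nat.le_ceil _
    push_cast at this; linarith [(Nat.cast_nonneg m : (0 : ℝ) ≤ m)]
  have hm0 : (0 : ℝ) ≤ m := Nat.cast_nonneg m
  have hlogc : 1 ≤ Real.log (1 / c) := one_le_log_inv hc hc13
  have hsplit : Real.log (N ^ 3 / c) = 3 * Real.log N + Real.log (1 / c) := by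
    rw [show N ^ 3 / c = N ^ 3 * (1 / c) by ring, Real.log_mul (by positivity) (by positivity),
      Real.log_pow]
    push_cast; ring
  have hlam : Real.log (((m + 2 : ℕ) : ℝ) ^ 2 / c)
      = 2 * Real.log (m + 2) + Real.log (1 / c) := by
    rw [show ((m + 2 : ℕ) : ℝ) ^ 2 / c = ((m : ℝ) + 2) ^ 2 * (1 / c) by push_cast; ring,
      Real.log_mul (by positivity) (by positivity), Real.log_pow]
    push_cast; ring
  have hlogm : 0 ≤ Real.log ((m : ℝ) + 2) := Real.log_nonneg (by linarith)
  have ht0 : (0 : ℝ) ≤ t := Nat.cast_nonneg t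
  have key : t * Real.log N ≤ 4 * rateSum ξ τ₁ c t ^ 2 + 4.5 * (τ₁ : ℝ) ^ 2 := by
    by_cases hcase : 4 ^ (m + 2) ≤ τ₁
    · -- few rounds: `t ≤ τ₁ ^ (3/2)`
      set y := √(τ₁ : ℝ) with hy
      have hy2 : y ^ 2 = τ₁ := Real.sq_sqrt (by positivity)
      have hy1 : 1 ≤ y := Real.one_le_sqrt.2 (by linarith)
      have hpow : ((2 : ℝ) ^ (m + 2)) ≤ y := by
        refine Real.le_sqrt_of_sq_le ?_
        rw [← pow_mul, mul_comm, pow_mul]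
        norm_num
        exact_mod_cast hcase
      have hty : (t : ℝ) ≤ y * τ₁ := by
        have : (t : ℝ) ≤ (2 ^ (m + 2) * τ₁ : ℕ) := by exact_mod_cast h2
        push_cast at this
        exact this.trans (mul_le_mul_of_nonneg_right hpow (by positivity))
      have hmL : 2 * ((m : ℝ) + 2) ≤ L := by
        rw [hL, Real.le_logb_iff_rpow_le (by norm_num) (by linarith),
          Real.rpow_mul (by norm_num)]
        norm_num
        have : ((4 : ℝ) ^ (m + 2)) ≤ τ₁ := by exact_mod_cast hcase
        exact_mod_cast this
      have hLy : L ≤ 2.9 * (y - 1) := by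
        rw [hL, Real.logb, div_le_iff₀ (Real.log_pos (by norm_num)), ← hy2, Real.log_pow]
        have h3 := Real.log_le_sub_one_of_pos (by linarith : 0 < y)
        have h4 := Real.log_two_gt_d9
        push_cast
        nlinarith
      have hlogN : Real.log N ≤ 4.5 * y := by
        have := Real.log_le_sub_one_of_pos (by linarith : 0 < N)
        linarith
      calc t * Real.log N ≤ (y * τ₁) * (4.5 * y) :=
            mul_le_mul hty hlogN (Real.log_nonneg (by linarith)) (by positivity)
        _ = 4.5 * (τ₁ : ℝ) ^ 2 := by rw [← hy2]; ring
        _ ≤ _ := by nlinarith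
    · -- here `log₂ τ₁` is at most of the order of `m`
      have hmL : L ≤ 2 * ((m : ℝ) + 2) := by
        rw [hL, Real.logb_le_iff_le_rpow (by norm_num) (by linarith),
          Real.rpow_mul (by norm_num)]
        norm_num
        have : (τ₁ : ℝ) ≤ ((4 : ℝ) ^ (m + 2)) := by
          push Not at hcase
          exact_mod_cast hcase.le
        exact_mod_cast this
      have hlogN : Real.log N ≤ Real.log (((m + 2 : ℕ) : ℝ) ^ 2 / c) := by
        rw [hlam]
        have h3 : N ≤ 13 * ((m : ℝ) + 2) := by linarith
        have h4 : Real.log N ≤ Real.log 13 + Real.log ((m : ℝ) + 2) := by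
          rw [← Real.log_mul (by norm_num) (by positivity)]
          exact Real.log_le_log (by linarith) h3
        have h5 : Real.log 13 ≤ Real.log (1 / c) := by
          refine Real.log_le_log (by norm_num) ?_
          rw [le_div_iff₀ hc]; linarith
        linarith
      calc t * Real.log N ≤ t * Real.log (((m + 2 : ℕ) : ℝ) ^ 2 / c) :=
            mul_le_mul_of_nonneg_left hlogN ht0
        _ ≤ _ := by nlinarith
  have hkey2 : t * Real.log (1 / c) ≤ 4 * rateSum ξ τ₁ c t ^ 2 := by
    refine le_trans (mul_le_mul_of_nonneg_left ?_ ht0) h4S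
    rw [hlam]; linarith
  rw [hsplit]
  refine Real.sqrt_le_iff.2 ⟨by positivity, ?_⟩
  nlinarith [mul_nonneg hS (by positivity : (0 : ℝ) ≤ τ₁)]

include hξ hτ in
/-- The level at which the error of the model of epoch `m + 3` is at most the rate of the
*previous* epoch. It lets the analysis work with the minimum of two consecutive rates, although the
rates need not be monotone in the epoch. -/
lemma exists_level_previous_rate {δ : ℝ} (hδ : δ ∈ Set.Ioo (0 : ℝ) 1)
    (hδτ : δ * Real.log τ₁ ≤ 100) (m : ℕ) :
    ∃ ζ ∈ Set.Ioo (0 : ℝ) 1, ζ ≤ δ / 13 / ((m + 2 : ℕ) : ℝ) ^ 2 ∧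
      ξ (tau τ₁ (m + 2) - tau τ₁ (m + 1)) ζ ≤ epochRate ξ τ₁ (δ / 13) (m + 2) := by
  have hδ0 := hδ.1
  have hm1 : (1 : ℝ) ≤ ((m + 2 : ℕ) : ℝ) ^ 2 :=
    one_le_pow₀ (by exact_mod_cast Nat.le_add_left 1 _)
  set ζ₀ : ℝ := δ / 13 / ((m + 2 : ℕ) : ℝ) ^ 2 with hζ₀
  have hζ0 : 0 < ζ₀ := by positivity
  have hζ1 : ζ₀ < 1 := by
    rw [hζ₀, div_div, div_lt_one (by positivity)]; nlinarith [hδ.2]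
  cases m with
  | zero =>
    -- the first two epochs have the same length
    refine ⟨ζ₀, ⟨hζ0, hζ1⟩, le_rfl, le_of_eq ?_⟩
    have e : tau τ₁ 2 - tau τ₁ 1 = tau τ₁ 1 - tau τ₁ 0 := by
      rw [tau_succ_succ, tau_zero, tau_one]; omega
    change ξ (tau τ₁ 2 - tau τ₁ 1) ζ₀ = ξ (tau τ₁ 1 - tau τ₁ 0) ζ₀
    rw [e]
  | succ k =>
    set n := tau τ₁ (k + 2) - tau τ₁ (k + 1) with hn
    have hn' : tau τ₁ (k + 1 + 2) - tau τ₁ (k + 1 + 1) = 2 * n := by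
      have e1 := tau_succ_succ (τ₁ := τ₁) k
      have e2 : tau τ₁ (k + 1 + 2) = 2 * tau τ₁ (k + 2) := tau_succ_succ (k + 1)
      rw [e2, show k + 1 + 1 = k + 2 from rfl]
      omega
    have hnval : n = 2 ^ k * τ₁ := by
      rw [hn, tau_succ_succ]; simp only [tau]; omega
    have hn2 : 2 ≤ n := by
      rw [hnval]
      exact hτ.trans (Nat.le_mul_of_pos_left _ (by positivity))
    have hnr : (2 : ℝ) ≤ n := by exact_mod_cast hn2
    have hlogn : 0 < Real.log n := Real.log_pos (by linarith)
    have hlog2n : Real.log n ≤ Real.log (2 * n : ℕ) :=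
      Real.log_le_log (by linarith) (by push_cast; linarith)
    have hlogneq : Real.log n = k * Real.log 2 + Real.log τ₁ := by
      have hτ1 : (2 : ℝ) ≤ τ₁ := by exact_mod_cast hτ
      rw [hnval]; push_cast
      rw [Real.log_mul (by positivity) (by positivity), Real.log_pow]
    -- follow the curve `c / ln n` from `n` to `2 n`; the hypothesis on `δ ln τ₁` keeps `c` below `1`
    set c := ζ₀ * Real.log n with hcdef
    have hc0 : 0 < c := by positivity
    have hc1 : c < 1 := by
      have hk : (0 : ℝ) ≤ k := Nat.cast_nonneg k
      have h1 : δ * Real.log n ≤ k + 100 := by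
        rw [hlogneq]
        have h2 := Real.log_two_lt_d9
        have h3 := Real.log_two_gt_d9
        have : δ * (k * Real.log 2) ≤ 1 * (k * 1) :=
          mul_le_mul hδ.2.le (mul_le_mul_of_nonneg_left (by linarith) hk) (by positivity)
            zero_le_one
        linarith
      have h4 : c = δ * Real.log n / (13 * ((k + 3 : ℕ) : ℝ) ^ 2) := by
        rw [hcdef, hζ₀]; push_cast; field_simp; ring
      rw [h4, div_lt_one (by positivity)]
      push_cast
      nlinarith
    refine ⟨c / Real.log (2 * n : ℕ), ⟨div_pos hc0 (by linarith), ?_⟩, ?_, ?_⟩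
    · rw [div_lt_one (by linarith)]
      calc c < 1 * Real.log n := mul_lt_mul_of_pos_right hζ1 hlogn
        _ ≤ _ := by linarith
    · rw [div_le_iff₀ (by linarith), hcdef]
      exact mul_le_mul_of_nonneg_left hlog2n hζ0.le
    · have h := hξ.antitone c ⟨hc0, hc1⟩ n (2 * n) hn2 (by omega)
        (by calc c < 1 * Real.log n := mul_lt_mul_of_pos_right hζ1 hlogn
              _ = _ := one_mul _)
      have e : c / Real.log n = ζ₀ := by rw [hcdef]; field_simp
      rw [e] at h
      rw [hn']
      exact h

end Rate

/-! ### Runs on the favourable event -/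

section Run

variable {X W : Type*} [MeasurableSpace X] {K : ℕ}

/-- The standing assumptions, for a fixed history `h` and fixed seeds `w`. -/
structure Standing (A : Algorithm X W K) (D : Measure (X × (Fin K → ℝ))) (fstar : X → Fin K → ℝ)
    (pol : X → Fin K) (B : ℝ) (h : ℕ → X × Fin K × ℝ) (w : ℕ → W) : Prop where
  two_le : 2 ≤ A.τ₁
  δ_mem : A.δ ∈ Set.Ioo (0 : ℝ) 1
  measurable_pick : Measurable A.pick
  le_pick : ∀ (v : Fin K → ℝ) (a : Fin K), v a ≤ v (A.pick v)
  rate : ValidRate A.ξ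
  meanReward : IsMeanReward D fstar
  optimal : IsOptimalPolicy fstar pol
  nonneg : 0 ≤ B
  measurable_model : ∀ m, Measurable (A.model h w m)
  model_mem : ∀ m x a, A.model h w m x a ∈ Set.Icc (0 : ℝ) 1

/-- The favourable event up to round `T`: the fitted models are accurate, at the rate of their own
epoch and at that of the previous epoch, and the rewards of the complete epochs and those up to the
test rounds are close to the values of the kernels that were played. -/
structure GoodRun (A : Algorithm X W K) (D : Measure (X × (Fin K → ℝ))) (fstar : X → Fin K → ℝ)
    (B : ℝ) (T : ℕ) (h : ℕ → X × Fin K × ℝ) (w : ℕ → W) : Prop where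
  error : ∀ m, tau A.τ₁ (m + 1) ≤ T → A.SafeAfter h (tau A.τ₁ (m + 1)) →
    meanSqError D (A.kernel h w (m + 1)) (A.model h w (m + 2)) fstar
      ≤ B + epochRate A.ξ A.τ₁ A.δ' (m + 2)
  error_prev : ∀ m, tau A.τ₁ (m + 2) ≤ T → A.SafeAfter h (tau A.τ₁ (m + 2)) →
    meanSqError D (A.kernel h w (m + 2)) (A.model h w (m + 3)) fstar
      ≤ B + epochRate A.ξ A.τ₁ A.δ' (m + 2)
  epoch_reward : ∀ m, tau A.τ₁ (m + 1) ≤ T →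
    |∑ i ∈ Finset.Ioc (tau A.τ₁ m) (tau A.τ₁ (m + 1)),
        ((h i).2.2 - value (D.map Prod.fst) (A.roundKernel h w i) fstar)|
      ≤ ((tau A.τ₁ (m + 1) - tau A.τ₁ m : ℕ) : ℝ) *
        √(1 / (2 * ((tau A.τ₁ (m + 1) - tau A.τ₁ m : ℕ) : ℝ))
          * Real.log (((m + 1 : ℕ) : ℝ) ^ 2 / A.δ'))
  test_reward : ∀ t, t ≤ T → A.IsTestRound t →
    |∑ i ∈ Finset.Icc 1 t,
        ((h i).2.2 - value (D.map Prod.fst) (A.roundKernel h w i) fstar)|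
      ≤ √(2 * t * Real.log ((⌈(epochOf A.τ₁ t : ℝ) + Real.logb 2 A.τ₁⌉₊ : ℝ) ^ 3 / A.δ'))

variable {A : Algorithm X W K} {h : ℕ → X × Fin K × ℝ} {w : ℕ → W}

omit [MeasurableSpace X] in
lemma Algorithm.one_le_K (A : Algorithm X W K) : (1 : ℝ) ≤ K := by exact_mod_cast (A.pick 0).pos

lemma sqrt_eighth_bounds : 0.353 ≤ √(1 / 8 : ℝ) ∧ √(1 / 8 : ℝ) ≤ 0.354 :=
  ⟨Real.le_sqrt_of_sq_le (by norm_num), Real.sqrt_le_iff.2 ⟨by norm_num, by norm_num⟩⟩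

lemma isProbabilityMeasure_map_fst (D : Measure (X × (Fin K → ℝ))) [IsProbabilityMeasure D] :
    IsProbabilityMeasure (D.map Prod.fst) :=
  Measure.isProbabilityMeasure_map measurable_fst.aemeasurable

omit [MeasurableSpace X] in
lemma Algorithm.γ_nonneg (A : Algorithm X W K) (m : ℕ) : 0 ≤ A.γ m := by
  unfold Algorithm.γ; split_ifs
  · exact zero_le_one
  · positivity

omit [MeasurableSpace X] in
lemma Algorithm.SafeAfter.mono {s t : ℕ} (hs : A.SafeAfter h t) (hst : s ≤ t) :
    A.SafeAfter h s := by
  induction t with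
  | zero => rwa [Nat.le_zero.1 hst]
  | succ t ih =>
    rcases Nat.of_le_succ hst with h1 | h1
    · exact ih hs.1 h1
    · rwa [h1]

omit [MeasurableSpace X] in
lemma Algorithm.SafeAfter.threshold_le {t : ℕ} (hs : A.SafeAfter h t) (ht : 1 ≤ t)
    (htest : A.IsTestRound t) : A.threshold h t ≤ Algorithm.cumReward h t := by
  obtain ⟨t, rfl⟩ := Nat.exists_eq_add_of_le' ht
  exact hs.2 htest

omit [MeasurableSpace X] in
lemma Algorithm.monotone_lower : Monotone (A.lower h) :=
  monotone_nat_of_le_succ fun _ => le_max_left _ _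

omit [MeasurableSpace X] in
lemma Algorithm.lower'_le_lower (m : ℕ) : A.lower' h (m + 1) ≤ A.lower h (m + 1) :=
  le_max_right _ _

variable {D : Measure (X × (Fin K → ℝ))} {fstar : X → Fin K → ℝ} {pol : X → Fin K} {B : ℝ} {T : ℕ}

lemma sum_regret_eq (t : ℕ) :
    ∑ i ∈ Finset.Icc 1 t, kernelRegret (D.map Prod.fst) pol fstar (A.roundKernel h w i) =
      t * value (D.map Prod.fst) (policyKernel pol) fstar -
        ∑ i ∈ Finset.Icc 1 t, value (D.map Prod.fst) (A.roundKernel h w i) fstar := by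
  simp only [kernelRegret, Finset.sum_sub_distrib, Finset.sum_const, Nat.card_Icc, nsmul_eq_mul,
    Nat.add_sub_cancel]

omit [MeasurableSpace X] in
lemma Algorithm.threshold_eq (t : ℕ) : A.threshold h t = t * A.lower h (epochOf A.τ₁ t - 1) - A.τ₁
    - √(2 * t * Real.log ((⌈(epochOf A.τ₁ t : ℝ) + Real.logb 2 A.τ₁⌉₊ : ℝ) ^ 3 / A.δ'))
    - 20.3 * (√K * rateSum A.ξ A.τ₁ A.δ' t) := by
  rw [Algorithm.threshold, rateSum]; ring

namespace Standing

variable (S : Standing A D fstar pol B h w)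
include S

lemma δ'_mem : A.δ' ∈ Set.Ioo (0 : ℝ) 1 :=
  ⟨div_pos S.δ_mem.1 (by norm_num), (div_lt_one (by norm_num)).2 (by linarith [S.δ_mem.2])⟩

lemma δ'_le : A.δ' ≤ 1 / 13 := div_le_div_of_nonneg_right S.δ_mem.2.le (by norm_num)

lemma isKernel (m : ℕ) : IsKernel (A.kernel h w m) :=
  isKernel_actionKernel S.measurable_pick S.le_pick (A.γ_nonneg m) (S.measurable_model m)

lemma isKernel_roundKernel (t : ℕ) : IsKernel (A.roundKernel h w t) := by
  unfold Algorithm.roundKernel; split_ifs <;> exact S.isKernel _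

lemma rate_pos (m : ℕ) : 0 < epochRate A.ξ A.τ₁ A.δ' (m + 2) :=
  epochRate_pos S.rate S.two_le S.δ'_mem m

lemma roundKernel_eq {m t : ℕ} (h1 : tau A.τ₁ m < t) (h2 : t ≤ tau A.τ₁ (m + 1))
    (hs : A.SafeAfter h (t - 1)) : A.roundKernel h w t = A.kernel h w (m + 1) := by
  unfold Algorithm.roundKernel
  rw [if_pos hs, epochOf_eq S.two_le h1 h2]

/-- The exploration parameter balances `γ` against the rate: `γ_m √(K ξ_m) = K / √8`. -/
lemma γ_mul (m : ℕ) : A.γ (m + 2) * √(K * epochRate A.ξ A.τ₁ A.δ' (m + 2)) = √(1 / 8) * K := by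
  have h1 := S.rate_pos m
  have hK := A.one_le_K
  unfold Algorithm.γ
  rw [if_neg (by omega), mul_assoc, ← Real.sqrt_mul (by positivity)]
  congr 1
  rw [show (K : ℝ) / epochRate A.ξ A.τ₁ A.δ' (m + 2) * (K * epochRate A.ξ A.τ₁ A.δ' (m + 2))
    = (K : ℝ) ^ 2 by field_simp]
  exact Real.sqrt_sq (by linarith)

variable [IsProbabilityMeasure D]

lemma regret_nonneg {q : X → Fin K → ℝ} (hq : IsKernel q) :
    0 ≤ kernelRegret (D.map Prod.fst) pol fstar q :=
  have := isProbabilityMeasure_map_fst D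
  kernelRegret_nonneg S.meanReward.measurable S.meanReward.mem_Icc S.optimal.measurable
    S.optimal.le hq

lemma regret_le_one {q : X → Fin K → ℝ} (hq : IsKernel q) :
    kernelRegret (D.map Prod.fst) pol fstar q ≤ 1 :=
  have := isProbabilityMeasure_map_fst D
  kernelRegret_le_one S.meanReward.measurable S.meanReward.mem_Icc S.optimal.measurable hq

variable (G : GoodRun A D fstar B T h w)
include G

/-- As long as the misspecification `B` is below all previous rates, true and predicted regrets
agree up to a factor `2` and an additive term whose square is at most `K max(B, ξ_m)`. The scale
that is found involves the minimum of `ξ_m` and the previous rate: the exploration parameter of the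
kernel that produced the data is tuned to the previous rate, which `ξ_m` may exceed. -/
lemma exists_scale (m : ℕ) (hT : tau A.τ₁ (m + 1) ≤ T) (hs : A.SafeAfter h (tau A.τ₁ (m + 1)))
    (hB : ∀ j < m, B ≤ epochRate A.ξ A.τ₁ A.δ' (j + 2)) :
    ∃ s : ℝ, 0 < s ∧ s ^ 2 ≤ K * max B (epochRate A.ξ A.τ₁ A.δ' (m + 2)) ∧
      ∀ q, IsKernel q →
        kernelRegret (D.map Prod.fst) pol fstar q ≤ 2 * kernelRegret (D.map Prod.fst)
            (fun x => A.pick (A.model h w (m + 2) x)) (A.model h w (m + 2)) q + 12 * s ∧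
        kernelRegret (D.map Prod.fst) (fun x => A.pick (A.model h w (m + 2) x))
            (A.model h w (m + 2)) q ≤ 2 * kernelRegret (D.map Prod.fst) pol fstar q + 12 * s := by
  have := isProbabilityMeasure_map_fst D
  have hK := A.one_le_K
  have hK0 : 0 < K := (A.pick 0).pos
  induction m with
  | zero =>
    have hξ := S.rate_pos 0
    set M := max B (epochRate A.ξ A.τ₁ A.δ' (0 + 2)) with hM
    have hM0 : 0 < M := lt_max_of_lt_right hξ
    have hs0 : 0 < √(K * M) := Real.sqrt_pos.2 (by positivity)
    have hs2 : √(K * M) ^ 2 = K * M := Real.sq_sqrt (by positivity)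
    refine ⟨√(K * M), hs0, hs2.le, fun q hq => ?_⟩
    have he := G.error 0 hT hs
    refine kernelRegret_comparison S.measurable_pick S.le_pick (A.γ_nonneg 1)
      (S.measurable_model 1) (S.model_mem 1) (S.measurable_model 2) (S.model_mem 2)
      S.meanReward.measurable S.meanReward.mem_Icc S.optimal.measurable S.optimal.le hK0 hs0
      ?_ (fun q hq => ?_) hq
    · rw [hs2]
      have h1 : B ≤ M := le_max_left _ _
      have h2 : epochRate A.ξ A.τ₁ A.δ' (0 + 2) ≤ M := le_max_right _ _
      have h3 : meanSqError D (A.kernel h w (0 + 1)) (A.model h w (0 + 2)) fstar ≤ 2 * M := by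
        linarith
      calc _ ≤ K * (2 * M) := mul_le_mul_of_nonneg_left h3 (by linarith)
        _ = _ := by ring
    · -- the model of the first epoch is zero, so it predicts no regret
      have h0 : kernelRegret (D.map Prod.fst) (fun x => A.pick (A.model h w 1 x))
          (A.model h w 1) q = 0 := by
        simp [kernelRegret, value, Algorithm.model]
      rw [h0]
      have := S.regret_nonneg hq
      rw [mul_zero, zero_mul]
      positivity
  | succ m ih =>
    have hle : tau A.τ₁ (m + 1) ≤ tau A.τ₁ (m + 2) :=
      (tau_strictMono S.two_le).monotone (by omega)
    obtain ⟨s, hs0, hs2, hcomp⟩ := ih (hle.trans hT) (hs.mono hle) fun j hj => hB j (by omega)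
    have hBm : B ≤ epochRate A.ξ A.τ₁ A.δ' (m + 2) := hB m (by omega)
    have hξ := S.rate_pos m
    have hξ' := S.rate_pos (m + 1)
    rw [max_eq_right hBm] at hs2
    set M := max B (min (epochRate A.ξ A.τ₁ A.δ' (m + 1 + 2)) (epochRate A.ξ A.τ₁ A.δ' (m + 2)))
      with hM
    have hM0 : 0 < M := lt_max_of_lt_right (lt_min hξ' hξ)
    have hMle : M ≤ epochRate A.ξ A.τ₁ A.δ' (m + 2) := max_le hBm (min_le_right _ _)
    have hMle' : M ≤ max B (epochRate A.ξ A.τ₁ A.δ' (m + 1 + 2)) :=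
      max_le_max le_rfl (min_le_left _ _)
    have ht0 : 0 < √(K * M) := Real.sqrt_pos.2 (by positivity)
    have ht2 : √(K * M) ^ 2 = K * M := Real.sq_sqrt (by positivity)
    refine ⟨√(K * M), ht0, ht2.le.trans (mul_le_mul_of_nonneg_left hMle' (by linarith)),
      fun q hq => ?_⟩
    have he := G.error (m + 1) hT hs
    have he' := G.error_prev m hT hs
    refine kernelRegret_comparison S.measurable_pick S.le_pick (A.γ_nonneg (m + 2))
      (S.measurable_model (m + 2)) (S.model_mem (m + 2)) (S.measurable_model (m + 3))
      (S.model_mem (m + 3)) S.meanReward.measurable S.meanReward.mem_Icc S.optimal.measurable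
      S.optimal.le hK0 ht0 ?_ (fun q hq => ?_) hq
    · rw [ht2]
      have h1 : B ≤ M := le_max_left _ _
      have h2 : min (epochRate A.ξ A.τ₁ A.δ' (m + 1 + 2)) (epochRate A.ξ A.τ₁ A.δ' (m + 2)) ≤ M :=
        le_max_right _ _
      have h3 : meanSqError D (A.kernel h w (m + 2)) (A.model h w (m + 3)) fstar ≤ 2 * M := by
        rcases min_le_iff.1 h2 with h4 | h4
        · exact he.trans (by linarith)
        · exact he'.trans (by linarith)
      calc _ ≤ K * (2 * M) := mul_le_mul_of_nonneg_left h3 (by linarith)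
        _ = _ := by ring
    · have hγ := S.γ_mul m
      have hγ0 := A.γ_nonneg (m + 2)
      have h8 := sqrt_eighth_bounds
      set R := √(K * epochRate A.ξ A.τ₁ A.δ' (m + 2)) with hR
      have hsR : s ≤ R := Real.le_sqrt_of_sq_le hs2
      have htR : √(K * M) ≤ R :=
        Real.sqrt_le_sqrt (mul_le_mul_of_nonneg_left hMle (by linarith))
      have hreg := S.regret_nonneg hq
      have hc := (hcomp q hq).2
      have hγR : A.γ (m + 2) * R ≤ 0.354 * K := by
        rw [hγ]; exact mul_le_mul_of_nonneg_right h8.2 (by linarith)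
      have hγt : A.γ (m + 2) * √(K * M) ≤ 0.354 * K :=
        (mul_le_mul_of_nonneg_left htR hγ0).trans hγR
      have hγs : A.γ (m + 2) * s ≤ 0.354 * K :=
        (mul_le_mul_of_nonneg_left hsR hγ0).trans hγR
      calc _ ≤ A.γ (m + 2) * (2 * kernelRegret (D.map Prod.fst) pol fstar q + 12 * s)
              * √(K * M) :=
            mul_le_mul_of_nonneg_right (mul_le_mul_of_nonneg_left hc hγ0) ht0.le
        _ = (A.γ (m + 2) * √(K * M)) * (2 * kernelRegret (D.map Prod.fst) pol fstar q)
              + (A.γ (m + 2) * s) * (12 * √(K * M)) := by ring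
        _ ≤ (0.354 * K) * (2 * kernelRegret (D.map Prod.fst) pol fstar q)
              + (0.354 * K) * (12 * √(K * M)) :=
            add_le_add (mul_le_mul_of_nonneg_right hγt (by positivity))
              (mul_le_mul_of_nonneg_right hγs (by positivity))
        _ = _ := by ring

/-- The regret of the kernel of an epoch all of whose predecessors have rates above `B`. The
constant `20.3` is the one of the misspecification test; `2 · 2.84 + 12 ≤ 20.3`. -/
lemma regret_kernel_le (m : ℕ) (hT : tau A.τ₁ (m + 1) ≤ T) (hs : A.SafeAfter h (tau A.τ₁ (m + 1)))
    (hB : ∀ j < m, B ≤ epochRate A.ξ A.τ₁ A.δ' (j + 2)) :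
    kernelRegret (D.map Prod.fst) pol fstar (A.kernel h w (m + 2)) ≤
      20.3 * (√K * √(epochRate A.ξ A.τ₁ A.δ' (m + 2))) + 12 * √(K * B) := by
  have := isProbabilityMeasure_map_fst D
  have hK := A.one_le_K
  obtain ⟨s, hs0, hs2, hcomp⟩ := S.exists_scale G m hT hs hB
  have h1 := (hcomp _ (S.isKernel (m + 2))).1
  have h2 := mul_kernelRegret_actionKernel_le (μ := D.map Prod.fst) S.measurable_pick S.le_pick
    (A.γ_nonneg (m + 2)) (S.measurable_model (m + 2)) (S.model_mem (m + 2))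
  have hγ := S.γ_mul m
  have hξ := S.rate_pos m
  have h8 := sqrt_eighth_bounds
  rw [← Real.sqrt_mul (by linarith)]
  set R := √(K * epochRate A.ξ A.τ₁ A.δ' (m + 2)) with hR
  have hR0 : 0 < R := Real.sqrt_pos.2 (by positivity)
  have hγ0 : 0 < A.γ (m + 2) := by
    refine lt_of_le_of_ne (A.γ_nonneg _) fun h0 => ?_
    rw [← h0, zero_mul] at hγ
    have : 0 < √(1 / 8 : ℝ) * K := by positivity
    linarith
  have hsle : s ≤ √(K * B) + R := by
    have hB0 := S.nonneg
    refine (Real.le_sqrt_of_sq_le hs2).trans ?_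
    rcases max_choice B (epochRate A.ξ A.τ₁ A.δ' (m + 2)) with h3 | h3
    · rw [h3]; linarith
    · rw [h3]; linarith [Real.sqrt_nonneg ((K : ℝ) * B)]
  have h3 : kernelRegret (D.map Prod.fst) (fun x => A.pick (A.model h w (m + 2) x))
      (A.model h w (m + 2)) (A.kernel h w (m + 2)) ≤ 2.84 * R := by
    refine le_of_mul_le_mul_left ?_ hγ0
    calc _ ≤ (K : ℝ) := h2
      _ ≤ 2.84 * (√(1 / 8) * K) := by nlinarith
      _ = _ := by rw [← hγ]; ring
  linarith

omit [IsProbabilityMeasure D] in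
/-- The bound `l'` of a safe epoch lies below the value of its kernel, by at most twice the width. -/
lemma epoch_lower (m : ℕ) (hT : tau A.τ₁ (m + 1) ≤ T) (hs : A.SafeAfter h (tau A.τ₁ (m + 1))) :
    A.lower' h (m + 1) ≤ value (D.map Prod.fst) (A.kernel h w (m + 1)) fstar ∧
    value (D.map Prod.fst) (A.kernel h w (m + 1)) fstar ≤ A.lower' h (m + 1) +
      2 * √(1 / (2 * ((tau A.τ₁ (m + 1) - tau A.τ₁ m : ℕ) : ℝ))
          * Real.log (((m + 1 : ℕ) : ℝ) ^ 2 / A.δ')) := by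
  have h1 := G.epoch_reward m hT
  have hlt := tau_strictMono S.two_le (Nat.lt_add_one m)
  have hn : (0 : ℝ) < ((tau A.τ₁ (m + 1) - tau A.τ₁ m : ℕ) : ℝ) := by
    exact_mod_cast Nat.sub_pos_of_lt hlt
  have hconst : ∑ i ∈ Finset.Ioc (tau A.τ₁ m) (tau A.τ₁ (m + 1)),
      value (D.map Prod.fst) (A.roundKernel h w i) fstar = ((tau A.τ₁ (m + 1) - tau A.τ₁ m : ℕ) : ℝ)
        * value (D.map Prod.fst) (A.kernel h w (m + 1)) fstar := by
    rw [Finset.sum_congr rfl fun i hi => by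
      rw [S.roundKernel_eq (Finset.mem_Ioc.1 hi).1 (Finset.mem_Ioc.1 hi).2
        (hs.mono (by rw [Finset.mem_Ioc] at hi; omega))]]
    rw [Finset.sum_const, Nat.card_Ioc, nsmul_eq_mul]
  rw [Finset.sum_sub_distrib, hconst] at h1
  unfold Algorithm.lower'
  simp only [Nat.add_sub_cancel]
  set n : ℝ := ((tau A.τ₁ (m + 1) - tau A.τ₁ m : ℕ) : ℝ)
  set V := value (D.map Prod.fst) (A.kernel h w (m + 1)) fstar
  set Q := ∑ t ∈ Finset.Ioc (tau A.τ₁ m) (tau A.τ₁ (m + 1)), (h t).2.2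
  set ω := √(1 / (2 * n) * Real.log (((m + 1 : ℕ) : ℝ) ^ 2 / A.δ'))
  rw [abs_le] at h1
  have e : Q = n * (Q / n) := by field_simp
  constructor
  · have : n * (Q / n - V) ≤ n * ω := by rw [mul_sub, ← e]; exact h1.2
    linarith [le_of_mul_le_mul_left this hn]
  · have : n * (V - Q / n) ≤ n * ω := by rw [mul_sub, ← e]; linarith [h1.1]
    linarith [le_of_mul_le_mul_left this hn]

/-- The lower confidence bound is valid for the kernel of the epoch that is remembered. -/
lemma lower_le_value (m : ℕ) (hT : tau A.τ₁ m ≤ T) (hs : A.SafeAfter h (tau A.τ₁ m)) :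
    A.lower h m ≤ value (D.map Prod.fst) (A.kernel h w (A.safeEpoch h m)) fstar := by
  have := isProbabilityMeasure_map_fst D
  induction m with
  | zero =>
    exact (value_mem_Icc (S.isKernel _) S.meanReward.measurable S.meanReward.mem_Icc).1
  | succ m ih =>
    have hle : tau A.τ₁ m ≤ tau A.τ₁ (m + 1) := (tau_strictMono S.two_le).monotone (by omega)
    by_cases hc : A.lower h (m + 1) = A.lower h m
    · have e : A.safeEpoch h (m + 1) = A.safeEpoch h m := by
        rw [Algorithm.safeEpoch, if_neg fun hh => hh.2 hc]
      rw [hc, e]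
      exact ih (hle.trans hT) (hs.mono hle)
    · have e : A.safeEpoch h (m + 1) = m + 1 := by
        rw [Algorithm.safeEpoch, if_pos ⟨hs, hc⟩]
      have h2 : A.lower h (m + 1) = A.lower' h (m + 1) := by
        rcases max_choice (A.lower h m) (A.lower' h (m + 1)) with h3 | h3
        · exact absurd h3 hc
        · exact h3
      rw [e, h2]
      exact (S.epoch_lower G m hT hs).1

/-- Once the rate of a past epoch has fallen below the misspecification `B`, the lower confidence
bound is optimal up to `O(√(K B))`: the first such epoch is still covered by `regret_kernel_le`. -/
lemma value_sub_lower_le (m : ℕ) (hT : tau A.τ₁ (m + 1) ≤ T)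
    (hs : A.SafeAfter h (tau A.τ₁ (m + 1)))
    (hB : ∃ j < m, epochRate A.ξ A.τ₁ A.δ' (j + 2) < B) :
    value (D.map Prod.fst) (policyKernel pol) fstar - A.lower h (m + 1) ≤ 35 * √(K * B) := by
  classical
  have hK := A.one_le_K
  -- the first epoch with a rate below `B`
  obtain ⟨hjm, hjB⟩ := Nat.find_spec hB
  have hmin : ∀ i < Nat.find hB, B ≤ epochRate A.ξ A.τ₁ A.δ' (i + 2) := fun i hi => by
    by_contra! hlt
    exact Nat.find_min hB hi ⟨hi.trans hjm, hlt⟩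
  set j := Nat.find hB
  have hle1 : tau A.τ₁ (j + 1) ≤ tau A.τ₁ (m + 1) :=
    (tau_strictMono S.two_le).monotone (by omega)
  have hle2 : tau A.τ₁ (j + 2) ≤ tau A.τ₁ (m + 1) :=
    (tau_strictMono S.two_le).monotone (by omega)
  have h1 := S.regret_kernel_le G j (hle1.trans hT) (hs.mono hle1) hmin
  have h2 := (S.epoch_lower G (j + 1) (hle2.trans hT) (hs.mono hle2)).2
  have h3 : A.lower' h (j + 1 + 1) ≤ A.lower h (m + 1) :=
    (A.lower'_le_lower (j + 1)).trans (A.monotone_lower (by omega))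
  have hξ := S.rate_pos j
  have hsqrt : √(epochRate A.ξ A.τ₁ A.δ' (j + 2)) ≤ √B := Real.sqrt_le_sqrt hjB.le
  have hKB : √((K : ℝ) * B) = √K * √B := Real.sqrt_mul (by linarith) _
  have hK1 : 1 ≤ √(K : ℝ) := Real.one_le_sqrt.2 hK
  have hwidth : √(1 / (2 * ((tau A.τ₁ (j + 1 + 1) - tau A.τ₁ (j + 1) : ℕ) : ℝ))
      * Real.log (((j + 1 + 1 : ℕ) : ℝ) ^ 2 / A.δ')) ≤ √B := by
    refine Real.sqrt_le_sqrt (le_trans ?_ hjB.le)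
    have hl := log_div_le_epochRate S.rate S.two_le S.δ'_mem j
    have hn0 : (0 : ℝ) < ((tau A.τ₁ (j + 1) - tau A.τ₁ j : ℕ) : ℝ) := by
      exact_mod_cast Nat.sub_pos_of_lt (tau_strictMono S.two_le (Nat.lt_add_one j))
    have hle : ((tau A.τ₁ (j + 1) - tau A.τ₁ j : ℕ) : ℝ)
        ≤ ((tau A.τ₁ (j + 1 + 1) - tau A.τ₁ (j + 1) : ℕ) : ℝ) := by
      exact_mod_cast epoch_length_le j
    have hlog := log_sq_div_pos S.δ'_mem (j + 1)
    refine le_trans ?_ hl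
    rw [div_mul_eq_mul_div, one_mul]
    exact div_le_div_of_nonneg_left hlog.le hn0 (by linarith)
  have hB0 : 0 ≤ √B := Real.sqrt_nonneg _
  have h5 : √(K : ℝ) * √(epochRate A.ξ A.τ₁ A.δ' (j + 2)) ≤ √K * √B :=
    mul_le_mul_of_nonneg_left hsqrt (by positivity)
  have h6 : √B ≤ √K * √B := le_mul_of_one_le_left hB0 hK1
  unfold kernelRegret at h1
  rw [hKB] at h1 ⊢
  linarith

/-- The cumulative regret as long as the status is safe and the past rates exceed `B`. -/
lemma sum_regret_le_of_rates {t : ℕ} (htT : t ≤ T) (hs : A.SafeAfter h (t - 1))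
    (hB : ∀ j, j + 2 < epochOf A.τ₁ t → B ≤ epochRate A.ξ A.τ₁ A.δ' (j + 2)) :
    ∑ i ∈ Finset.Icc 1 t, kernelRegret (D.map Prod.fst) pol fstar (A.roundKernel h w i) ≤
      A.τ₁ + 20.3 * (√K * rateSum A.ξ A.τ₁ A.δ' t) + 12 * √(K * B) * t := by
  have hKB : 0 ≤ √((K : ℝ) * B) := Real.sqrt_nonneg _
  have hterm : ∀ i ∈ Finset.Icc 1 t,
      kernelRegret (D.map Prod.fst) pol fstar (A.roundKernel h w i) ≤
        ((if i ≤ A.τ₁ then 1 else 0) + (if A.τ₁ + 1 ≤ i then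
          20.3 * (√K * √(epochRate A.ξ A.τ₁ A.δ' (epochOf A.τ₁ i))) else 0)) + 12 * √(K * B) := by
    intro i hi
    rw [Finset.mem_Icc] at hi
    by_cases hi1 : i ≤ A.τ₁
    · rw [if_pos hi1, if_neg (by omega)]
      linarith [S.regret_le_one (S.isKernel_roundKernel i)]
    · rw [if_neg hi1, if_pos (by omega), zero_add]
      obtain ⟨m, hm, h1, h2⟩ := exists_epochOf_eq S.two_le hi.1
      cases m with
      | zero => rw [zero_add, tau_one] at h2; exact absurd h2 hi1
      | succ m =>
        rw [S.roundKernel_eq h1 h2 (hs.mono (by omega)), hm]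
        refine S.regret_kernel_le G m (by omega) (hs.mono (by omega)) fun j hj => hB j ?_
        have := epochOf_mono S.two_le hi.1 hi.2
        omega
  refine (Finset.sum_le_sum hterm).trans ?_
  rw [Finset.sum_add_distrib, Finset.sum_add_distrib, Finset.sum_const, Nat.card_Icc,
    nsmul_eq_mul, Nat.add_sub_cancel]
  have e1 : ∑ i ∈ Finset.Icc 1 t, (if i ≤ A.τ₁ then (1 : ℝ) else 0) ≤ A.τ₁ := by
    rw [← Finset.sum_filter, Finset.sum_const, nsmul_eq_mul, mul_one]
    have : (Finset.Icc 1 t).filter (· ≤ A.τ₁) ⊆ Finset.Icc 1 A.τ₁ := fun i hi => by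
      simp only [Finset.mem_filter, Finset.mem_Icc] at hi ⊢; omega
    have := Finset.card_le_card this
    rw [Nat.card_Icc, Nat.add_sub_cancel] at this
    exact_mod_cast this
  have e2 : ∑ i ∈ Finset.Icc 1 t, (if A.τ₁ + 1 ≤ i then
      20.3 * (√K * √(epochRate A.ξ A.τ₁ A.δ' (epochOf A.τ₁ i))) else 0)
      = 20.3 * (√K * rateSum A.ξ A.τ₁ A.δ' t) := by
    rw [← Finset.sum_filter, rateSum, Finset.mul_sum, Finset.mul_sum]
    refine Finset.sum_congr ?_ fun _ _ => rfl
    ext i; simp only [Finset.mem_filter, Finset.mem_Icc]; omega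
  rw [e2]
  linarith

/-- The cumulative regret within an epoch whose predecessors include one with rate below `B`. The
last test that was passed controls the regret up to its round, and as the kernel is the same in
the whole epoch and the tests are dyadic, at most doubling it covers the rounds since then. -/
lemma sum_regret_le_of_test {m t : ℕ} (htT : t ≤ T) (hs : A.SafeAfter h (t - 1))
    (h1 : tau A.τ₁ (m + 1) + 2 ≤ t) (h2 : t ≤ tau A.τ₁ (m + 2))
    (hB : ∃ j < m, epochRate A.ξ A.τ₁ A.δ' (j + 2) < B) :
    ∑ i ∈ Finset.Icc 1 t, kernelRegret (D.map Prod.fst) pol fstar (A.roundKernel h w i) ≤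
      26 * A.τ₁ + 65 * (√K * rateSum A.ξ A.τ₁ A.δ' t) + 70 * √(K * B) * t := by
  have hK := A.one_le_K
  have hKB : 0 ≤ √((K : ℝ) * B) := Real.sqrt_nonneg _
  -- the last test round before `t` is `t₀ = a + 2 ^ j`
  set a := tau A.τ₁ (m + 1) with ha
  set j := Nat.log 2 (t - 1 - a) with hj
  have hj1 : 2 ^ j ≤ t - 1 - a := Nat.pow_log_le_self 2 (by omega)
  have hj2 : t - 1 - a < 2 ^ (j + 1) := Nat.lt_pow_succ_log_self (by norm_num) _
  rw [pow_succ] at hj2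
  have hjpos : 0 < 2 ^ j := by positivity
  set t₀ := a + 2 ^ j with ht₀
  have hep : epochOf A.τ₁ t₀ = m + 2 := epochOf_eq (m := m + 1) S.two_le (by omega) (by
    change t₀ ≤ tau A.τ₁ (m + 2); omega)
  have htest : A.IsTestRound t₀ := by
    refine ⟨by omega, Or.inl ⟨j, ?_⟩⟩
    rw [hep]; rfl
  have hs₀ : A.SafeAfter h t₀ := hs.mono (by omega)
  have hpass := hs₀.threshold_le (by omega) htest
  have hdev := G.test_reward t₀ (by omega) htest
  have hlow := S.value_sub_lower_le G m (by omega) (hs.mono (by omega)) hB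
  rw [A.threshold_eq, hep, show m + 2 - 1 = m + 1 from rfl] at hpass
  obtain ⟨k, rfl⟩ : ∃ k, m = k + 1 := by
    obtain ⟨i, hi, -⟩ := hB; exact ⟨m - 1, by omega⟩
  have hwid := sqrt_log_ceil_le S.rate S.two_le S.δ'_mem.1 S.δ'_le (m := k) (t := t₀)
    (by change a < t₀; omega) (by change t₀ ≤ tau A.τ₁ (k + 1 + 2); omega)
  rw [hep, abs_le, Finset.sum_sub_distrib] at hdev
  rw [show k + 1 + 2 = k + 3 from rfl] at hdev hpass
  set ℓ := √(2 * t₀ * Real.log ((⌈((k + 3 : ℕ) : ℝ) + Real.logb 2 A.τ₁⌉₊ : ℝ) ^ 3 / A.δ'))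
  have hcum : Algorithm.cumReward h t₀ = ∑ i ∈ Finset.Icc 1 t₀, (h i).2.2 := rfl
  set V := value (D.map Prod.fst) (policyKernel pol) fstar with hV
  have hS0 := rateSum_nonneg (ξ := A.ξ) (τ₁ := A.τ₁) (c := A.δ') t₀
  have hSt : rateSum A.ξ A.τ₁ A.δ' t₀ ≤ rateSum A.ξ A.τ₁ A.δ' t := rateSum_mono (by omega)
  have hK1 : 1 ≤ √(K : ℝ) := Real.one_le_sqrt.2 hK
  have hSK : rateSum A.ξ A.τ₁ A.δ' t₀ ≤ √K * rateSum A.ξ A.τ₁ A.δ' t₀ :=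
    le_mul_of_one_le_left hS0 hK1
  have hSKt : √K * rateSum A.ξ A.τ₁ A.δ' t₀ ≤ √K * rateSum A.ξ A.τ₁ A.δ' t :=
    mul_le_mul_of_nonneg_left hSt (by positivity)
  have hτ0 : (0 : ℝ) ≤ A.τ₁ := Nat.cast_nonneg _
  have hupto : ∑ i ∈ Finset.Icc 1 t₀,
      kernelRegret (D.map Prod.fst) pol fstar (A.roundKernel h w i) ≤
      A.τ₁ + 2 * ℓ + 20.3 * (√K * rateSum A.ξ A.τ₁ A.δ' t₀) + 35 * √(K * B) * t₀ := by
    rw [sum_regret_eq, ← hV]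
    have := mul_le_mul_of_nonneg_left hlow (Nat.cast_nonneg t₀ : (0 : ℝ) ≤ t₀)
    rw [mul_sub] at this
    linarith [hdev.2]
  set r := kernelRegret (D.map Prod.fst) pol fstar (A.kernel h w (k + 3)) with hr
  have hr0 : 0 ≤ r := S.regret_nonneg (S.isKernel _)
  have hsplit : ∀ b, a + b ≤ t → ∑ i ∈ Finset.Icc 1 (a + b),
      kernelRegret (D.map Prod.fst) pol fstar (A.roundKernel h w i) =
      ∑ i ∈ Finset.Icc 1 a, kernelRegret (D.map Prod.fst) pol fstar (A.roundKernel h w i)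
        + b * r := by
    intro b hb
    induction b with
    | zero => simp
    | succ b ih =>
      rw [← add_assoc, Finset.sum_Icc_succ_top (by omega), ih (by omega),
        S.roundKernel_eq (m := k + 2) (by change a < _; omega)
          (by change _ ≤ tau A.τ₁ (k + 1 + 2); omega) (hs.mono (by omega))]
      push_cast; rw [← hr]; ring
  have hA0 : 0 ≤ ∑ i ∈ Finset.Icc 1 a,
      kernelRegret (D.map Prod.fst) pol fstar (A.roundKernel h w i) :=
    Finset.sum_nonneg fun i _ => S.regret_nonneg (S.isKernel_roundKernel i)
  have e1 := hsplit (2 ^ j) (by omega)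
  have e2 := hsplit (t - a) (by omega)
  rw [show a + (t - a) = t by omega] at e2
  have hcast : ((t - a : ℕ) : ℝ) ≤ 2 * ((2 ^ j : ℕ) : ℝ) := by
    exact_mod_cast (by omega : t - a ≤ 2 * 2 ^ j)
  have hmul := mul_le_mul_of_nonneg_right hcast hr0
  have ht0t : (t₀ : ℝ) ≤ t := by exact_mod_cast (by omega : t₀ ≤ t)
  have hKBt : √((K : ℝ) * B) * t₀ ≤ √(K * B) * t := mul_le_mul_of_nonneg_left ht0t hKB
  rw [e2]
  rw [← ht₀] at e1
  rw [e1] at hupto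
  linarith

/-- The cumulative regret as long as the status is safe. -/
lemma sum_regret_le_of_safe {t : ℕ} (htT : t ≤ T) (hs : A.SafeAfter h (t - 1)) :
    ∑ i ∈ Finset.Icc 1 t, kernelRegret (D.map Prod.fst) pol fstar (A.roundKernel h w i) ≤
      27 * A.τ₁ + 65 * (√K * rateSum A.ξ A.τ₁ A.δ' t) + 70 * √(K * B) * t := by
  have hKB : 0 ≤ √((K : ℝ) * B) := Real.sqrt_nonneg _
  have hτ2 : (2 : ℝ) ≤ A.τ₁ := by exact_mod_cast S.two_le
  -- the first round of an epoch is not preceded by a test of that epoch; its regret is at most `1`,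
  -- and it is treated separately
  have main : ∀ s, s ≤ t → (∀ m, tau A.τ₁ (m + 1) + 1 ≠ s) →
      ∑ i ∈ Finset.Icc 1 s, kernelRegret (D.map Prod.fst) pol fstar (A.roundKernel h w i) ≤
        26 * A.τ₁ + 65 * (√K * rateSum A.ξ A.τ₁ A.δ' s) + 70 * √(K * B) * s := by
    intro s hst hne
    have hSs : 0 ≤ √K * rateSum A.ξ A.τ₁ A.δ' s :=
      mul_nonneg (Real.sqrt_nonneg _) (rateSum_nonneg s)
    have hKBs : 0 ≤ √((K : ℝ) * B) * s := by positivity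
    by_cases hB : ∀ j, j + 2 < epochOf A.τ₁ s → B ≤ epochRate A.ξ A.τ₁ A.δ' (j + 2)
    · have := S.sum_regret_le_of_rates G (hst.trans htT) (hs.mono (by omega)) hB
      linarith
    · push Not at hB
      obtain ⟨j, hj1, hj2⟩ := hB
      have hs1 : 1 ≤ s := by
        by_contra! h0
        have : epochOf A.τ₁ s ≤ 0 := Nat.sInf_le (by
          show s ≤ tau A.τ₁ 0
          omega)
        omega
      obtain ⟨m, hm, h1, h2⟩ := exists_epochOf_eq S.two_le hs1
      obtain ⟨k, rfl⟩ : ∃ k, m = k + 1 := ⟨m - 1, by omega⟩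
      have := hne k
      exact S.sum_regret_le_of_test G (hst.trans htT) (hs.mono (by omega)) (by omega) h2
        ⟨j, by omega, hj2⟩
  by_cases hfirst : ∃ m, tau A.τ₁ (m + 1) + 1 = t
  · obtain ⟨m, hm⟩ := hfirst
    have h1 := main (tau A.τ₁ (m + 1)) (by omega) fun k hk => by
      -- epochs have at least two rounds
      rcases lt_or_ge k m with hkm | hkm
      · have h3 : tau A.τ₁ (k + 2) ≤ tau A.τ₁ (m + 1) :=
          (tau_strictMono S.two_le).monotone (by omega)
        have h4 : tau A.τ₁ 1 ≤ tau A.τ₁ (k + 1) := (tau_strictMono S.two_le).monotone (by omega)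
        have h5 := tau_succ_succ (τ₁ := A.τ₁) k
        have h6 := S.two_le
        rw [tau_one] at h4
        omega
      · have : tau A.τ₁ (m + 1) ≤ tau A.τ₁ (k + 1) :=
          (tau_strictMono S.two_le).monotone (by omega)
        omega
    have hlast := S.regret_le_one (S.isKernel_roundKernel t)
    have hSt : √K * rateSum A.ξ A.τ₁ A.δ' (tau A.τ₁ (m + 1)) ≤ √K * rateSum A.ξ A.τ₁ A.δ' t :=
      mul_le_mul_of_nonneg_left (rateSum_mono (by omega)) (Real.sqrt_nonneg _)
    have hKBt : √((K : ℝ) * B) * (tau A.τ₁ (m + 1) : ℕ) ≤ √(K * B) * t :=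
      mul_le_mul_of_nonneg_left (by exact_mod_cast (by omega : tau A.τ₁ (m + 1) ≤ t)) hKB
    rw [← hm, Finset.sum_Icc_succ_top (by omega), hm]
    linarith
  · push Not at hfirst
    have := main t le_rfl hfirst
    linarith

/-- If a test is failed, the lower confidence bound is optimal up to `O(√(K B))`. In an epoch whose
predecessors have rates above `B`, the cumulative reward would otherwise exceed the threshold. -/
lemma value_sub_lower_le_of_fail {t m : ℕ} (htT : t ≤ T) (hep : epochOf A.τ₁ t = m + 2)
    (h1 : tau A.τ₁ (m + 1) < t) (hs : A.SafeAfter h (t - 1)) (htest : A.IsTestRound t)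
    (hfail : Algorithm.cumReward h t < A.threshold h t) :
    value (D.map Prod.fst) (policyKernel pol) fstar - A.lower h (m + 1) ≤ 35 * √(K * B) := by
  have hKB : 0 ≤ √((K : ℝ) * B) := Real.sqrt_nonneg _
  by_cases hB : ∃ j < m, epochRate A.ξ A.τ₁ A.δ' (j + 2) < B
  · exact S.value_sub_lower_le G m (by omega) (hs.mono (by omega)) hB
  · push Not at hB
    have hsum := S.sum_regret_le_of_rates G htT hs fun j hj => hB j (by omega)
    have hdev := G.test_reward t htT htest
    rw [A.threshold_eq, show epochOf A.τ₁ t - 1 = m + 1 by omega] at hfail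
    rw [abs_le, Finset.sum_sub_distrib] at hdev
    rw [sum_regret_eq] at hsum
    have hcum : Algorithm.cumReward h t = ∑ i ∈ Finset.Icc 1 t, (h i).2.2 := rfl
    have ht0 : (0 : ℝ) < t := by exact_mod_cast (by omega : 0 < t)
    refine le_of_mul_le_mul_left (a := (t : ℝ)) ?_ ht0
    rw [mul_sub]
    have : 12 * √((K : ℝ) * B) * t ≤ t * (35 * √(K * B)) := by nlinarith
    linarith [hdev.1]

/-- The cumulative regret of the kernels that are played, on the favourable event. -/
lemma sum_regret_le :
    ∑ i ∈ Finset.Icc 1 T, kernelRegret (D.map Prod.fst) pol fstar (A.roundKernel h w i) ≤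
      27 * A.τ₁ + 65 * (√K * rateSum A.ξ A.τ₁ A.δ' T) + 105 * √(K * B) * T := by
  classical
  have hKB : 0 ≤ √((K : ℝ) * B) := Real.sqrt_nonneg _
  by_cases hsafe : A.SafeAfter h (T - 1)
  · have h1 := S.sum_regret_le_of_safe G le_rfl hsafe
    have : 0 ≤ √((K : ℝ) * B) * T := by positivity
    linarith
  have hex : ∃ t, ¬ A.SafeAfter h t := ⟨_, hsafe⟩
  -- the round of the failed test
  set t := Nat.find hex with ht
  have htfail : ¬ A.SafeAfter h t := Nat.find_spec hex
  have htT : t ≤ T - 1 := Nat.find_min' hex hsafe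
  have ht1 : 1 ≤ t := by
    by_contra! h0
    rw [show t = 0 by omega] at htfail
    exact htfail trivial
  have hbefore : A.SafeAfter h (t - 1) := by
    by_contra hc
    exact Nat.find_min hex (m := t - 1) (by omega) hc
  obtain ⟨htest, hlt⟩ : A.IsTestRound t ∧ Algorithm.cumReward h t < A.threshold h t := by
    obtain ⟨k, hk⟩ : ∃ k, t = k + 1 := ⟨t - 1, by omega⟩
    rw [hk] at htfail hbefore ⊢
    by_contra! hc
    exact htfail ⟨hbefore, hc⟩
  obtain ⟨m', hm', h1, h2⟩ := exists_epochOf_eq S.two_le ht1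
  obtain ⟨m, rfl⟩ : ∃ m, m' = m + 1 := ⟨m' - 1, by have := htest.1; omega⟩
  have hlow := S.value_sub_lower_le_of_fail G (by omega) hm' h1 hbefore htest hlt
  have hval := S.lower_le_value G (m + 1) (by omega) (hbefore.mono (by omega))
  -- the remembered epoch does not change after the failure
  have hconst : ∀ k, A.safeEpoch h (m + 1 + k) = A.safeEpoch h (m + 1) := by
    intro k
    induction k with
    | zero => rfl
    | succ k ih =>
      rw [← add_assoc, Algorithm.safeEpoch, if_neg, ih]
      rintro ⟨hh, -⟩
      have : tau A.τ₁ (m + 1 + 1) ≤ tau A.τ₁ (m + 1 + k + 1) :=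
        (tau_strictMono S.two_le).monotone (by omega)
      exact htfail (hh.mono (by omega))
  have hlater : ∀ i ∈ Finset.Ioc t T,
      kernelRegret (D.map Prod.fst) pol fstar (A.roundKernel h w i) ≤ 35 * √(K * B) := by
    intro i hi
    rw [Finset.mem_Ioc] at hi
    have hns : ¬ A.SafeAfter h (i - 1) := fun hh => htfail (hh.mono (by omega))
    have hei := epochOf_mono S.two_le ht1 hi.1.le
    obtain ⟨k, hk⟩ : ∃ k, epochOf A.τ₁ i - 1 = m + 1 + k := ⟨epochOf A.τ₁ i - 1 - (m + 1), by omega⟩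
    rw [Algorithm.roundKernel, if_neg hns, hk, hconst, kernelRegret]
    linarith
  have hsum := S.sum_regret_le_of_safe G (t := t) (by omega) hbefore
  have hSt : √K * rateSum A.ξ A.τ₁ A.δ' t ≤ √K * rateSum A.ξ A.τ₁ A.δ' T :=
    mul_le_mul_of_nonneg_left (rateSum_mono (by omega)) (Real.sqrt_nonneg _)
  have hKBt : √((K : ℝ) * B) * t ≤ √(K * B) * T :=
    mul_le_mul_of_nonneg_left (by exact_mod_cast (by omega : t ≤ T)) hKB
  have hrest := Finset.sum_le_card_nsmul _ _ _ hlater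
  rw [Nat.card_Ioc, nsmul_eq_mul] at hrest
  have hcard : ((T - t : ℕ) : ℝ) * (35 * √(K * B)) ≤ T * (35 * √(K * B)) :=
    mul_le_mul_of_nonneg_right (by exact_mod_cast Nat.sub_le T t) (by positivity)
  have hsplit : ∑ i ∈ Finset.Icc 1 T,
      kernelRegret (D.map Prod.fst) pol fstar (A.roundKernel h w i)
      = ∑ i ∈ Finset.Icc 1 t, kernelRegret (D.map Prod.fst) pol fstar (A.roundKernel h w i)
        + ∑ i ∈ Finset.Ioc t T, kernelRegret (D.map Prod.fst) pol fstar (A.roundKernel h w i) := by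
    rw [← Finset.sum_union]
    · congr 1
      ext i; simp only [Finset.mem_union, Finset.mem_Icc, Finset.mem_Ioc]; omega
    · rw [Finset.disjoint_left]
      intro i hi hi'; simp only [Finset.mem_Icc, Finset.mem_Ioc] at hi hi'; omega
  rw [hsplit]
  linarith

end Standing

end Run

/-! ### Measurability of the algorithm -/

section Measurability

variable {X W Θ : Type*} [MeasurableSpace X] [MeasurableSpace W] [MeasurableSpace Θ] {K : ℕ}

lemma measurable_value_param {μ : Measure X} [SFinite μ] {q : Θ → X → Fin K → ℝ}
    {f : X → Fin K → ℝ} (hq : Measurable fun y : Θ × X => q y.1 y.2) (hf : Measurable f) :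
    Measurable fun θ => value μ (q θ) f := by
  have h : Measurable fun y : Θ × X => ∑ a, q y.1 y.2 a * f y.2 a :=
    Finset.measurable_sum _ fun a _ => ((measurable_pi_apply a).comp hq).mul
      ((measurable_apply hf a).comp measurable_snd)
  exact (h.stronglyMeasurable.integral_prod_right (ν := μ)).measurable

lemma measurable_meanSqError_param {D : Measure (X × (Fin K → ℝ))} [IsProbabilityMeasure D]
    {q f : Θ → X → Fin K → ℝ} {g : X → Fin K → ℝ} (hq : Measurable fun y : Θ × X => q y.1 y.2)
    (hf : Measurable fun y : Θ × X => f y.1 y.2) (hg : Measurable g) :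
    Measurable fun θ => meanSqError D (q θ) (f θ) g := by
  have h : Measurable fun y : Θ × X => ∑ a, q y.1 y.2 a * (f y.1 y.2 a - g y.2 a) ^ 2 :=
    Finset.measurable_sum _ fun a _ => ((measurable_pi_apply a).comp hq).mul
      ((((measurable_pi_apply a).comp hf).sub ((measurable_apply hg a).comp measurable_snd)).pow_const
        2)
  have := isProbabilityMeasure_map_fst D
  exact (h.stronglyMeasurable.integral_prod_right (ν := D.map Prod.fst)).measurable

variable {A : Algorithm X W K} {h : Θ → ℕ → X × Fin K × ℝ} {w : Θ → ℕ → W} {n : ℕ}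
  (hh : ∀ s, 1 ≤ s → s < n → Measurable fun θ => h θ s)
  (hw : ∀ s < n, Measurable fun θ => w θ s)

omit [MeasurableSpace W] in
include hh in
lemma measurable_reward {s : ℕ} (h1 : 1 ≤ s) (hs : s < n) : Measurable fun θ => (h θ s).2.2 :=
  measurable_snd.comp (measurable_snd.comp (hh s h1 hs))

omit [MeasurableSpace W] in
include hh in
lemma measurable_lower {m : ℕ} (hm : tau A.τ₁ m < n) (hτ : 2 ≤ A.τ₁) :
    Measurable fun θ => A.lower (h θ) m := by
  induction m with
  | zero => exact measurable_const
  | succ m ih =>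
    have hlt := tau_strictMono hτ (Nat.lt_add_one m)
    refine (ih (hlt.trans hm)).max (Measurable.sub_const (Measurable.div_const
      (Finset.measurable_sum _ fun i hi => ?_) _) _)
    simp only [Nat.add_sub_cancel, Finset.mem_Ioc] at hi
    exact measurable_reward hh (by omega) (by omega)

omit [MeasurableSpace W] in
include hh in
lemma measurableSet_safeAfter (hτ : 2 ≤ A.τ₁) {t : ℕ} (ht : t < n) :
    MeasurableSet {θ | A.SafeAfter (h θ) t} := by
  induction t with
  | zero => exact MeasurableSet.univ
  | succ t ih =>
    have hthr : Measurable fun θ => A.threshold (h θ) (t + 1) := by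
      obtain ⟨m, hm, h1, h2⟩ := exists_epochOf_eq hτ (Nat.le_add_left 1 t)
      unfold Algorithm.threshold
      refine Measurable.sub_const (Measurable.sub_const (Measurable.sub_const
        (Measurable.const_mul (measurable_lower hh ?_ hτ) _) _) _) _
      rw [hm, Nat.add_sub_cancel]; omega
    have hcum : Measurable fun θ => Algorithm.cumReward (h θ) (t + 1) :=
      Finset.measurable_sum _ fun i hi => by
        rw [Finset.mem_Icc] at hi
        exact measurable_reward hh hi.1 (by omega)
    have hset : MeasurableSet {θ | A.IsTestRound (t + 1) →
        A.threshold (h θ) (t + 1) ≤ Algorithm.cumReward (h θ) (t + 1)} := by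
      by_cases hc : A.IsTestRound (t + 1)
      · simpa [hc] using measurableSet_le hthr hcum
      · simp [hc]
    exact (ih (by omega)).inter hset

include hh hw in
lemma measurable_model_param {F : Set (X → Fin K → ℝ)} (hreg : IsRegression F A.reg)
    {m : ℕ} (hm : tau A.τ₁ m < n) :
    Measurable fun y : Θ × X => A.model (h y.1) (w y.1) (m + 1) y.2 := by
  cases m with
  | zero => exact measurable_const
  | succ m =>
    have hdata : Measurable fun θ => A.epochData (h θ) (m + 1) :=
      measurable_pi_lambda _ fun i => by
        have hi := i.2
        simp only [Nat.add_sub_cancel] at hi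
        exact hh _ (by omega) (by simp only [Nat.add_sub_cancel]; omega)
    exact (hreg.measurable _).comp ((((hw _ hm).comp measurable_fst).prodMk
      (hdata.comp measurable_fst)).prodMk measurable_snd)

include hh hw in
lemma measurable_kernel_param {F : Set (X → Fin K → ℝ)}
    (hreg : IsRegression F A.reg) (hpick : Measurable A.pick) {m : ℕ} (hm : tau A.τ₁ m < n) :
    Measurable fun y : Θ × X => A.kernel (h y.1) (w y.1) (m + 1) y.2 :=
  (measurable_actionKernel hpick).comp (measurable_model_param hh hw hreg hm)

omit [MeasurableSpace X] [MeasurableSpace W] [MeasurableSpace Θ] in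
lemma Algorithm.safeEpoch_le (h : ℕ → X × Fin K × ℝ) (m : ℕ) : A.safeEpoch h m ≤ m := by
  induction m with
  | zero => exact le_rfl
  | succ m ih => rw [Algorithm.safeEpoch]; split_ifs <;> omega

omit [MeasurableSpace W] in
include hh in
lemma measurable_safeEpoch (hτ : 2 ≤ A.τ₁) {m : ℕ} (hm : tau A.τ₁ m < n) :
    Measurable fun θ => A.safeEpoch (h θ) m := by
  induction m with
  | zero => exact measurable_const
  | succ m ih =>
    have hlt := (tau_strictMono hτ (Nat.lt_add_one m)).trans hm
    unfold Algorithm.safeEpoch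
    refine Measurable.ite ?_ measurable_const (ih hlt)
    exact (measurableSet_safeAfter hh hτ hm).inter
      (measurableSet_eq_fun (measurable_lower hh hm hτ) (measurable_lower hh hlt hτ)).compl

include hh hw in
lemma measurable_roundKernel (hτ : 2 ≤ A.τ₁) {F : Set (X → Fin K → ℝ)}
    (hreg : IsRegression F A.reg) (hpick : Measurable A.pick) {t : ℕ} (ht : 1 ≤ t) (htn : t ≤ n) :
    Measurable fun y : Θ × X => A.roundKernel (h y.1) (w y.1) t y.2 := by
  obtain ⟨m, hm, h1, h2⟩ := exists_epochOf_eq hτ ht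
  have hker : ∀ j ≤ m + 1, Measurable fun y : Θ × X => A.kernel (h y.1) (w y.1) j y.2 := by
    intro j hj
    cases j with
    | zero => exact (measurable_actionKernel hpick).comp measurable_const
    | succ j =>
      have : tau A.τ₁ j ≤ tau A.τ₁ m := (tau_strictMono hτ).monotone (by omega)
      exact measurable_kernel_param hh hw hreg hpick (by omega)
  have hG : Measurable fun q : ℕ × (Θ × X) =>
      A.kernel (h q.2.1) (w q.2.1) (min q.1 m) q.2.2 :=
    measurable_from_prod_countable_right fun j => hker (min j m) (by omega)
  have hsE : Measurable fun θ => A.safeEpoch (h θ) m := measurable_safeEpoch hh hτ (by omega)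
  have e : (fun y : Θ × X => A.roundKernel (h y.1) (w y.1) t y.2) = fun y =>
      haveI := Classical.dec (A.SafeAfter (h y.1) (t - 1))
      if A.SafeAfter (h y.1) (t - 1) then A.kernel (h y.1) (w y.1) (m + 1) y.2
      else A.kernel (h y.1) (w y.1) (min (A.safeEpoch (h y.1) m) m) y.2 := by
    funext y
    rw [Algorithm.roundKernel, hm, Nat.add_sub_cancel, min_eq_left (A.safeEpoch_le _ m)]
    split_ifs <;> rfl
  rw [e]
  refine Measurable.ite ?_ (hker _ le_rfl) ?_
  · exact measurable_fst (measurableSet_safeAfter hh hτ (by omega : t - 1 < n))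
  · exact hG.comp ((hsE.comp measurable_fst).prodMk measurable_id)

end Measurability

/-! ### Adaptedness of a run -/

section Adapted

variable {X U W Ω : Type*} [MeasurableSpace X] [MeasurableSpace U] [MeasurableSpace W]
  [MeasurableSpace Ω] {K : ℕ} {A : Algorithm X W K} {D : Measure (X × (Fin K → ℝ))}
  {ν : Measure U} {ρ : Measure W} {draw : (Fin K → ℝ) → U → Fin K} {P : Measure Ω}
  {z : ℕ → Ω → X × (Fin K → ℝ)} {u : ℕ → Ω → U} {w : ℕ → Ω → W} {act : ℕ → Ω → Fin K}

/-- The past of round `t`: the σ-algebra generated by the contexts, rewards and seeds of the rounds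
before `t`. -/
@[reducible] def history (z : ℕ → Ω → X × (Fin K → ℝ)) (u : ℕ → Ω → U) (w : ℕ → Ω → W) (t : ℕ) :
    MeasurableSpace Ω :=
  pastSigma (fun t ω => (z t ω, u t ω, w t ω)) t

omit [MeasurableSpace Ω] in
lemma measurable_history {s t : ℕ} (h : s < t) :
    Measurable[history z u w t] fun ω => (z s ω, u s ω, w s ω) :=
  measurable_pastSigma (ξ := fun t ω => (z t ω, u t ω, w t ω)) h

variable (hτ : 2 ≤ A.τ₁) {F : Set (X → Fin K → ℝ)} (hreg : IsRegression F A.reg)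
  (hpick : Measurable A.pick) (hdraw : IsSampler ν draw) (hrun : IsRun A D ν ρ draw P z u w act)
include hτ hreg hpick hdraw hrun

lemma measurable_act {t : ℕ} (ht : 1 ≤ t) : Measurable[history z u w (t + 1)] (act t) := by
  induction t using Nat.strong_induction_on with
  | _ t ih =>
    have hle : ∀ {s s'}, s ≤ s' → history z u w s ≤ history z u w s' := fun h => pastSigma_mono h
    have hobs : ∀ s, 1 ≤ s → s < t →
        Measurable[history z u w (t + 1)] fun ω => observation z act ω s := by
      intro s h1 hs
      have hz : Measurable[history z u w (t + 1)] (z s) :=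
        measurable_fst.comp (measurable_history (z := z) (u := u) (w := w) (by omega : s < t + 1))
      have ha : Measurable[history z u w (t + 1)] (act s) :=
        (ih s hs h1).mono (hle (by omega)) le_rfl
      exact (measurable_fst.comp hz).prodMk
        (ha.prodMk (measurable_eval_uncurry.comp ((measurable_snd.comp hz).prodMk ha)))
    have hws : ∀ s < t, Measurable[history z u w (t + 1)] fun ω => w s ω := fun s hs =>
      (measurable_snd.comp measurable_snd).comp
        (measurable_history (z := z) (u := u) (w := w) (by omega : s < t + 1))
    have hk := @measurable_roundKernel X W Ω _ _ (history z u w (t + 1)) K A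
      (fun ω => observation z act ω) (fun ω s => w s ω) t hobs hws hτ F hreg hpick t ht le_rfl
    have hzt := measurable_history (z := z) (u := u) (w := w) (Nat.lt_add_one t)
    have hx : Measurable[history z u w (t + 1)] fun ω => (z t ω).1 :=
      (measurable_fst.comp measurable_fst).comp hzt
    have hu : Measurable[history z u w (t + 1)] (u t) :=
      (measurable_fst.comp measurable_snd).comp hzt
    have hid : @Measurable Ω Ω (history z u w (t + 1)) (history z u w (t + 1)) id := fun _ hs => hs
    have e : act t = fun ω => draw (A.roundKernel (observation z act ω) (fun s => w s ω) t
        (z t ω).1) (u t ω) := funext fun ω => hrun.action t ht ω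
    rw [e]
    exact hdraw.measurable.comp ((hk.comp (hid.prodMk hx)).prodMk hu)

lemma measurable_observation {s t : ℕ} (h1 : 1 ≤ s) (hs : s < t) :
    Measurable[history z u w t] fun ω => observation z act ω s := by
  have hz : Measurable[history z u w t] (z s) :=
    measurable_fst.comp (measurable_history (z := z) (u := u) (w := w) hs)
  have ha : Measurable[history z u w t] (act s) :=
    (measurable_act hτ hreg hpick hdraw hrun h1).mono (pastSigma_mono hs) le_rfl
  exact (measurable_fst.comp hz).prodMk
    (ha.prodMk (measurable_eval_uncurry.comp ((measurable_snd.comp hz).prodMk ha)))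

/-- The kernel of round `t` is determined by the past of round `t`. -/
lemma measurable_roundKernel_history {t : ℕ} (ht : 1 ≤ t) :
    Measurable[(history z u w t).prod inferInstance] fun y : Ω × X =>
      A.roundKernel (observation z act y.1) (fun s => w s y.1) t y.2 :=
  @measurable_roundKernel X W Ω _ _ (history z u w t) K A
    (fun ω => observation z act ω) (fun ω s => w s ω) t
    (fun _ h1 hs => measurable_observation hτ hreg hpick hdraw hrun h1 hs)
    (fun _ hs => (measurable_snd.comp measurable_snd).comp
      (measurable_history (z := z) (u := u) (w := w) hs)) hτ F hreg hpick t ht le_rfl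

/-- The kernel of epoch `m + 1` is determined by the past of its first round. -/
lemma measurable_kernel_history (m : ℕ) :
    Measurable[(history z u w (tau A.τ₁ m + 1)).prod inferInstance] fun y : Ω × X =>
      A.kernel (observation z act y.1) (fun s => w s y.1) (m + 1) y.2 :=
  @measurable_kernel_param X W Ω _ _ (history z u w (tau A.τ₁ m + 1)) K A
    (fun ω => observation z act ω) (fun ω s => w s ω) (tau A.τ₁ m + 1)
    (fun _ h1 hs => measurable_observation hτ hreg hpick hdraw hrun h1 hs)
    (fun _ hs => (measurable_snd.comp measurable_snd).comp
      (measurable_history (z := z) (u := u) (w := w) hs)) F hreg hpick m (Nat.lt_succ_self _)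

end Adapted

/-! ### Deviation of the rewards -/

section Deviation

variable {X U W Ω : Type*} [MeasurableSpace X] [MeasurableSpace U] [MeasurableSpace W]
  [MeasurableSpace Ω] {K : ℕ} {A : Algorithm X W K} {D : Measure (X × (Fin K → ℝ))}
  [IsProbabilityMeasure D] {ν : Measure U} [IsProbabilityMeasure ν] {ρ : Measure W}
  [IsProbabilityMeasure ρ] {draw : (Fin K → ℝ) → U → Fin K} {P : Measure Ω}
  [IsProbabilityMeasure P]
  {z : ℕ → Ω → X × (Fin K → ℝ)} {u : ℕ → Ω → U} {w : ℕ → Ω → W} {act : ℕ → Ω → Fin K}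
  {fstar : X → Fin K → ℝ} {pol : X → Fin K}

lemma Algorithm.isKernel_kernel {F : Set (X → Fin K → ℝ)}
    (hF : ∀ f ∈ F, Measurable f ∧ ∀ x a, f x a ∈ Set.Icc (0 : ℝ) 1) (hreg : IsRegression F A.reg)
    (hpick : Measurable A.pick) (hmax : ∀ (v : Fin K → ℝ) (a : Fin K), v a ≤ v (A.pick v))
    (h : ℕ → X × Fin K × ℝ) (w : ℕ → W) (m : ℕ) : IsKernel (A.kernel h w m) := by
  refine isKernel_actionKernel hpick hmax (A.γ_nonneg m) ?_
  match m with
  | 0 => exact measurable_const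
  | 1 => exact measurable_const
  | m + 2 => exact (hF _ (hreg.mem _ _ _)).1

variable (hτ : 2 ≤ A.τ₁) {F : Set (X → Fin K → ℝ)} (hreg : IsRegression F A.reg)
  (hpick : Measurable A.pick) (hdraw : IsSampler ν draw) (hrun : IsRun A D ν ρ draw P z u w act)
  (hD : ∀ᵐ z ∂D, ∀ a, z.2 a ∈ Set.Icc (0 : ℝ) 1) (hfstar : IsMeanReward D fstar)
  (hker : ∀ h w t, IsKernel (A.roundKernel h w t))
include hτ hreg hpick hdraw hrun

omit [IsProbabilityMeasure D] [IsProbabilityMeasure ν] [IsProbabilityMeasure ρ]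
  [IsProbabilityMeasure P] hτ hreg hpick hdraw in
lemma observation_reward {t : ℕ} (ht : 1 ≤ t) (ω : Ω) :
    (observation z act ω t).2.2 = (z t ω).2
      (draw (A.roundKernel (observation z act ω) (fun s => w s ω) t (z t ω).1) (u t ω)) := by
  rw [← hrun.action t ht ω]; rfl

omit [IsProbabilityMeasure D] [IsProbabilityMeasure ν] [IsProbabilityMeasure ρ]
  [IsProbabilityMeasure P] in
lemma measurable_reward_history {t : ℕ} (ht : 1 ≤ t) :
    Measurable[(history z u w t).prod inferInstance]
      fun q : Ω × ((X × (Fin K → ℝ)) × U × W) => q.2.1.2 (draw (A.roundKernel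
        (observation z act q.1) (fun s => w s q.1) t q.2.1.1) q.2.2.1) := by
  have hk := measurable_roundKernel_history hτ hreg hpick hdraw hrun ht
  have h1 : @Measurable (Ω × ((X × (Fin K → ℝ)) × U × W)) Ω
    ((history z u w t).prod inferInstance) (history z u w t) Prod.fst := @measurable_fst _ _ _ _
  have h2 : Measurable[(history z u w t).prod inferInstance]
    (Prod.snd : Ω × ((X × (Fin K → ℝ)) × U × W) → _) := @measurable_snd _ _ _ _
  have h3 := hk.comp (h1.prodMk (measurable_fst.comp (measurable_fst.comp h2)))
  exact measurable_eval_uncurry.comp ((measurable_snd.comp (measurable_fst.comp h2)).prodMk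
    (hdraw.measurable.comp (h3.prodMk (measurable_fst.comp (measurable_snd.comp h2)))))

omit [IsProbabilityMeasure ν] [IsProbabilityMeasure ρ] [IsProbabilityMeasure P] in
include hfstar in
lemma measurable_value_history {t : ℕ} (ht : 1 ≤ t) :
    Measurable[history z u w t] fun ω => value (D.map Prod.fst) (A.roundKernel
      (observation z act ω) (fun s => w s ω) t) fstar := by
  have := isProbabilityMeasure_map_fst D
  exact @measurable_value_param X Ω _ (history z u w t) K (D.map Prod.fst) inferInstance
    (fun ω => A.roundKernel (observation z act ω) (fun s => w s ω) t) fstar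
    (measurable_roundKernel_history hτ hreg hpick hdraw hrun ht) hfstar.measurable

omit hτ hreg hpick hrun in
include hD hfstar in
lemma hasSubgaussianMGF_reward {k : X → Fin K → ℝ} (hk : IsKernel k) :
    HasSubgaussianMGF (fun v : (X × (Fin K → ℝ)) × U × W =>
      v.1.2 (draw (k v.1.1) v.2.1) - value (D.map Prod.fst) k fstar) (1 / 4)
      (D.prod (ν.prod ρ)) := by
  have hs := hdraw.prod (ρ := ρ)
  have h := hasSubgaussianMGF_of_mem_Icc (μ := D.prod (ν.prod ρ)) (a := 0) (b := 1)
    (measurable_drawn_reward hs hk.measurable).aemeasurable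
    ((Measure.quasiMeasurePreserving_fst.ae hD).mono fun y hy => hy _)
  rw [integral_drawn_reward hD hfstar hs hk] at h
  convert h using 1
  rw [sub_zero, nnnorm_one, div_pow]; norm_num

include hD hfstar hker in
/-- Concentration of the rewards around the values of the kernels that were played. -/
lemma measure_reward_deviation_le (s : Finset ℕ) (hs : ∀ t ∈ s, 1 ≤ t) {ε : ℝ} (hε : 0 ≤ ε) :
    P {ω | ε < |∑ t ∈ s, ((observation z act ω t).2.2 - value (D.map Prod.fst)
        (A.roundKernel (observation z act ω) (fun s => w s ω) t) fstar)|}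
      ≤ 2 * ENNReal.ofReal (Real.exp (-2 * ε ^ 2 / s.card)) := by
  set g : ℕ → Ω → (X × (Fin K → ℝ)) × U × W → ℝ := fun t ω v =>
    v.1.2 (draw (A.roundKernel (observation z act ω) (fun s => w s ω) t v.1.1) v.2.1)
      - value (D.map Prod.fst) (A.roundKernel (observation z act ω) (fun s => w s ω) t) fstar with hg
  have hgm : ∀ t ∈ s, Measurable[(history z u w t).prod inferInstance]
      (fun q : Ω × ((X × (Fin K → ℝ)) × U × W) => g t q.1 q.2) := fun t ht =>
    (measurable_reward_history hτ hreg hpick hdraw hrun (hs t ht)).sub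
      ((measurable_value_history hτ hreg hpick hdraw hrun hfstar (hs t ht)).comp
        (@measurable_fst _ _ (history z u w t) _))
  have hsub : ∀ t ∈ s, ∀ ω, HasSubgaussianMGF (g t ω) (1 / 4) (D.prod (ν.prod ρ)) :=
    fun t _ ω => hasSubgaussianMGF_reward hdraw hD hfstar (hker _ _ t)
  have hξ := hrun.measurable
  have h1 := azuma (pastSigma_le hξ) pastSigma_mono hξ (fun t => measurable_pastSigma
    (Nat.lt_add_one t)) (indep_pastSigma hξ hrun.indep) hrun.law s hgm hsub hε
  have h2 := azuma (pastSigma_le hξ) pastSigma_mono hξ (fun t => measurable_pastSigma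
    (Nat.lt_add_one t)) (indep_pastSigma hξ hrun.indep) hrun.law s
    (g := fun t ω v => -g t ω v) (fun t ht => (hgm t ht).neg) (fun t ht ω => (hsub t ht ω).neg) hε
  have e : -ε ^ 2 / (2 * (s.card * ((1 / 4 : NNReal) : ℝ))) = -2 * ε ^ 2 / s.card := by
    rcases Nat.eq_zero_or_pos s.card with h0 | h0
    · rw [h0]; simp
    · push_cast; field_simp; norm_num
  rw [e] at h1 h2
  rw [two_mul]
  refine le_trans (le_trans (measure_mono ?_) (measure_union_le _ _)) (add_le_add h1 h2)
  intro ω hω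
  have e2 : ∑ t ∈ s, ((observation z act ω t).2.2 - value (D.map Prod.fst)
        (A.roundKernel (observation z act ω) (fun s => w s ω) t) fstar)
      = ∑ t ∈ s, g t ω (z t ω, u t ω, w t ω) :=
    Finset.sum_congr rfl fun t ht => by
      rw [observation_reward hrun (hs t ht)]
  rw [Set.mem_ofPred_eq, e2] at hω
  rcases lt_abs.1 hω with h3 | h3
  · exact Or.inl h3.le
  · right
    rw [Set.mem_ofPred_eq, Finset.sum_neg_distrib]; exact h3.le

include hD hfstar hker in
/-- Concentration of the realized regret around the regret of the kernels that were played. -/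
lemma measure_regret_deviation_le (hpol : Measurable pol) (T : ℕ) {ε : ℝ} (hε : 0 ≤ ε) :
    P {ω | ε < regret z act pol T ω - ∑ t ∈ Finset.Icc 1 T, kernelRegret (D.map Prod.fst) pol fstar
        (A.roundKernel (observation z act ω) (fun s => w s ω) t)}
      ≤ ENNReal.ofReal (Real.exp (-ε ^ 2 / (2 * T))) := by
  set g : ℕ → Ω → (X × (Fin K → ℝ)) × U × W → ℝ := fun t ω v =>
    v.1.2 (pol v.1.1)
      - v.1.2 (draw (A.roundKernel (observation z act ω) (fun s => w s ω) t v.1.1) v.2.1)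
      - kernelRegret (D.map Prod.fst) pol fstar
          (A.roundKernel (observation z act ω) (fun s => w s ω) t) with hg
  have hs : ∀ t ∈ Finset.Icc 1 T, 1 ≤ t := fun t ht => (Finset.mem_Icc.1 ht).1
  have hpolm : Measurable fun v : (X × (Fin K → ℝ)) × U × W => v.1.2 (pol v.1.1) :=
    measurable_eval_uncurry.comp ((measurable_snd.comp measurable_fst).prodMk
      (hpol.comp (measurable_fst.comp measurable_fst)))
  have hgm : ∀ t ∈ Finset.Icc 1 T, Measurable[(history z u w t).prod inferInstance]
      (fun q : Ω × ((X × (Fin K → ℝ)) × U × W) => g t q.1 q.2) := fun t ht =>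
    ((hpolm.comp (@measurable_snd _ _ (history z u w t) _)).sub
      (measurable_reward_history hτ hreg hpick hdraw hrun (hs t ht))).sub
      (((measurable_value_history hτ hreg hpick hdraw hrun hfstar (hs t ht)).const_sub _).comp
        (@measurable_fst _ _ (history z u w t) _))
  have hDμ : ∀ᵐ v ∂(D.prod (ν.prod ρ)), ∀ a, v.1.2 a ∈ Set.Icc (0 : ℝ) 1 :=
    Measure.quasiMeasurePreserving_fst.ae hD
  have hsub : ∀ t ∈ Finset.Icc 1 T, ∀ ω, HasSubgaussianMGF (g t ω) 1 (D.prod (ν.prod ρ)) := by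
    intro t _ ω
    have hk := hker (observation z act ω) (fun s => w s ω) t
    have hds := hdraw.prod (ρ := ρ)
    have hdm := measurable_drawn_reward hds hk.measurable
    have h := hasSubgaussianMGF_of_mem_Icc (μ := D.prod (ν.prod ρ)) (a := -1) (b := 1)
      (hpolm.sub hdm).aemeasurable (hDμ.mono fun v hv => by
        have h1 := hv (pol v.1.1)
        have h2 := hv (draw (A.roundKernel (observation z act ω) (fun s => w s ω) t v.1.1) v.2.1)
        exact ⟨by simp only [Pi.sub_apply]; linarith [h1.1, h2.2],
          by simp only [Pi.sub_apply]; linarith [h1.2, h2.1]⟩)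
    have hmean : ∫ v, ((fun v : (X × (Fin K → ℝ)) × U × W => v.1.2 (pol v.1.1)) -
        fun v : (X × (Fin K → ℝ)) × U × W => v.1.2 (draw (A.roundKernel (observation z act ω) (fun s => w s ω) t v.1.1) v.2.1)) v
        ∂(D.prod (ν.prod ρ)) = kernelRegret (D.map Prod.fst) pol fstar
          (A.roundKernel (observation z act ω) (fun s => w s ω) t) := by
      simp only [Pi.sub_apply]
      rw [integral_sub, integral_drawn_reward hD hfstar hds hk, kernelRegret]
      · congr 1
        rw [← integral_policy_reward hD hfstar hpol]
        have := integral_prod (μ := D) (ν := ν.prod ρ)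
          (fun v : (X × (Fin K → ℝ)) × U × W => v.1.2 (pol v.1.1))
          (Integrable.of_bound hpolm.aestronglyMeasurable 1
            (ae_norm_le_one (hDμ.mono fun v hv => hv _)))
        rw [this]; simp
      · exact Integrable.of_bound hpolm.aestronglyMeasurable 1
          (ae_norm_le_one (hDμ.mono fun v hv => hv _))
      · exact Integrable.of_bound hdm.aestronglyMeasurable 1
          (ae_norm_le_one (hDμ.mono fun v hv => hv _))
    have hc : (‖(1 : ℝ) - -1‖₊ / 2) ^ 2 = 1 := by
      rw [sub_neg_eq_add, one_add_one_eq_two, Real.nnnorm_two, div_self two_ne_zero, one_pow]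
    rw [hmean, hc] at h
    exact h
  have hξ := hrun.measurable
  have h1 := azuma (pastSigma_le hξ) pastSigma_mono hξ (fun t => measurable_pastSigma
    (Nat.lt_add_one t)) (indep_pastSigma hξ hrun.indep) hrun.law (Finset.Icc 1 T) hgm hsub hε
  rw [Nat.card_Icc, Nat.add_sub_cancel, NNReal.coe_one, mul_one] at h1
  refine le_trans (measure_mono ?_) h1
  intro ω hω
  rw [Set.mem_ofPred_eq, regret, ← Finset.sum_sub_distrib] at hω
  refine hω.le.trans (le_of_eq (Finset.sum_congr rfl fun t ht => ?_))
  simp only [hg]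
  rw [← hrun.action t (hs t ht) ω]

end Deviation

/-! ### Accuracy of the fitted models -/

section Accuracy

variable {X U W Ω : Type*} [MeasurableSpace X] [MeasurableSpace U] [MeasurableSpace W]
  [MeasurableSpace Ω] {K : ℕ} {A : Algorithm X W K} {D : Measure (X × (Fin K → ℝ))}
  [IsProbabilityMeasure D] {ν : Measure U} [IsProbabilityMeasure ν] {ρ : Measure W}
  [IsProbabilityMeasure ρ] {draw : (Fin K → ℝ) → U → Fin K} {P : Measure Ω}
  [IsProbabilityMeasure P]
  {z : ℕ → Ω → X × (Fin K → ℝ)} {u : ℕ → Ω → U} {w : ℕ → Ω → W} {act : ℕ → Ω → Fin K}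
  {fstar : X → Fin K → ℝ}

/-- The observations of a block of rounds in which all actions are drawn from `p`. -/
def blockData {n : ℕ} (draw : (Fin K → ℝ) → U → Fin K) (p : X → Fin K → ℝ)
    (v : Fin n → (X × (Fin K → ℝ)) × U × W) (i : Fin n) : X × Fin K × ℝ :=
  ((v i).1.1, draw (p (v i).1.1) (v i).2.1, (v i).1.2 (draw (p (v i).1.1) (v i).2.1))

omit [IsProbabilityMeasure D] in
lemma isProbabilityMeasure_inducedLaw [IsProbabilityMeasure D] (hdraw : IsSampler ν draw)
    {p : X → Fin K → ℝ} (hp : IsKernel p) : IsProbabilityMeasure (inducedLaw D p) := by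
  rw [← (measurePreserving_inducedLaw (D := D) hdraw hp).map_eq]
  exact Measure.isProbabilityMeasure_map
    (measurePreserving_inducedLaw (D := D) hdraw hp).measurable.aemeasurable

/-- If all actions of a block are drawn from a fixed kernel `p`, then its observations are i.i.d.
with law `D(p)`, and independent of the seed of the regression algorithm. -/
lemma measurePreserving_blockData (hdraw : IsSampler ν draw) {p : X → Fin K → ℝ} (hp : IsKernel p)
    {n : ℕ} (l : Fin n) :
    MeasurePreserving (fun v : Fin n → (X × (Fin K → ℝ)) × U × W =>
        ((v l).2.2, blockData draw p v))
      (Measure.pi fun _ => D.prod (ν.prod ρ))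
      (ρ.prod (Measure.pi fun _ => inducedLaw D p)) := by
  have := isProbabilityMeasure_inducedLaw (D := D) hdraw hp
  have h1 : MeasurePreserving (fun y : (X × (Fin K → ℝ)) × U × W =>
      ((y.1.1, draw (p y.1.1) y.2.1, y.1.2 (draw (p y.1.1) y.2.1)), y.2.2))
      (D.prod (ν.prod ρ)) ((inducedLaw D p).prod ρ) :=
    ((measurePreserving_inducedLaw hdraw hp).prod (MeasurePreserving.id ρ)).comp
      (measurePreserving_prodAssoc D ν ρ).symm
  have h2 := measurePreserving_pi (fun _ : Fin n => D.prod (ν.prod ρ))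
    (fun _ => (inducedLaw D p).prod ρ) fun _ => h1
  have h3 := measurePreserving_arrowProdEquivProdArrow (X × Fin K × ℝ) W (Fin n)
    (fun _ => inducedLaw D p) (fun _ => ρ)
  have h4 := (MeasurePreserving.id (Measure.pi fun _ : Fin n => inducedLaw D p)).prod
    (measurePreserving_eval (fun _ : Fin n => ρ) l)
  have h5 : MeasurePreserving Prod.swap ((Measure.pi fun _ : Fin n => inducedLaw D p).prod ρ)
    (ρ.prod (Measure.pi fun _ : Fin n => inducedLaw D p)) := Measure.measurePreserving_swap
  exact h5.comp (h4.comp (h3.comp h2))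

variable (hτ : 2 ≤ A.τ₁) {F : Set (X → Fin K → ℝ)}
  (hF : ∀ f ∈ F, Measurable f ∧ ∀ x a, f x a ∈ Set.Icc (0 : ℝ) 1) (hreg : IsRegression F A.reg)
  (hpick : Measurable A.pick) (hmax : ∀ (v : Fin K → ℝ) (a : Fin K), v a ≤ v (A.pick v))
  (hdraw : IsSampler ν draw) (hrun : IsRun A D ν ρ draw P z u w act)
  (hfstar : IsMeanReward D fstar)
include hτ hF hreg hpick hmax hdraw hrun hfstar

omit [MeasurableSpace U] [MeasurableSpace Ω] [IsProbabilityMeasure D] [IsProbabilityMeasure ν]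
  [IsProbabilityMeasure ρ] [IsProbabilityMeasure P] hτ hF hdraw hrun hfstar in
lemma Algorithm.kernel_mem_kernelClass (h : ℕ → X × Fin K × ℝ) (w : ℕ → W) (m : ℕ) :
    A.kernel h w (m + 1) ∈ kernelClass F := by
  cases m with
  | zero =>
    -- the zero model need not belong to `F`, but the kernel of the first epoch is constant
    exact ⟨_, hreg.mem 0 (w 0) Fin.elim0, fun _ => actionKernel A.pick (A.γ 1) 0, measurable_const,
      fun _ => actionKernel_mem_stdSimplex hmax (A.γ_nonneg 1) 0, fun _ _ => rfl⟩
  | succ m =>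
    exact ⟨_, hreg.mem _ _ _, actionKernel A.pick (A.γ (m + 2)), measurable_actionKernel hpick,
      fun v => actionKernel_mem_stdSimplex hmax (A.γ_nonneg _) v, fun _ _ => rfl⟩

/-- The model fitted on the data of an epoch that was safe to its end obeys the guarantee of the
regression algorithm, at every confidence level. On that event the data coincide with those of a
fictitious epoch in which the kernel is never changed, and these are i.i.d. given the past. -/
lemma measure_error_le {B : ℝ} (hguar : RegressionGuarantee D ρ F A.reg fstar B A.ξ) (m : ℕ)
    {ζ : ℝ} (hζ : ζ ∈ Set.Ioo (0 : ℝ) 1) :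
    P {ω | A.SafeAfter (observation z act ω) (tau A.τ₁ (m + 1)) ∧
        B + A.ξ (tau A.τ₁ (m + 1) - tau A.τ₁ m) ζ <
          meanSqError D (A.kernel (observation z act ω) (fun s => w s ω) (m + 1))
            (A.model (observation z act ω) (fun s => w s ω) (m + 2)) fstar}
      ≤ ENNReal.ofReal ζ := by
  set a := tau A.τ₁ m with ha
  have hlt : a < tau A.τ₁ (m + 1) := tau_strictMono hτ (Nat.lt_add_one m)
  set n := tau A.τ₁ (m + 1) - a with hn
  have hn1 : 1 ≤ n := by omega
  set l : Fin n := ⟨n - 1, by omega⟩ with hl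
  set p : Ω → X → Fin K → ℝ := fun ω =>
    A.kernel (observation z act ω) (fun s => w s ω) (m + 1) with hp
  have hpk : ∀ ω, IsKernel (p ω) := fun ω => Algorithm.isKernel_kernel hF hreg hpick hmax _ _ _
  have hξ := hrun.measurable
  set blk : Ω → Fin n → (X × (Fin K → ℝ)) × U × W :=
    fun ω i => (z (a + 1 + i) ω, u (a + 1 + i) ω, w (a + 1 + i) ω) with hblk
  have hblkm : Measurable blk := measurable_pi_lambda _ fun i => hξ _
  have hlaw : P.map blk = Measure.pi fun _ => D.prod (ν.prod ρ) :=
    map_block hξ hrun.indep hrun.law (a + 1) n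
  set bad : Set (Ω × (Fin n → (X × (Fin K → ℝ)) × U × W)) :=
    {q | B + A.ξ n ζ < meanSqError D (p q.1)
      (A.reg n (q.2 l).2.2 (blockData draw (p q.1) q.2)) fstar} with hbad
  have hbadm : MeasurableSet[(history z u w (a + 1)).prod inferInstance] bad := by
    have hk := measurable_kernel_history hτ hreg hpick hdraw hrun m
    let Y := Fin n → (X × (Fin K → ℝ)) × U × W
    let mΘ : MeasurableSpace (Ω × Y) := (history z u w (a + 1)).prod inferInstance
    have hω : @Measurable (Ω × Y) Ω mΘ (history z u w (a + 1)) Prod.fst := @measurable_fst _ _ _ _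
    have hv : @Measurable (Ω × Y) Y mΘ _ Prod.snd := @measurable_snd _ _ _ _
    have hvi : ∀ i, Measurable[mΘ] fun q : Ω × Y => q.2 i := fun i =>
      (measurable_pi_apply i).comp hv
    have hdata : Measurable[mΘ] fun q : Ω × Y => blockData draw (p q.1) q.2 := by
      refine @measurable_pi_lambda _ _ _ mΘ _ _ fun i => ?_
      have hx : Measurable[mΘ] fun q : Ω × Y => (q.2 i).1.1 :=
        measurable_fst.comp (measurable_fst.comp (hvi i))
      have hd : Measurable[mΘ] fun q : Ω × Y => draw (p q.1 (q.2 i).1.1) (q.2 i).2.1 :=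
        hdraw.measurable.comp ((hk.comp (hω.prodMk hx)).prodMk
          (measurable_fst.comp (measurable_snd.comp (hvi i))))
      exact hx.prodMk (hd.prodMk (measurable_eval_uncurry.comp
        ((measurable_snd.comp (measurable_fst.comp (hvi i))).prodMk hd)))
    have hseed : Measurable[mΘ] fun q : Ω × Y => (q.2 l).2.2 :=
      measurable_snd.comp (measurable_snd.comp (hvi l))
    have hfst : @Measurable ((Ω × Y) × X) (Ω × Y) (mΘ.prod inferInstance) mΘ Prod.fst :=
      @measurable_fst _ _ _ _
    have hsnd : @Measurable ((Ω × Y) × X) X (mΘ.prod inferInstance) _ Prod.snd :=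
      @measurable_snd _ _ _ _
    have hq : Measurable[mΘ.prod inferInstance] fun y : (Ω × Y) × X => p y.1.1 y.2 :=
      hk.comp ((hω.comp hfst).prodMk hsnd)
    have hf : Measurable[mΘ.prod inferInstance] fun y : (Ω × Y) × X =>
        A.reg n (y.1.2 l).2.2 (blockData draw (p y.1.1) y.1.2) y.2 :=
      (hreg.measurable n).comp (((hseed.comp hfst).prodMk (hdata.comp hfst)).prodMk hsnd)
    have hM := @measurable_meanSqError_param X (Ω × Y) _ mΘ K D _ (fun q => p q.1)
      (fun q => A.reg n (q.2 l).2.2 (blockData draw (p q.1) q.2)) fstar hq hf hfstar.measurable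
    exact hM measurableSet_Ioi
  refine le_trans (measure_mono ?_) (measure_le_of_indep (pastSigma_le hξ (a + 1)) hblkm
    (indep_pastSigma_block hξ hrun.indep a n) hbadm fun ω => ?_)
  · rintro ω ⟨hsafe, herr⟩
    have hdata : blockData draw (p ω) (blk ω) = A.epochData (observation z act ω) (m + 1) := by
      funext i
      have hi := i.2
      have ht1 : 1 ≤ a + 1 + (i : ℕ) := by omega
      have hround : A.roundKernel (observation z act ω) (fun s => w s ω) (a + 1 + i) = p ω := by
        rw [Algorithm.roundKernel, if_pos (hsafe.mono (by omega)),
          epochOf_eq hτ (m := m) (by omega) (by omega)]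
      have hact := hrun.action (a + 1 + i) ht1 ω
      rw [hround] at hact
      simp only [blockData, hblk]
      rw [← hact]; rfl
    have hseed : (blk ω l).2.2 = w (tau A.τ₁ (m + 1)) ω := by
      simp only [hblk, hl]
      congr 1; omega
    show B + A.ξ n ζ < meanSqError D (p ω)
      (A.reg n (blk ω l).2.2 (blockData draw (p ω) (blk ω))) fstar
    rw [hdata, hseed]
    exact herr
  · rw [hlaw]
    have hmp := measurePreserving_blockData (D := D) (ρ := ρ) hdraw (hpk ω) l
    have := isProbabilityMeasure_inducedLaw (D := D) hdraw (hpk ω)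
    set good : Set (W × (Fin n → X × Fin K × ℝ)) :=
      {q | meanSqError D (p ω) (A.reg n q.1 q.2) fstar ≤ B + A.ξ n ζ} with hgood
    have hgoodm : MeasurableSet good := by
      have hM := measurable_meanSqError_param (D := D) (Θ := W × (Fin n → X × Fin K × ℝ))
        (q := fun _ => p ω) (f := fun q => A.reg n q.1 q.2) (g := fstar)
        ((hpk ω).measurable.comp measurable_snd) (hreg.measurable n) hfstar.measurable
      exact measurableSet_le hM measurable_const
    have hg := hguar (p ω) (A.kernel_mem_kernelClass hreg hpick hmax _ _ m) n hn1 ζ hζ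
    have hcompl : (ρ.prod (Measure.pi fun _ : Fin n => inducedLaw D (p ω))) goodᶜ
        ≤ ENNReal.ofReal ζ := by
      rw [prob_compl_eq_one_sub hgoodm]
      refine (tsub_le_tsub_left hg 1).trans ?_
      rw [← ENNReal.ofReal_one, ← ENNReal.ofReal_sub _ (by linarith [hζ.2]), sub_sub_cancel]
    refine le_trans (le_of_eq ?_) hcompl
    rw [← hmp.measure_preimage hgoodm.compl.nullMeasurableSet]
    congr 1
    ext v
    simp [hbad, hgood]

end Accuracy

/-! ### The regret bound -/

lemma sum_inv_sq_le_two (n : ℕ) : ∑ m ∈ Finset.range n, 1 / ((m + 1 : ℕ) : ℝ) ^ 2 ≤ 2 := by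
  have h : ∀ k : ℕ, ∑ m ∈ Finset.range (k + 1), 1 / ((m + 1 : ℕ) : ℝ) ^ 2
      ≤ 2 - 1 / ((k : ℝ) + 1) := by
    intro k
    induction k with
    | zero => norm_num
    | succ k ih =>
      rw [Finset.sum_range_succ]
      have hk : (0 : ℝ) ≤ k := Nat.cast_nonneg k
      have h1 : 1 / ((k + 1 + 1 : ℕ) : ℝ) ^ 2 ≤ 1 / ((k : ℝ) + 1) - 1 / ((k + 1 : ℕ) + 1) := by
        push_cast
        rw [div_sub_div _ _ (by positivity) (by positivity),
          div_le_div_iff₀ (by positivity) (by positivity)]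
        nlinarith
      linarith
  cases n with
  | zero => norm_num
  | succ k =>
    have : (0 : ℝ) ≤ 1 / ((k : ℝ) + 1) := by positivity
    linarith [h k]

lemma ofReal_one_sub_le {Ω : Type*} [MeasurableSpace Ω] {P : Measure Ω} [IsProbabilityMeasure P]
    {s : Set Ω} {δ : ℝ} (hδ : 0 ≤ δ) (h : P sᶜ ≤ ENNReal.ofReal δ) :
    ENNReal.ofReal (1 - δ) ≤ P s := by
  rw [ENNReal.ofReal_sub _ hδ, ENNReal.ofReal_one, tsub_le_iff_right]
  calc (1 : ENNReal) = P (s ∪ sᶜ) := by rw [Set.union_compl_self, measure_univ]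
    _ ≤ P s + P sᶜ := measure_union_le _ _
    _ ≤ _ := by gcongr

/-- The number `⌈m + 2 + log₂ τ₁⌉` in the threshold of epoch `m + 2`. It bounds the number of tests
in that epoch. -/
noncomputable def testIndex (τ₁ m : ℕ) : ℕ := ⌈((m + 2 : ℕ) : ℝ) + Real.logb 2 τ₁⌉₊

/-- A set of at most `testIndex τ₁ m` rounds that contains the test rounds of epoch `m + 2`. -/
noncomputable def testRounds (τ₁ m : ℕ) : Finset ℕ :=
  insert (tau τ₁ (m + 2))
    ((Finset.range (testIndex τ₁ m - 1)).image fun j => tau τ₁ (m + 1) + 2 ^ j)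

lemma le_testIndex {τ₁ : ℕ} (hτ : 2 ≤ τ₁) (m : ℕ) : m + 2 ≤ testIndex τ₁ m := by
  have hτ' : (1 : ℝ) ≤ τ₁ := by exact_mod_cast (by omega : 1 ≤ τ₁)
  have h : ((m + 2 : ℕ) : ℝ) + Real.logb 2 τ₁ ≤ testIndex τ₁ m := Nat.le_ceil _
  have h2 : 0 ≤ Real.logb 2 (τ₁ : ℝ) := Real.logb_nonneg (by norm_num) hτ'
  exact_mod_cast (by linarith : ((m + 2 : ℕ) : ℝ) ≤ testIndex τ₁ m)

lemma card_testRounds_le {τ₁ : ℕ} (hτ : 2 ≤ τ₁) (m : ℕ) :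
    (testRounds τ₁ m).card ≤ testIndex τ₁ m := by
  have h1 := Finset.card_insert_le (tau τ₁ (m + 2))
    ((Finset.range (testIndex τ₁ m - 1)).image fun j => tau τ₁ (m + 1) + 2 ^ j)
  have h2 := Finset.card_image_le (s := Finset.range (testIndex τ₁ m - 1))
    (f := fun j => tau τ₁ (m + 1) + 2 ^ j)
  rw [Finset.card_range] at h2
  have h3 := le_testIndex hτ m
  unfold testRounds
  omega

lemma Algorithm.IsTestRound.mem_testRounds {X W : Type*} {K : ℕ} {A : Algorithm X W K}
    (hτ : 2 ≤ A.τ₁) {t m : ℕ} (ht : A.IsTestRound t) (hm : epochOf A.τ₁ t = m + 2)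
    (h2 : t ≤ tau A.τ₁ (m + 2)) : t ∈ testRounds A.τ₁ m := by
  obtain ⟨-, ⟨j, hj⟩ | hj⟩ := ht
  · rw [hm, show m + 2 - 1 = m + 1 from rfl] at hj
    refine Finset.mem_insert_of_mem (Finset.mem_image.2 ⟨j, Finset.mem_range.2 ?_, hj.symm⟩)
    have hle : 2 ^ j ≤ 2 ^ m * A.τ₁ := by
      rw [hj, tau_succ_succ] at h2
      have : tau A.τ₁ (m + 1) = 2 ^ m * A.τ₁ := rfl
      omega
    have hτ' : (0 : ℝ) < A.τ₁ := by exact_mod_cast (by omega : 0 < A.τ₁)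
    have hlog : (j : ℝ) ≤ m + Real.logb 2 A.τ₁ := by
      have h3 : ((2 : ℝ) ^ j) ≤ 2 ^ m * A.τ₁ := by exact_mod_cast hle
      have h4 := Real.logb_le_logb_of_le (b := 2) (by norm_num) (by positivity) h3
      rwa [Real.logb_mul (by positivity) (by positivity), Real.logb_pow, Real.logb_pow,
        Real.logb_self_eq_one (by norm_num), mul_one, mul_one] at h4
    have h5 : ((m + 2 : ℕ) : ℝ) + Real.logb 2 A.τ₁ ≤ testIndex A.τ₁ m := Nat.le_ceil _
    have h6 : ((j + 2 : ℕ) : ℝ) ≤ testIndex A.τ₁ m := by push_cast at h5 ⊢; linarith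
    have h7 : j + 2 ≤ testIndex A.τ₁ m := by exact_mod_cast h6
    omega
  · rw [hm] at hj
    rw [hj]; exact Finset.mem_insert_self _ _

section Main

variable {X U W Ω : Type*} [MeasurableSpace X] [MeasurableSpace U] [MeasurableSpace W]
  [MeasurableSpace Ω] {K : ℕ} {A : Algorithm X W K} {D : Measure (X × (Fin K → ℝ))}
  [IsProbabilityMeasure D] {ν : Measure U} [IsProbabilityMeasure ν] {ρ : Measure W}
  [IsProbabilityMeasure ρ] {draw : (Fin K → ℝ) → U → Fin K} {P : Measure Ω}
  [IsProbabilityMeasure P]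
  {z : ℕ → Ω → X × (Fin K → ℝ)} {u : ℕ → Ω → U} {w : ℕ → Ω → W} {act : ℕ → Ω → Fin K}
  {fstar : X → Fin K → ℝ} {pol : X → Fin K} {F : Set (X → Fin K → ℝ)} {B : ℝ}

/-- The conditions of `GoodRun` hold with probability at least `1 - 12 δ'`: the exceptional events of
an epoch have total probability at most `6 δ' / (m + 1)²`. -/
lemma measure_not_goodRun_le (hτ : 2 ≤ A.τ₁) (hδ : A.δ ∈ Set.Ioo (0 : ℝ) 1)
    (hδτ : A.δ * Real.log A.τ₁ ≤ 100) (hD : ∀ᵐ z ∂D, ∀ a, z.2 a ∈ Set.Icc (0 : ℝ) 1)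
    (hfstar : IsMeanReward D fstar)
    (hF : ∀ f ∈ F, Measurable f ∧ ∀ x a, f x a ∈ Set.Icc (0 : ℝ) 1) (hreg : IsRegression F A.reg)
    (hpick : Measurable A.pick) (hmax : ∀ (v : Fin K → ℝ) (a : Fin K), v a ≤ v (A.pick v))
    (hξ : ValidRate A.ξ) (hguar : RegressionGuarantee D ρ F A.reg fstar B A.ξ)
    (hdraw : IsSampler ν draw) (hrun : IsRun A D ν ρ draw P z u w act) (T : ℕ) :
    P {ω | ¬ GoodRun A D fstar B T (observation z act ω) (fun s => w s ω)}
      ≤ ENNReal.ofReal (12 * A.δ') := by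
  have hδ' : 0 < A.δ' := div_pos hδ.1 (by norm_num)
  have hδ1 : A.δ' ≤ 1 / 13 := div_le_div_of_nonneg_right hδ.2.le (by norm_num)
  have hker : ∀ h w t, IsKernel (A.roundKernel h w t) := fun h w t => by
    unfold Algorithm.roundKernel
    split_ifs <;> exact Algorithm.isKernel_kernel hF hreg hpick hmax _ _ _
  have hdev := fun (s : Finset ℕ) (hs : ∀ t ∈ s, 1 ≤ t) (ε : ℝ) (hε : 0 ≤ ε) =>
    measure_reward_deviation_le hτ hreg hpick hdraw hrun hD hfstar hker s hs hε
  -- the exceptional events: inaccurate models, at the level of their own epoch and at that of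
  -- `exists_level_previous_rate`, and deviations of the rewards in epochs and up to tests
  set E : ℕ → Set Ω := fun m => {ω | A.SafeAfter (observation z act ω) (tau A.τ₁ (m + 1)) ∧
    B + epochRate A.ξ A.τ₁ A.δ' (m + 2) <
      meanSqError D (A.kernel (observation z act ω) (fun s => w s ω) (m + 1))
        (A.model (observation z act ω) (fun s => w s ω) (m + 2)) fstar} with hE
  set E' : ℕ → Set Ω := fun m => {ω | A.SafeAfter (observation z act ω) (tau A.τ₁ (m + 2)) ∧
    B + epochRate A.ξ A.τ₁ A.δ' (m + 2) <
      meanSqError D (A.kernel (observation z act ω) (fun s => w s ω) (m + 2))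
        (A.model (observation z act ω) (fun s => w s ω) (m + 3)) fstar} with hE'
  set R : ℕ → Set Ω := fun m => {ω | ((tau A.τ₁ (m + 1) - tau A.τ₁ m : ℕ) : ℝ) *
        √(1 / (2 * ((tau A.τ₁ (m + 1) - tau A.τ₁ m : ℕ) : ℝ))
          * Real.log (((m + 1 : ℕ) : ℝ) ^ 2 / A.δ')) <
      |∑ i ∈ Finset.Ioc (tau A.τ₁ m) (tau A.τ₁ (m + 1)), ((observation z act ω i).2.2 -
        value (D.map Prod.fst) (A.roundKernel (observation z act ω) (fun s => w s ω) i) fstar)|}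
    with hR
  set Q : ℕ → Set Ω := fun m => ⋃ t ∈ testRounds A.τ₁ m,
    {ω | √(2 * t * Real.log ((testIndex A.τ₁ m : ℝ) ^ 3 / A.δ')) <
      |∑ i ∈ Finset.Icc 1 t, ((observation z act ω i).2.2 -
        value (D.map Prod.fst) (A.roundKernel (observation z act ω) (fun s => w s ω) i) fstar)|}
    with hQ
  have hsq1 : ∀ k : ℕ, (1 : ℝ) ≤ ((k + 1 : ℕ) : ℝ) ^ 2 := fun k =>
    one_le_pow₀ (by exact_mod_cast Nat.le_add_left 1 k)
  have hmono : ∀ m : ℕ, A.δ' / ((m + 2 : ℕ) : ℝ) ^ 2 ≤ A.δ' / ((m + 1 : ℕ) : ℝ) ^ 2 := fun m =>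
    div_le_div_of_nonneg_left hδ'.le (lt_of_lt_of_le one_pos (hsq1 m))
      (pow_le_pow_left₀ (by positivity) (by exact_mod_cast Nat.le_succ (m + 1)) 2)
  have hPE : ∀ m, P (E m) ≤ ENNReal.ofReal (A.δ' / ((m + 1 : ℕ) : ℝ) ^ 2) := fun m => by
    refine le_trans ?_ (ENNReal.ofReal_le_ofReal (hmono m))
    exact measure_error_le hτ hF hreg hpick hmax hdraw hrun hfstar hguar m
      ⟨div_pos hδ' (lt_of_lt_of_le one_pos (hsq1 (m + 1))),
        (div_lt_one (lt_of_lt_of_le one_pos (hsq1 (m + 1)))).2 (by linarith [hsq1 (m + 1)])⟩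
  have hPE' : ∀ m, P (E' m) ≤ ENNReal.ofReal (A.δ' / ((m + 1 : ℕ) : ℝ) ^ 2) := fun m => by
    obtain ⟨ζ, hζ, hζle, hζξ⟩ := exists_level_previous_rate hξ hτ hδ hδτ m
    refine le_trans ?_ (ENNReal.ofReal_le_ofReal (hζle.trans (hmono m)))
    refine le_trans (measure_mono ?_) (measure_error_le hτ hF hreg hpick hmax hdraw hrun hfstar
      hguar (m + 1) hζ)
    rintro ω ⟨h1, h2⟩
    exact ⟨h1, lt_of_le_of_lt (add_le_add le_rfl hζξ) h2⟩
  have hPR : ∀ m, P (R m) ≤ ENNReal.ofReal (2 * (A.δ' / ((m + 1 : ℕ) : ℝ) ^ 2)) := fun m => by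
    have hn : (0 : ℝ) < ((tau A.τ₁ (m + 1) - tau A.τ₁ m : ℕ) : ℝ) := by
      exact_mod_cast Nat.sub_pos_of_lt (tau_strictMono hτ (Nat.lt_add_one m))
    have hlog := log_sq_div_pos (c := A.δ') ⟨hδ', by linarith⟩ m
    refine (hdev _ (fun t ht => by rw [Finset.mem_Ioc] at ht; omega) _
      (mul_nonneg hn.le (Real.sqrt_nonneg _))).trans (le_of_eq ?_)
    rw [Nat.card_Ioc]
    set n : ℝ := ((tau A.τ₁ (m + 1) - tau A.τ₁ m : ℕ) : ℝ)
    have e : -2 * (n * √(1 / (2 * n) * Real.log (((m + 1 : ℕ) : ℝ) ^ 2 / A.δ'))) ^ 2 / n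
        = -Real.log (((m + 1 : ℕ) : ℝ) ^ 2 / A.δ') := by
      rw [mul_pow, Real.sq_sqrt (by positivity)]; field_simp
    rw [e, Real.exp_neg, Real.exp_log (by positivity), inv_div, ENNReal.ofReal_mul zero_le_two,
      ENNReal.ofReal_ofNat]
  have hPQ : ∀ m, P (Q m) ≤ ENNReal.ofReal (2 * (A.δ' / ((m + 1 : ℕ) : ℝ) ^ 2)) := fun m => by
    set N := testIndex A.τ₁ m with hN
    have hNm : m + 2 ≤ N := le_testIndex hτ m
    have hN1 : (1 : ℝ) ≤ N := by exact_mod_cast (by omega : 1 ≤ N)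
    have hN3 : (1 : ℝ) ≤ (N : ℝ) ^ 3 := one_le_pow₀ hN1
    have hlog : 0 ≤ Real.log ((N : ℝ) ^ 3 / A.δ') :=
      Real.log_nonneg ((one_le_div hδ').2 (by linarith))
    have hone : ∀ t ∈ testRounds A.τ₁ m,
        P {ω | √(2 * t * Real.log ((N : ℝ) ^ 3 / A.δ')) <
          |∑ i ∈ Finset.Icc 1 t, ((observation z act ω i).2.2 - value (D.map Prod.fst)
            (A.roundKernel (observation z act ω) (fun s => w s ω) i) fstar)|}
          ≤ ENNReal.ofReal (2 * (A.δ' / (N : ℝ) ^ 3)) := by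
      intro t ht
      have ht0 : (0 : ℝ) < t := by
        have hpos : 0 < tau A.τ₁ (m + 2) := Nat.zero_lt_of_lt (tau_strictMono hτ (Nat.lt_add_one _))
        rcases Finset.mem_insert.1 ht with h1 | h1
        · rw [h1]; exact_mod_cast hpos
        · obtain ⟨j, -, rfl⟩ := Finset.mem_image.1 h1
          exact_mod_cast Nat.add_pos_right _ (by positivity)
      refine (hdev _ (fun i hi => (Finset.mem_Icc.1 hi).1) _ (Real.sqrt_nonneg _)).trans ?_
      rw [Nat.card_Icc, Nat.add_sub_cancel, Real.sq_sqrt (by positivity),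
        ENNReal.ofReal_mul zero_le_two, ENNReal.ofReal_ofNat]
      refine mul_le_mul_right (ENNReal.ofReal_le_ofReal ?_) _
      have e : -2 * (2 * t * Real.log ((N : ℝ) ^ 3 / A.δ')) / t
          = -(4 * Real.log ((N : ℝ) ^ 3 / A.δ')) := by field_simp; ring
      calc Real.exp (-2 * (2 * t * Real.log ((N : ℝ) ^ 3 / A.δ')) / t)
          ≤ Real.exp (-Real.log ((N : ℝ) ^ 3 / A.δ')) := by
            rw [e]; exact Real.exp_le_exp.2 (by linarith)
        _ = _ := by rw [Real.exp_neg, Real.exp_log (by positivity), inv_div]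
    calc P (Q m) ≤ ∑ t ∈ testRounds A.τ₁ m, ENNReal.ofReal (2 * (A.δ' / (N : ℝ) ^ 3)) :=
          (measure_biUnion_finset_le _ _).trans (Finset.sum_le_sum hone)
      _ = ENNReal.ofReal ((testRounds A.τ₁ m).card * (2 * (A.δ' / (N : ℝ) ^ 3))) := by
          rw [Finset.sum_const, nsmul_eq_mul, ENNReal.ofReal_mul (Nat.cast_nonneg _),
            ENNReal.ofReal_natCast]
      _ ≤ _ := by
          refine ENNReal.ofReal_le_ofReal ?_
          have hcard : ((testRounds A.τ₁ m).card : ℝ) ≤ N := by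
            exact_mod_cast card_testRounds_le hτ m
          calc ((testRounds A.τ₁ m).card : ℝ) * (2 * (A.δ' / (N : ℝ) ^ 3))
              ≤ N * (2 * (A.δ' / (N : ℝ) ^ 3)) := mul_le_mul_of_nonneg_right hcard (by positivity)
            _ = 2 * (A.δ' / (N : ℝ) ^ 2) := by field_simp
            _ ≤ _ := by
                refine mul_le_mul_of_nonneg_left ?_ zero_le_two
                refine div_le_div_of_nonneg_left hδ'.le (lt_of_lt_of_le one_pos (hsq1 m)) ?_
                exact pow_le_pow_left₀ (by positivity) (by exact_mod_cast (by omega : m + 1 ≤ N)) 2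
  have hsub : {ω | ¬ GoodRun A D fstar B T (observation z act ω) (fun s => w s ω)} ⊆
      ⋃ m ∈ Finset.range T, (E m ∪ E' m) ∪ (R m ∪ Q m) := by
    intro ω hω
    by_contra hnot
    simp only [Set.mem_iUnion, Finset.mem_range, not_exists] at hnot
    have hlt : ∀ {m}, tau A.τ₁ (m + 1) ≤ T → m < T := fun {m} hm =>
      lt_of_lt_of_le ((Nat.lt_add_one m).trans_le (tau_strictMono hτ).le_apply) hm
    refine hω ⟨fun m hm hs => ?_, fun m hm hs => ?_, fun m hm => ?_, fun t ht htest => ?_⟩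
    · by_contra! hc
      exact hnot m (hlt hm) (Or.inl (Or.inl ⟨hs, hc⟩))
    · by_contra! hc
      exact hnot m ((Nat.lt_succ_self m).trans (hlt hm)) (Or.inl (Or.inr ⟨hs, hc⟩))
    · by_contra! hc
      exact hnot m (hlt hm) (Or.inr (Or.inl hc))
    · have ht1 : 1 ≤ t := by
        by_contra! h0
        have h1 : epochOf A.τ₁ t ≤ 0 := Nat.sInf_le (by
          show t ≤ tau A.τ₁ 0
          omega)
        have := htest.1
        omega
      obtain ⟨m', hm', h1, h2⟩ := exists_epochOf_eq hτ ht1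
      obtain ⟨m, rfl⟩ : ∃ m, m' = m + 1 := ⟨m' - 1, by have := htest.1; omega⟩
      have hmem := htest.mem_testRounds hτ hm' h2
      by_contra! hc
      rw [hm'] at hc
      refine hnot m (hlt (h1.le.trans ht)) (Or.inr (Or.inr ?_))
      exact Set.mem_biUnion hmem hc
  calc P {ω | ¬ GoodRun A D fstar B T (observation z act ω) (fun s => w s ω)}
      ≤ ∑ m ∈ Finset.range T, P ((E m ∪ E' m) ∪ (R m ∪ Q m)) :=
        (measure_mono hsub).trans (measure_biUnion_finset_le _ _)
    _ ≤ ∑ m ∈ Finset.range T, ENNReal.ofReal (6 * A.δ' * (1 / ((m + 1 : ℕ) : ℝ) ^ 2)) := by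
        refine Finset.sum_le_sum fun m _ => ?_
        have hx : 0 ≤ A.δ' / ((m + 1 : ℕ) : ℝ) ^ 2 := by positivity
        calc P ((E m ∪ E' m) ∪ (R m ∪ Q m)) ≤ (P (E m) + P (E' m)) + (P (R m) + P (Q m)) :=
              (measure_union_le _ _).trans
                (add_le_add (measure_union_le _ _) (measure_union_le _ _))
          _ ≤ (ENNReal.ofReal (A.δ' / ((m + 1 : ℕ) : ℝ) ^ 2)
                + ENNReal.ofReal (A.δ' / ((m + 1 : ℕ) : ℝ) ^ 2))
              + (ENNReal.ofReal (2 * (A.δ' / ((m + 1 : ℕ) : ℝ) ^ 2))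
                + ENNReal.ofReal (2 * (A.δ' / ((m + 1 : ℕ) : ℝ) ^ 2))) :=
              add_le_add (add_le_add (hPE m) (hPE' m)) (add_le_add (hPR m) (hPQ m))
          _ = _ := by
              rw [← ENNReal.ofReal_add hx hx, ← ENNReal.ofReal_add (by positivity) (by positivity),
                ← ENNReal.ofReal_add (by positivity) (by positivity)]
              congr 1; ring
    _ = ENNReal.ofReal (6 * A.δ' * ∑ m ∈ Finset.range T, 1 / ((m + 1 : ℕ) : ℝ) ^ 2) := by
        rw [← ENNReal.ofReal_sum_of_nonneg fun m _ => by positivity, ← Finset.mul_sum]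
    _ ≤ _ := by
        refine ENNReal.ofReal_le_ofReal ?_
        have := mul_le_mul_of_nonneg_left (sum_inv_sq_le_two T) (by positivity : 0 ≤ 6 * A.δ')
        linarith

omit [MeasurableSpace X] [MeasurableSpace W] in
lemma regretRate_eq (T : ℕ) (c : ℝ) : regretRate K B A.ξ A.τ₁ c T =
    √((K : ℝ) * B) * T + √K * rateSum A.ξ A.τ₁ c T := rfl

/-- The regret bound with the internal confidence parameter. -/
theorem regret_bound (hτ : 2 ≤ A.τ₁) (hδ : A.δ ∈ Set.Ioo (0 : ℝ) 1)
    (hδτ : A.δ * Real.log A.τ₁ ≤ 100) (hD : ∀ᵐ z ∂D, ∀ a, z.2 a ∈ Set.Icc (0 : ℝ) 1)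
    (hfstar : IsMeanReward D fstar) (hpol : IsOptimalPolicy fstar pol)
    (hF : ∀ f ∈ F, Measurable f ∧ ∀ x a, f x a ∈ Set.Icc (0 : ℝ) 1) (hreg : IsRegression F A.reg)
    (hpick : Measurable A.pick) (hmax : ∀ (v : Fin K → ℝ) (a : Fin K), v a ≤ v (A.pick v))
    (hξ : ValidRate A.ξ) (hB : 0 ≤ B) (hguar : RegressionGuarantee D ρ F A.reg fstar B A.ξ)
    (hdraw : IsSampler ν draw) (hrun : IsRun A D ν ρ draw P z u w act) (T : ℕ) :
    ENNReal.ofReal (1 - A.δ) ≤ P {ω |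
      regret z act pol T ω ≤ 140 * (A.τ₁ + regretRate K B A.ξ A.τ₁ (A.δ / 13) T) ∧
      (A.τ₁ ^ 2 ≤ T → regret z act pol T ω ≤ 140 * regretRate K B A.ξ A.τ₁ (A.δ / 13) T)} := by
  have hδ' : 0 < A.δ' := div_pos hδ.1 (by norm_num)
  have hδ1 : A.δ' ≤ 1 / 13 := div_le_div_of_nonneg_right hδ.2.le (by norm_num)
  have hK1 : 1 ≤ √(K : ℝ) := Real.one_le_sqrt.2 A.one_le_K
  have hS0 := rateSum_nonneg (ξ := A.ξ) (τ₁ := A.τ₁) (c := A.δ') T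
  have hSK : rateSum A.ξ A.τ₁ A.δ' T ≤ √K * rateSum A.ξ A.τ₁ A.δ' T :=
    le_mul_of_one_le_left hS0 hK1
  have hKB : 0 ≤ √((K : ℝ) * B) * T := by positivity
  have hτ0 : (0 : ℝ) ≤ A.τ₁ := Nat.cast_nonneg _
  have hlate := fun hT => tau_one_le_rateSum hξ hτ hδ' hδ1 (t := T) hT
  -- a bound in terms of `τ₁` and the rate gives both claims
  have himp : ∀ ω, regret z act pol T ω ≤ 33 * A.τ₁ +
      71 * (√K * rateSum A.ξ A.τ₁ A.δ' T) + 105 * (√(K * B) * T) →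
      regret z act pol T ω ≤ 140 * (A.τ₁ + regretRate K B A.ξ A.τ₁ (A.δ / 13) T) ∧
      (A.τ₁ ^ 2 ≤ T → regret z act pol T ω ≤ 140 * regretRate K B A.ξ A.τ₁ (A.δ / 13) T) := by
    intro ω hω
    rw [regretRate_eq]
    change _ ≤ 140 * (A.τ₁ + (√(K * B) * T + √K * rateSum A.ξ A.τ₁ A.δ' T)) ∧
      (_ → _ ≤ 140 * (√(K * B) * T + √K * rateSum A.ξ A.τ₁ A.δ' T))
    refine ⟨by linarith, fun hT => ?_⟩
    have := hlate hT
    linarith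
  refine ofReal_one_sub_le hδ.1.le ?_
  by_cases hT : T ≤ 2 * A.τ₁
  · -- the regret is at most the number of rounds
    have hz : ∀ t, ∀ᵐ ω ∂P, ∀ a, (z t ω).2 a ∈ Set.Icc (0 : ℝ) 1 := by
      intro t
      have h1 : ∀ᵐ v ∂(P.map fun ω => (z t ω, u t ω, w t ω)), ∀ a, v.1.2 a ∈ Set.Icc (0 : ℝ) 1 := by
        rw [hrun.law t]
        exact Measure.quasiMeasurePreserving_fst.ae hD
      exact ae_of_ae_map (hrun.measurable t).aemeasurable h1
    refine le_trans (le_of_eq ?_) zero_le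
    rw [← mem_ae_iff]
    filter_upwards [ae_all_iff.2 hz] with ω hω
    refine himp ω ?_
    have h1 : regret z act pol T ω ≤ T := by
      unfold regret
      calc _ ≤ ∑ _t ∈ Finset.Icc 1 T, (1 : ℝ) := Finset.sum_le_sum fun t _ => by
            linarith [(hω t (pol (z t ω).1)).2, (hω t (act t ω)).1]
        _ = T := by simp
    have h2 : (T : ℝ) ≤ 2 * A.τ₁ := by exact_mod_cast hT
    have h3 : 0 ≤ √(K : ℝ) * rateSum A.ξ A.τ₁ A.δ' T := by positivity
    linarith
  · have hker : ∀ h w t, IsKernel (A.roundKernel h w t) := fun h w t => by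
      unfold Algorithm.roundKernel
      split_ifs <;> exact Algorithm.isKernel_kernel hF hreg hpick hmax _ _ _
    have hlog : 0 ≤ Real.log (1 / A.δ') := (one_le_log_inv hδ' hδ1).trans' zero_le_one
    have hT0 : (0 : ℝ) < T := by exact_mod_cast (by omega : 0 < T)
    have hfinal := measure_regret_deviation_le hτ hreg hpick hdraw hrun hD hfstar hker
      hpol.measurable T (Real.sqrt_nonneg (2 * T * Real.log (1 / A.δ')))
    have e : -√(2 * T * Real.log (1 / A.δ')) ^ 2 / (2 * T) = -Real.log (1 / A.δ') := by
      rw [Real.sq_sqrt (by positivity)]; field_simp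
    rw [e, Real.exp_neg, Real.exp_log (by positivity), inv_div, div_one] at hfinal
    have hgood := measure_not_goodRun_le hτ hδ hδτ hD hfstar hF hreg hpick hmax hξ hguar hdraw
      hrun T
    have htot : ENNReal.ofReal A.δ = ENNReal.ofReal (12 * A.δ') + ENNReal.ofReal A.δ' := by
      rw [← ENNReal.ofReal_add (by positivity) hδ'.le]
      congr 1; unfold Algorithm.δ'; ring
    rw [htot]
    refine le_trans (le_trans (measure_mono ?_) (measure_union_le _ _)) (add_le_add hgood hfinal)
    intro ω hω
    by_contra hnot
    rw [Set.mem_union, not_or] at hnot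
    obtain ⟨h1, h2⟩ := hnot
    refine hω (himp ω ?_)
    have hG : GoodRun A D fstar B T (observation z act ω) (fun s => w s ω) := not_not.1 h1
    have hdev : regret z act pol T ω - ∑ t ∈ Finset.Icc 1 T, kernelRegret (D.map Prod.fst) pol fstar
        (A.roundKernel (observation z act ω) (fun s => w s ω) t)
          ≤ √(2 * T * Real.log (1 / A.δ')) := not_lt.1 fun hc => h2 hc
    have hmodel : ∀ m, Measurable (A.model (observation z act ω) (fun s => w s ω) m) ∧
        ∀ x a, A.model (observation z act ω) (fun s => w s ω) m x a ∈ Set.Icc (0 : ℝ) 1 := by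
      intro m
      match m with
      | 0 => exact ⟨measurable_const, fun _ _ => ⟨le_rfl, zero_le_one⟩⟩
      | 1 => exact ⟨measurable_const, fun _ _ => ⟨le_rfl, zero_le_one⟩⟩
      | m + 2 => exact hF _ (hreg.mem _ _ _)
    have hS : Standing A D fstar pol B (observation z act ω) (fun s => w s ω) :=
      ⟨hτ, hδ, hpick, hmax, hξ, hfstar, hpol, hB, fun m => (hmodel m).1, fun m => (hmodel m).2⟩
    have hsum := hS.sum_regret_le hG
    obtain ⟨m, hm, h3, h4⟩ := exists_epochOf_eq hτ (by omega : 1 ≤ T)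
    obtain ⟨k, rfl⟩ : ∃ k, m = k + 2 := by
      refine ⟨m - 2, ?_⟩
      by_contra hne
      have : tau A.τ₁ (m + 1) ≤ tau A.τ₁ 2 := (tau_strictMono hτ).monotone (by omega)
      rw [tau_succ_succ, tau_one] at this
      omega
    -- the deviation of the realized regret is not larger than the width in the threshold
    have hwid := sqrt_log_ceil_le hξ hτ hδ' hδ1 h3 h4
    have hle : √(2 * T * Real.log (1 / A.δ')) ≤ √(2 * T * Real.log
        ((⌈((k + 3 : ℕ) : ℝ) + Real.logb 2 A.τ₁⌉₊ : ℝ) ^ 3 / A.δ')) := by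
      refine Real.sqrt_le_sqrt (mul_le_mul_of_nonneg_left ?_ (by positivity))
      refine Real.log_le_log (by positivity) (div_le_div_of_nonneg_right ?_ hδ'.le)
      have := le_testIndex hτ (k + 1)
      exact one_le_pow₀ (by exact_mod_cast (by omega : 1 ≤ testIndex A.τ₁ (k + 1)))
    linarith

omit [MeasurableSpace X] [MeasurableSpace W] in
/-- For rates that grow by at most a factor `c` from `ζ` to `ζ / 13`, the internal confidence
parameter can be replaced by `δ`. -/
lemma regretRate_div_thirteen_le (hτ : 2 ≤ A.τ₁) (hδ : A.δ ∈ Set.Ioo (0 : ℝ) 1) {c : ℝ}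
    (hc : 1 ≤ c)
    (hξ : ∀ n : ℕ, 1 ≤ n → ∀ ζ ∈ Set.Ioc (0 : ℝ) (1 / 4), A.ξ n (ζ / 13) ≤ c * A.ξ n ζ) (T : ℕ) :
    regretRate K B A.ξ A.τ₁ (A.δ / 13) T ≤ √c * regretRate K B A.ξ A.τ₁ A.δ T := by
  have hc1 : 1 ≤ √c := Real.one_le_sqrt.2 hc
  rw [regretRate_eq, regretRate_eq, mul_add]
  refine add_le_add (le_mul_of_one_le_left (by positivity) hc1) ?_
  rw [mul_left_comm]
  refine mul_le_mul_of_nonneg_left ?_ (Real.sqrt_nonneg _)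
  rw [rateSum, rateSum, Finset.mul_sum]
  refine Finset.sum_le_sum fun i hi => ?_
  rw [Finset.mem_Icc] at hi
  rw [← Real.sqrt_mul (by linarith)]
  refine Real.sqrt_le_sqrt ?_
  obtain ⟨m, hm, h1, h2⟩ := exists_epochOf_eq hτ (by omega : 1 ≤ i)
  cases m with
  | zero => rw [zero_add, tau_one] at h2; omega
  | succ m =>
    rw [hm]
    have hn : 1 ≤ tau A.τ₁ (m + 1) - tau A.τ₁ m := by
      have := tau_strictMono hτ (Nat.lt_add_one m)
      omega
    have h4 : (4 : ℝ) ≤ ((m + 2 : ℕ) : ℝ) ^ 2 := by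
      have : (2 : ℝ) ≤ ((m + 2 : ℕ) : ℝ) := by exact_mod_cast Nat.le_add_left 2 m
      nlinarith
    have h := hξ _ hn (A.δ / ((m + 2 : ℕ) : ℝ) ^ 2) ⟨div_pos hδ.1 (by linarith), by
      rw [div_le_iff₀ (by linarith)]; linarith [hδ.2]⟩
    rw [div_right_comm] at h
    exact h

end Main

end SafeFalcon

theorem theorem1 :
    ∃ C : ℝ, 0 < C ∧
      ∀ (K : ℕ) (X U W Ω : Type*)
        [MeasurableSpace X] [MeasurableSpace U] [MeasurableSpace W] [MeasurableSpace Ω]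
        -- the environment
        (D : Measure (X × (Fin K → ℝ))) [IsProbabilityMeasure D]
        (_hD : ∀ᵐ z ∂D, ∀ a, z.2 a ∈ Set.Icc (0 : ℝ) 1)
        (fstar : X → Fin K → ℝ) (_hfstar : SafeFalcon.IsMeanReward D fstar)
        (pol : X → Fin K) (_hpol : SafeFalcon.IsOptimalPolicy fstar pol)
        -- the model class
        (F : Set (X → Fin K → ℝ))
        (_hF : ∀ f ∈ F, Measurable f ∧ ∀ x a, f x a ∈ Set.Icc (0 : ℝ) 1)
        -- the laws of the seeds
        (ν : Measure U) [IsProbabilityMeasure ν] (ρ : Measure W) [IsProbabilityMeasure ρ]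
        -- the algorithm
        (A : SafeFalcon.Algorithm X W K)
        (_hτ : 2 ≤ A.τ₁) (_hδ : A.δ ∈ Set.Ioo (0 : ℝ) 1) (_hδτ : A.δ * Real.log A.τ₁ ≤ 100)
        (_hpick : Measurable A.pick ∧ ∀ (v : Fin K → ℝ) (a : Fin K), v a ≤ v (A.pick v))
        -- the assumption on the regression algorithm
        (_hreg : SafeFalcon.IsRegression F A.reg) (_hξ : SafeFalcon.ValidRate A.ξ)
        (B : ℝ) (_hB : 0 ≤ B)
        (_hguar : SafeFalcon.RegressionGuarantee D ρ F A.reg fstar B A.ξ)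
        -- a run of the algorithm
        (draw : (Fin K → ℝ) → U → Fin K) (_hdraw : SafeFalcon.IsSampler ν draw)
        (P : Measure Ω) [IsProbabilityMeasure P]
        (z : ℕ → Ω → X × (Fin K → ℝ)) (u : ℕ → Ω → U) (w : ℕ → Ω → W) (act : ℕ → Ω → Fin K)
        (_hrun : SafeFalcon.IsRun A D ν ρ draw P z u w act),
        -- the bound with the internal confidence parameter, for every valid rate
        (∀ T : ℕ, ENNReal.ofReal (1 - A.δ) ≤ P {ω |
            SafeFalcon.regret z act pol T ω
                ≤ C * (A.τ₁ + SafeFalcon.regretRate K B A.ξ A.τ₁ (A.δ / 13) T) ∧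
            (A.τ₁ ^ 2 ≤ T → SafeFalcon.regret z act pol T ω
                ≤ C * SafeFalcon.regretRate K B A.ξ A.τ₁ (A.δ / 13) T)}) ∧
        -- the bound with `δ` itself, for rates that grow by at most a factor `c` from `ζ` to `ζ/13`
        (∀ c : ℝ, 1 ≤ c →
          (∀ n : ℕ, 1 ≤ n → ∀ ζ ∈ Set.Ioc (0 : ℝ) (1 / 4), A.ξ n (ζ / 13) ≤ c * A.ξ n ζ) →
          ∀ T : ℕ, ENNReal.ofReal (1 - A.δ) ≤ P {ω |
            SafeFalcon.regret z act pol T ω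
                ≤ C * √c * (A.τ₁ + SafeFalcon.regretRate K B A.ξ A.τ₁ A.δ T) ∧
            (A.τ₁ ^ 2 ≤ T → SafeFalcon.regret z act pol T ω
                ≤ C * √c * SafeFalcon.regretRate K B A.ξ A.τ₁ A.δ T)}) := by
  refine ⟨140, by norm_num, ?_⟩
  intro K X U W Ω _ _ _ _ D _ hD fstar hfstar pol hpol F hF ν _ ρ _ A hτ hδ hδτ hpick hreg hξ B hB
    hguar draw hdraw P _ z u w act hrun
  have h := SafeFalcon.regret_bound hτ hδ hδτ hD hfstar hpol hF hreg hpick.1 hpick.2 hξ hB hguar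
    hdraw hrun
  refine ⟨h, fun c hc hξc T => (h T).trans (measure_mono fun ω hω => ?_)⟩
  have hrate := SafeFalcon.regretRate_div_thirteen_le (B := B) hτ hδ hc hξc T
  have hc1 : (A.τ₁ : ℝ) ≤ √c * A.τ₁ :=
    le_mul_of_one_le_left (Nat.cast_nonneg _) (Real.one_le_sqrt.2 hc)
  exact ⟨hω.1.trans (by linarith), fun hT => (hω.2 hT).trans (by linarith)⟩
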